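/- Conventions. It is NP-hard to distinguish two classes of instances (``Yes'' and ``No'') if every language in NP has a polynomial-time many-one reduction sending members to Yes-instances and non-members to No-instances. Numbers are encoded in binary. Johnson Coverage. Let $z>y\ge 1$ be integers and let $\alpha\in\mathbb R$. An instance of the $(\alpha,z,y)$-Johnson Coverage problem is a triple $(U,E,k)$ with $U=[n]$, a nonempty collection $E\subseteq\binom{[n]}{z}$ and an integer $k\ge 1$. It is a Yes-instance if there are $S_1,\dots,S_k\in\binom{[n]}{y}$ such that every $T\in E$ contains some $S_i$. It is a No-instance if for all $S_1,\dots,S_k\in\binom{[n]}{y}$ at most $\alpha|E|$ sets $T\in E$ contain some $S_i$. We say that $(\alpha,z,y)$-Johnson Coverage$^*$ is NP-hard if there is a function $f:\mathbb N\to\mathbb R$ with $f(m)\to\infty$ as $m\to\infty$ such that it is NP-hard to distinguish the Yes-instances with $|E|\ge f(|U|)\cdot k\cdot|U|^{z-y-1}$ from the No-instances with $|E|\ge f(|U|)\cdot k\cdot|U|^{z-y-1}$. The hypothesis $\mathsf{JCH}^*$ states that for every $\varepsilon>0$ there is $z\ge 2$ such that $(1-\frac1e+\varepsilon,z,z-1)$-Johnson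 Coverage$^*$ is NP-hard. Theorem. (a) Suppose that $(\alpha,z,y)$-Johnson Coverage$^*$ is NP-hard. Then for every constant $\varepsilon>0$ there is a constant $C$ such that, given a nonempty set $P\subset\mathbb R^d$ of $n$ points with rational coordinates, where $d\le C\log n$, and an integer $k\ge 1$, it is NP-hard to distinguish between the following two cases: * Completeness: there are $c_1,\dots,c_k\in\mathbb R^d$ and $\sigma:P\to\{c_1,\dots,c_k\}$ with $\sum_{a\in P}\|a-\sigma(a)\|_2\le n$. * Soundness: for all $c_1,\dots,c_k\in\mathbb R^d$ and all $\sigma:P\to\{c_1,\dots,c_k\}$, $$\sum_{a\in P}\|a-\sigma(a)\|_2\ \ge\ \left(\alpha+\sqrt{\frac{z-y+0.5}{z-y}}\,(1-\alpha)-\varepsilon\right)n .$$ (b) Suppose that $\mathsf{JCH}^*$ holds. Then for every constant $\varepsilon>0$ there is a constant $C$ such that the conclusion of (a) holds with the factor in the soundness case replaced by $1-\frac1e+\frac{\sqrt{3/2}}{e}-\varepsilon$ (where $1-\frac1e+\frac{\sqrt{3/2}}{e}\approx 1.08$). -/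

import Mathlib

/-! ### Encodings over a fixed finite alphabet

Machine inputs and outputs are strings over Mathlib's standard alphabet `Computability.Γ'`, whose
symbols are `blank`, `bit b`, `bra`, `ket` and `comma`. Numbers are written in binary. -/

namespace JCov

open Computability (Γ')

/-- A natural number in binary. -/
def encNat (n : ℕ) : List Γ' :=
  Computability.encodingNatΓ'.encode n

/-- A rational number: its sign, and numerator and denominator (in lowest terms) in binary. -/
def encRat (q : ℚ) : List Γ' :=
  Γ'.bra :: Γ'.bit (decide (q < 0)) ::
    (encNat q.num.natAbs ++ Γ'.comma :: encNat q.den ++ [Γ'.ket])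

/-- A bracketed list, each entry being followed by a comma. -/
def encList {α : Type} (e : α → List Γ') (l : List α) : List Γ' :=
  Γ'.bra :: (l.flatMap (fun a => e a ++ [Γ'.comma]) ++ [Γ'.ket])

/-! ### Polynomial time, NP, and NP-hardness of promise problems

Polynomial-time computability is Mathlib's `Turing.TM2ComputableInPolyTime`: computability by a
(multi-stack) Turing machine in a number of steps that is polynomial in the length of the input. -/

/-- `L` is in NP: membership has certificates of polynomial length that are checked by a
deterministic polynomial-time machine. -/
def InNP (L : Set (List Bool)) : Prop :=
  ∃ (V : List Bool × List Bool → Bool) (p : Polynomial ℕ),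
    Nonempty (Turing.TM2ComputableInPolyTime
      (Computability.encodingProd (Computability.encodingList Bool)
        (Computability.encodingList Bool)).encode
      Computability.encodeBool V) ∧
    ∀ x : List Bool, x ∈ L ↔ ∃ w : List Bool, w.length ≤ p.eval x.length ∧ V (x, w) = true

/-- It is NP-hard to distinguish the instances in `yes` from the instances in `no`: every language
in NP has a polynomial-time many-one (Karp) reduction that maps members to `yes` instances and
non-members to `no` instances. Instances are written as strings by `enc`. -/
def NPHardToDistinguish {ι : Type} (enc : ι → List Γ') (yes no : Set ι) : Prop :=
  ∀ L : Set (List Bool), InNP L →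
    ∃ f : List Bool → ι,
      Nonempty (Turing.TM2ComputableInPolyTime
        (Computability.encodingList Bool).encode enc f) ∧
      ∀ x : List Bool, (x ∈ L → f x ∈ yes) ∧ (x ∉ L → f x ∈ no)

/-! ### The Johnson Coverage problem -/

/-- Raw instance data: the universe is `[n] = {1, …, n}`, and `sets` lists the sets of the
collection `E`, each as a list of its elements. -/
structure JohnsonInstance where
  n : ℕ
  k : ℕ
  sets : List (List ℕ)

namespace JohnsonInstance

def enc (I : JohnsonInstance) : List Γ' :=
  encNat I.n ++ Γ'.comma :: encNat I.k ++ Γ'.comma :: encList (encList encNat) I.sets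

/-- The collection `E`. -/
def E (I : JohnsonInstance) : Finset (Finset ℕ) :=
  (I.sets.map List.toFinset).toFinset

/-- `I.sets` lists, without repetition, the sets of a nonempty collection of `z`-element subsets
of `[n]`, each given as the increasing list of its elements; and `k` is positive. -/
def IsValid (z : ℕ) (I : JohnsonInstance) : Prop :=
  0 < I.k ∧ I.sets ≠ [] ∧ I.sets.Nodup ∧
    ∀ T ∈ I.sets, T.Pairwise (· < ·) ∧ T.length = z ∧ ∀ i ∈ T, 1 ≤ i ∧ i ≤ I.n

end JohnsonInstance

/-- `cov(S, E)`: the members of `E` that contain `S`. -/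
def cov (S : Finset ℕ) (E : Finset (Finset ℕ)) : Finset (Finset ℕ) :=
  E.filter (fun T => S ⊆ T)

/-- The members of `E` covered by the family `S₁, …, S_k`. -/
def covFamily {k : ℕ} (S : Fin k → Finset ℕ) (E : Finset (Finset ℕ)) : Finset (Finset ℕ) :=
  Finset.univ.biUnion (fun j => cov (S j) E)

/-- Completeness case: some `k` subsets of `[n]` of size `y` cover all of `E`. -/
def johnsonYes (z y : ℕ) : Set JohnsonInstance :=
  {I | I.IsValid z ∧ ∃ S : Fin I.k → Finset ℕ,
    (∀ j, S j ∈ (Finset.Icc 1 I.n).powersetCard y) ∧ covFamily S I.E = I.E}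

/-- Soundness case: any `k` subsets of `[n]` of size `y` cover at most `α |E|` members of `E`. -/
def johnsonNo (α : ℝ) (z y : ℕ) : Set JohnsonInstance :=
  {I | I.IsValid z ∧ ∀ S : Fin I.k → Finset ℕ,
    (∀ j, S j ∈ (Finset.Icc 1 I.n).powersetCard y) →
      ((covFamily S I.E).card : ℝ) ≤ α * (I.E.card : ℝ)}

/-- Instances with `|E| ≥ f(|U|) · k · |U| ^ (z - y - 1)`. -/
def johnsonDense (f : ℕ → ℝ) (z y : ℕ) : Set JohnsonInstance :=
  {I | f I.n * ((I.k : ℝ) * (I.n : ℝ) ^ (z - y - 1)) ≤ (I.E.card : ℝ)}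

/-- `(α, z, y)`-Johnson Coverage* is NP-hard: the `(α, z, y)`-Johnson Coverage problem is NP-hard
on instances with `|E| = ω(k · |U| ^ (z - y - 1))`. -/
def JohnsonCoverageStarNPHard (α : ℝ) (z y : ℕ) : Prop :=
  ∃ f : ℕ → ℝ, Filter.Tendsto f Filter.atTop Filter.atTop ∧
    NPHardToDistinguish JohnsonInstance.enc
      (johnsonYes z y ∩ johnsonDense f z y) (johnsonNo α z y ∩ johnsonDense f z y)

/-- The dense Johnson Coverage Hypothesis JCH*. -/
def JCHStar : Prop :=
  ∀ ε : ℝ, 0 < ε → ∃ z : ℕ, 2 ≤ z ∧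
    JohnsonCoverageStarNPHard (1 - 1 / Real.exp 1 + ε) z (z - 1)

/-! ### Continuous Euclidean `k`-median -/

/-- Raw instance data: a list of points of `ℝ^d` with rational coordinates, and the number `k` of
centers. -/
structure MedianInstance where
  d : ℕ
  k : ℕ
  points : List (Fin d → ℚ)

namespace MedianInstance

def enc (I : MedianInstance) : List Γ' :=
  encNat I.d ++ Γ'.comma :: encNat I.k ++ Γ'.comma ::
    encList (encList encRat) (I.points.map List.ofFn)

/-- The point set `P`. -/
def P (I : MedianInstance) : Finset (Fin I.d → ℚ) :=
  I.points.toFinset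

/-- The points are listed without repetition, there is at least one, `k` is positive, and the
dimension satisfies `d ≤ C log |P|`. -/
def IsValid (C : ℝ) (I : MedianInstance) : Prop :=
  0 < I.k ∧ I.points ≠ [] ∧ I.points.Nodup ∧ (I.d : ℝ) ≤ C * Real.log (I.P.card : ℝ)

end MedianInstance

/-- A rational point, as a point of Euclidean space. -/
noncomputable def toEuclidean {d : ℕ} (a : Fin d → ℚ) : EuclideanSpace ℝ (Fin d) :=
  WithLp.toLp 2 (fun i => (a i : ℝ))

/-- The cost `∑_{a ∈ P} ‖a - σ(a)‖₂` of the centers `c₁, …, c_k` under the assignment `σ` of points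
to (indices of) centers. -/
noncomputable def medianCost {d k : ℕ} (P : Finset (Fin d → ℚ))
    (c : Fin k → EuclideanSpace ℝ (Fin d)) (σ : (Fin d → ℚ) → Fin k) : ℝ :=
  ∑ a ∈ P, ‖toEuclidean a - c (σ a)‖

/-- Completeness case: some `k` centers in `ℝ^d` and some assignment have cost at most `|P|`. -/
def medianYes (C : ℝ) : Set MedianInstance :=
  {I | I.IsValid C ∧ ∃ (c : Fin I.k → EuclideanSpace ℝ (Fin I.d)) (σ : (Fin I.d → ℚ) → Fin I.k),
    medianCost I.P c σ ≤ (I.P.card : ℝ)}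

/-- Soundness case: all `k` centers in `ℝ^d` and all assignments have cost at least `β |P|`. -/
def medianNo (C β : ℝ) : Set MedianInstance :=
  {I | I.IsValid C ∧
    ∀ (c : Fin I.k → EuclideanSpace ℝ (Fin I.d)) (σ : (Fin I.d → ℚ) → Fin I.k),
      β * (I.P.card : ℝ) ≤ medianCost I.P c σ}

/-- In dimension `O(log n)`, where `n` is the number of points, it is NP-hard to distinguish
continuous Euclidean `k`-median cost at most `n` from cost at least `β n`. -/
def MedianNPHardWithin (β : ℝ) : Prop :=
  ∃ C : ℝ, NPHardToDistinguish MedianInstance.enc (medianYes C) (medianNo C β)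

end JCov

/-! Geometry. Give the elements `i` of the universe nearly orthogonal vectors `v i` of equal squared
length `r`, slightly below `1 / (z - y)`, and represent a set `T` by the point `∑ i ∈ T, v i`. If
`T` contains a `y`-set `S`, the sum over `S` is at squared distance about `r (z - y)`, hence at most
1, from the point of `T` (`NearlyOrthogonal.norm_sub_sq_le`), so a cover yields centers of cost at
most `|E|`.

Conversely, let `c` be any center. Near orthogonality forces the set `B` of elements with `⟨v i, c⟩
> τ` to have fewer than a constant number `m` of elements (`NearlyOrthogonal.card_lt`). If `|T ∩ B|
≤ y`, then up to small errors the squared distance from `c` to the point of `T` is at least `r (z -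
|T ∩ B|)` plus the squared distance from `c` to the sum over `T ∩ B`. This is at least `r (z - y)`,
and even `r (z - y + 1/2)` unless `T ∩ B` is a `y`-set whose sum is at squared distance less than
about `r / 2` from `c`. Sums over two distinct `y`-sets are at squared distance about `2 r` or more,
so by the parallelogram law at most one `y`-set `S` is that close, and `c` serves cheaply only sets
containing `S`. Thus `k` centers act like `k` `y`-sets, and the bound on their coverage gives the
factor (`NearlyOrthogonal.exists_set_of_center`, `NearlyOrthogonal.le_sum_dist`). The sets with `|T
∩ B| > y` number at most `2 ^ m * n ^ (z - y - 1)` per center, which the density assumption makes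
negligible.

Construction. The vectors are scaled sign vectors, chosen greedily among all words of length `D = 4
^ (e + s)`. Since `D` is logarithmic in `|E|`, all `2 ^ D` words can be listed in polynomial time,
and a Chernoff bound with a Gilbert–Varshamov count shows that the greedy code is large enough
(`dimExp_length_greedy`). As `D` is a power of 4, its square root is a power of 2 and the
coordinates are dyadic rationals.

Machines. The given reduction is an arbitrary polynomial-time machine; it is extended by a
structured program (`comp_prog`), and such programs are obtained from closure properties of
polynomial-time functions on trees (`PTF`, `comp_ptf`).

Degenerate cases. Density says nothing about universes of at most `n₀` elements, but only finitely
many valid instances of this kind are not Yes-instances, so their answers are hardwired. If `α ≥ 1`,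
the claimed factor is below 1 and one fixed instance does. Part (b) is part (a) with `z - y = 1`. -/

namespace PolyTime

/-! ### Structured programs and their compilation to multi-stack machines. -/

open Turing
open Computability (Γ')

/-- The four work stacks of a structured program. -/
inductive Tape
  | main | a | b | c
  deriving DecidableEq

instance : Fintype Tape := ⟨{.main, .a, .b, .c}, by intro x; cases x <;> decide⟩

/-- The contents of the four work stacks. -/
def stk (m a b c : List Γ') : Tape → List Γ'
  | .main => m
  | .a => a
  | .b => b
  | .c => c

/-- Structured programs over the work stacks. -/
inductive Prog
  | skip : Prog
  | push (k : Tape) (x : Γ') : Prog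
  | seq (p q : Prog) : Prog
  | case (k : Tape) (f : Option Γ' → Prog) : Prog
  | loop (k : Tape) (f : Γ' → Prog) : Prog

/-- Big-step semantics with the number of steps: `case` pops a symbol and branches on it, `loop`
pops symbols and runs its body on each of them until the stack is empty. -/
inductive Runs : Prog → (Tape → List Γ') → (Tape → List Γ') → ℕ → Prop
  | skip S : Runs .skip S S 1
  | push k x S : Runs (.push k x) S (Function.update S k (x :: S k)) 1
  | seq {p q S S' S'' t t'} : Runs p S S' t → Runs q S' S'' t' → Runs (.seq p q) S S'' (t + t')
  | case {k f S S' t} : Runs (f (S k).head?) (Function.update S k (S k).tail) S' t →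
      Runs (.case k f) S S' (t + 1)
  | loop_nil {k f S} : S k = [] → Runs (.loop k f) S S 1
  | loop_cons {k f S x l S' S'' t t'} : S k = x :: l → Runs (f x) (Function.update S k l) S' t →
      Runs (.loop k f) S' S'' t' → Runs (.loop k f) S S'' (t + t' + 1)

/-- The control positions of a program. -/
def Lab : Prog → Type
  | .skip => Unit
  | .push _ _ => Unit
  | .seq p q => Lab p ⊕ Lab q
  | .case _ f => Option (Σ o, Lab (f o))
  | .loop _ f => Option (Σ x, Lab (f x))

@[reducible] noncomputable def Lab.fintype : ∀ p : Prog, Fintype (Lab p)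
  | .skip => inferInstanceAs (Fintype Unit)
  | .push _ _ => inferInstanceAs (Fintype Unit)
  | .seq p q =>
    letI := Lab.fintype p
    letI := Lab.fintype q
    inferInstanceAs (Fintype (Lab p ⊕ Lab q))
  | .case _ f =>
    letI := fun o => Lab.fintype (f o)
    inferInstanceAs (Fintype (Option (Σ o, Lab (f o))))
  | .loop _ f =>
    letI := fun o => Lab.fintype (f o)
    inferInstanceAs (Fintype (Option (Σ x, Lab (f x))))

/-- The first control position of a program. -/
def entry : ∀ p : Prog, Lab p
  | .skip => ()
  | .push _ _ => ()
  | .seq p _ => Sum.inl (entry p)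
  | .case _ _ => none
  | .loop _ _ => none

section Compile

variable {K₁ : Type} (Γ₁ : K₁ → Type) (σ₁ : Type) {Λ : Type}

/-- The stack alphabets of a machine with the work stacks added. -/
abbrev Alph : K₁ ⊕ Tape → Type := Sum.elim Γ₁ (fun _ => Γ')

/-- The statement at each control position of a program that is embedded in a larger machine and
continues at `ex`. -/
def compile : ∀ p : Prog, (Lab p → Λ) → Λ → Lab p → TM2.Stmt (Alph Γ₁) Λ (σ₁ × Option Γ')
  | .skip, _, ex, _ => .goto fun _ => ex
  | .push k x, _, ex, _ => .push (Sum.inr k) (fun _ => x) (.goto fun _ => ex)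
  | .seq p q, emb, ex, .inl l => compile p (fun l => emb (.inl l)) (emb (.inr (entry q))) l
  | .seq _ q, emb, ex, .inr l => compile q (fun l => emb (.inr l)) ex l
  | .case k f, emb, _, none =>
    .pop (Sum.inr k) (fun v o => (v.1, o)) (.goto fun v => emb (some ⟨v.2, entry (f v.2)⟩))
  | .case _ f, emb, ex, some ⟨o, l⟩ => compile (f o) (fun l => emb (some ⟨o, l⟩)) ex l
  | .loop k f, emb, ex, none =>
    .pop (Sum.inr k) (fun v o => (v.1, o))
      (.goto fun v => match v.2 with
        | none => ex
        | some x => emb (some ⟨x, entry (f x)⟩))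
  | .loop _ f, emb, _, some ⟨x, l⟩ => compile (f x) (fun l => emb (some ⟨x, l⟩)) (emb none) l

variable {Γ₁ σ₁}

/-- Stacks of the combined machine. -/
def join (S₁ : ∀ k, List (Γ₁ k)) (S : Tape → List Γ') : ∀ k, List (Alph Γ₁ k)
  | .inl k => S₁ k
  | .inr k => S k

variable [DecidableEq K₁]

theorem update_join_inr (S₁ : ∀ k, List (Γ₁ k)) (S : Tape → List Γ') (k : Tape) (l : List Γ') :
    Function.update (join S₁ S) (Sum.inr k) l = join S₁ (Function.update S k l) := by
  funext j
  rcases j with j | j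
  · exact Function.update_of_ne Sum.inl_ne_inr _ _
  · by_cases h : j = k
    · subst h
      exact (Function.update_self (β := fun k => List (Alph Γ₁ k)) (Sum.inr j) l _).trans
        (Function.update_self (β := fun _ => List Γ') j l _).symm
    · exact (Function.update_of_ne (fun e => h (Sum.inr.inj e)) _ _).trans
        (Function.update_of_ne (β := fun _ => List Γ') h l S).symm

theorem update_join_inl (S₁ : ∀ k, List (Γ₁ k)) (S : Tape → List Γ') (k : K₁)
    (l : List (Γ₁ k)) :
    Function.update (join S₁ S) (Sum.inl k) l = join (Function.update S₁ k l) S := by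
  funext j
  rcases j with j | j
  · by_cases h : j = k
    · subst h
      exact (Function.update_self (β := fun k => List (Alph Γ₁ k)) (Sum.inl j) l _).trans
        (Function.update_self (β := fun k => List (Γ₁ k)) j l _).symm
    · exact (Function.update_of_ne (fun e => h (Sum.inl.inj e)) _ _).trans
        (Function.update_of_ne (β := fun k => List (Γ₁ k)) h l S₁).symm
  · exact Function.update_of_ne Sum.inr_ne_inl _ _

/-- `c'` is the configuration `t` steps after `c`. -/
def Steps {K : Type} [DecidableEq K] {Γ : K → Type} {Λ σ : Type} (m : Λ → TM2.Stmt Γ Λ σ)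
    (c : TM2.Cfg Γ Λ σ) (t : ℕ) (c' : TM2.Cfg Γ Λ σ) : Prop :=
  (flip bind (TM2.step m))^[t] (some c) = some c'

section Steps
variable {K : Type} [DecidableEq K] {Γ : K → Type} {Λ σ : Type} {m : Λ → TM2.Stmt Γ Λ σ}
  {c c' c'' : TM2.Cfg Γ Λ σ} {s t : ℕ}

theorem Steps.trans (h : Steps m c s c') (h' : Steps m c' t c'') : Steps m c (s + t) c'' := by
  unfold Steps at *
  rw [add_comm, Function.iterate_add_apply, h, h']

theorem Steps.one {l : Λ} {v : σ} {S : ∀ k, List (Γ k)} {q : TM2.Stmt Γ Λ σ} (h : m l = q)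
    (h' : TM2.stepAux q v S = c') : Steps m ⟨some l, v, S⟩ 1 c' := by
  subst h h'
  rfl

end Steps

/-- Compilation preserves the number of steps and touches neither the stacks `S₁` nor the register
of the host machine. The induction is on the run, not on the program, because a run of a loop
contains a shorter run of the same loop; the embedding of labels and the exit label vary along it.
-/
theorem compile_correct {m : Λ → TM2.Stmt (Alph Γ₁) Λ (σ₁ × Option Γ')} (S₁ : ∀ k, List (Γ₁ k))
    {p : Prog} {S S' : Tape → List Γ'} {t : ℕ} (hr : Runs p S S' t) :
    ∀ (emb : Lab p → Λ) (ex : Λ), (∀ l, m (emb l) = compile Γ₁ σ₁ p emb ex l) →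
      ∀ v, ∃ v' : σ₁ × Option Γ', v'.1 = v.1 ∧
        Steps m ⟨some (emb (entry p)), v, join S₁ S⟩ t ⟨some ex, v', join S₁ S'⟩ := by
  induction hr with
  | skip S =>
    intro emb ex h v
    exact ⟨v, rfl, Steps.one (h _) rfl⟩
  | push k x S =>
    intro emb ex h v
    exact ⟨v, rfl, Steps.one (h _) (congrArg (TM2.Cfg.mk (some ex) v) (update_join_inr S₁ S k _))⟩
  | seq _ _ ih₁ ih₂ =>
    intro emb ex h v
    obtain ⟨v', e', h'⟩ := ih₁ (fun l => emb (.inl l)) _ (fun l => h (.inl l)) v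
    obtain ⟨v'', e'', h''⟩ := ih₂ (fun l => emb (.inr l)) _ (fun l => h (.inr l)) v'
    exact ⟨v'', e''.trans e', h'.trans h''⟩
  | @case k f S S' t _ ih =>
    intro emb ex h v
    obtain ⟨v', e', h'⟩ := ih (fun l => emb (some ⟨_, l⟩)) ex (fun l => h (some ⟨_, l⟩))
      (v.1, (S k).head?)
    refine ⟨v', e', ?_⟩
    rw [add_comm]
    exact (Steps.one (h none)
      (congrArg (TM2.Cfg.mk _ (v.1, (S k).head?)) (update_join_inr S₁ S k _))).trans h'
  | @loop_nil k f S hS =>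
    intro emb ex h v
    refine ⟨(v.1, none), rfl, Steps.one (h none) ?_⟩
    have e : Function.update S k (S k).tail = S := by
      rw [hS, List.tail_nil, ← hS, Function.update_eq_self]
    have e' := (update_join_inr S₁ S k (S k).tail).trans (congrArg (join S₁) e)
    have key : ∀ o : List Γ', o = [] → TM2.Cfg.mk (Λ := Λ) (Γ := Alph Γ₁)
        (σ := σ₁ × Option Γ') (some (match o.head? with
          | none => ex
          | some x => emb (some ⟨x, entry (f x)⟩))) (v.1, o.head?) (join S₁ S) =
        ⟨some ex, (v.1, none), join S₁ S⟩ := by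
      rintro o rfl; rfl
    exact (congrArg (TM2.Cfg.mk _ (v.1, (S k).head?)) e').trans (key _ hS)
  | @loop_cons k f S x l S' S'' t t' hS _ _ ih₁ ih₂ =>
    intro emb ex h v
    obtain ⟨v', e', h'⟩ := ih₁ (fun l => emb (some ⟨x, l⟩)) (emb none)
      (fun l => h (some ⟨x, l⟩)) (v.1, some x)
    obtain ⟨v'', e'', h''⟩ := ih₂ emb ex h v'
    refine ⟨v'', e''.trans e', ?_⟩
    rw [show t + t' + 1 = 1 + t + t' by omega]
    refine ((Steps.one (h none) ?_).trans h').trans h''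
    have key : ∀ o : List Γ', o = x :: l → TM2.Cfg.mk (Λ := Λ) (Γ := Alph Γ₁)
        (σ := σ₁ × Option Γ') (some (match o.head? with
          | none => ex
          | some x => emb (some ⟨x, entry (f x)⟩))) (v.1, o.head?)
          (join S₁ (Function.update S k o.tail)) =
        ⟨some (emb (some ⟨x, entry (f x)⟩)), (v.1, some x), join S₁ (Function.update S k l)⟩ := by
      rintro o rfl; rfl
    exact (congrArg (TM2.Cfg.mk _ (v.1, (S k).head?)) (update_join_inr S₁ S k _)).trans (key _ hS)

end Compile

end PolyTime

/-! ### Running a given machine inside a larger one that continues with a program. -/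

namespace PolyTime

open Turing
open Computability (Γ')

section Embed

variable {K₁ : Type} [DecidableEq K₁] {Γ₁ : K₁ → Type} {σ₁ Λ₁ Λ : Type}

/-- A statement of a machine, as a statement of a larger machine that continues at `ex` where the
given machine halts. -/
def embed (ex : Λ) (inj : Λ₁ → Λ) :
    TM2.Stmt Γ₁ Λ₁ σ₁ → TM2.Stmt (Alph Γ₁) Λ (σ₁ × Option Γ')
  | .push k f q => .push (Sum.inl k) (fun v => f v.1) (embed ex inj q)
  | .peek k f q => .peek (Sum.inl k) (fun v o => (f v.1 o, v.2)) (embed ex inj q)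
  | .pop k f q => .pop (Sum.inl k) (fun v o => (f v.1 o, v.2)) (embed ex inj q)
  | .load f q => .load (fun v => (f v.1, v.2)) (embed ex inj q)
  | .branch f q q' => .branch (fun v => f v.1) (embed ex inj q) (embed ex inj q')
  | .goto f => .goto fun v => inj (f v.1)
  | .halt => .goto fun _ => ex

/-- The configuration of the larger machine that corresponds to a configuration. -/
def lift (ex : Λ) (inj : Λ₁ → Λ) (w : Option Γ') (S : Tape → List Γ') (c : TM2.Cfg Γ₁ Λ₁ σ₁) :
    TM2.Cfg (Alph Γ₁) Λ (σ₁ × Option Γ') :=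
  ⟨some (c.l.elim ex inj), (c.var, w), join c.stk S⟩

theorem stepAux_embed (ex : Λ) (inj : Λ₁ → Λ) (w : Option Γ') (S : Tape → List Γ')
    (q : TM2.Stmt Γ₁ Λ₁ σ₁) (v : σ₁) (S₁ : ∀ k, List (Γ₁ k)) :
    TM2.stepAux (embed ex inj q) (v, w) (join S₁ S) = lift ex inj w S (TM2.stepAux q v S₁) := by
  induction q generalizing v S₁ with
  | push k f q ih =>
    exact (congrArg (TM2.stepAux (embed ex inj q) (v, w)) (update_join_inl S₁ S k _)).trans
      (ih v (Function.update S₁ k (f v :: S₁ k)))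
  | peek k f q ih => exact ih _ _
  | pop k f q ih =>
    exact (congrArg (TM2.stepAux (embed ex inj q) (f v (S₁ k).head?, w))
      (update_join_inl S₁ S k _)).trans (ih _ (Function.update S₁ k (S₁ k).tail))
  | load f q ih => exact ih _ _
  | branch f q q' ih ih' =>
    simp only [embed, TM2.stepAux, ih, ih']
    cases f v <;> rfl
  | goto f => rfl
  | halt => rfl

/-- The larger machine mimics each step; the halting label is translated to `ex`, where it carries
on with its own work. -/
theorem steps_lift {m₁ : Λ₁ → TM2.Stmt Γ₁ Λ₁ σ₁} {m : Λ → TM2.Stmt (Alph Γ₁) Λ (σ₁ × Option Γ')}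
    {ex : Λ} {inj : Λ₁ → Λ} (h : ∀ l, m (inj l) = embed ex inj (m₁ l)) (w : Option Γ')
    (S : Tape → List Γ') (n : ℕ) (c c' : TM2.Cfg Γ₁ Λ₁ σ₁) (hc : Steps m₁ c n c') :
    Steps m (lift ex inj w S c) n (lift ex inj w S c') := by
  induction n generalizing c with
  | zero => rw [Option.some.inj hc]; rfl
  | succ n ih =>
    obtain ⟨l, v, S₁⟩ := c
    unfold Steps at hc
    rw [Function.iterate_succ_apply] at hc
    cases l with
    | none =>
      -- A halted configuration has no successor, so it cannot begin a run of positive length.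
      have key : ∀ n, (flip bind (TM2.step m₁))^[n] none = none := by
        intro n
        induction n with
        | zero => rfl
        | succ n ih => rw [Function.iterate_succ_apply]; exact ih
      have : (flip bind (TM2.step m₁))^[n] none = some c' := hc
      rw [key] at this
      exact absurd this (by simp)
    | some l =>
      have := ih (TM2.stepAux (m₁ l) v S₁) hc
      rw [add_comm]
      exact (Steps.one (h l) (stepAux_embed ex inj w S (m₁ l) v S₁)).trans this

/-- The number of `push` operations in a statement. -/
def pushes : TM2.Stmt Γ₁ Λ₁ σ₁ → ℕ
  | .push _ _ q => pushes q + 1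
  | .peek _ _ q => pushes q
  | .pop _ _ q => pushes q
  | .load _ q => pushes q
  | .branch _ q q' => pushes q + pushes q'
  | .goto _ => 0
  | .halt => 0

theorem length_stepAux_le (k : K₁) (q : TM2.Stmt Γ₁ Λ₁ σ₁) (v : σ₁) (S : ∀ k, List (Γ₁ k)) :
    ((TM2.stepAux q v S).stk k).length ≤ (S k).length + pushes q := by
  induction q generalizing v S with
  | push j f q ih =>
    refine (ih v _).trans ?_
    by_cases h : k = j
    · subst h; simp [pushes]; omega
    · simp [pushes, Function.update_of_ne h]
  | peek j f q ih => exact ih _ _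
  | pop j f q ih =>
    refine (ih _ _).trans ?_
    by_cases h : k = j
    · subst h; simp [pushes]
    · simp [pushes, Function.update_of_ne h]
  | load f q ih => exact ih _ _
  | branch f q q' ih ih' =>
    simp only [TM2.stepAux, pushes]
    cases f v
    · exact (ih' v S).trans (by omega)
    · exact (ih v S).trans (by omega)
  | goto f => exact Nat.le_add_right _ _
  | halt => exact Nat.le_add_right _ _

/-- A statement pushes boundedly often, so stack heights grow at most linearly with time. This turns
a time bound in the length of the given machine's output into one in the length of its input. -/
theorem length_stk_le [Fintype Λ₁] (m₁ : Λ₁ → TM2.Stmt Γ₁ Λ₁ σ₁) (k : K₁) (n : ℕ)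
    (c c' : TM2.Cfg Γ₁ Λ₁ σ₁) (hc : Steps m₁ c n c') :
    (c'.stk k).length ≤ (c.stk k).length + n * ∑ l, pushes (m₁ l) := by
  induction n generalizing c' with
  | zero => rw [Option.some.inj hc]; simp
  | succ n ih =>
    unfold Steps at hc
    rw [Function.iterate_succ_apply'] at hc
    cases hd : (flip bind (TM2.step m₁))^[n] (some c) with
    | none => rw [hd] at hc; exact absurd hc (by simp [flip])
    | some d =>
      rw [hd] at hc
      obtain ⟨l, v, S⟩ := d
      cases l with
      | none => exact absurd hc (by simp [flip])
      | some l =>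
        have e : TM2.stepAux (m₁ l) v S = c' := Option.some.inj hc
        rw [← e]
        refine (length_stepAux_le k _ _ _).trans ?_
        have h₁ := ih _ hd
        have h₂ : pushes (m₁ l) ≤ ∑ l, pushes (m₁ l) :=
          Finset.single_le_sum (f := fun l => pushes (m₁ l)) (fun _ _ => Nat.zero_le _)
            (Finset.mem_univ l)
        simp only at h₁
        rw [Nat.succ_mul]
        omega

end Embed

section Combine

/-- The machine that runs `tm`, moves its output to the main work stack (which reverses it), and
runs the program `p`. -/
noncomputable def combine (tm : FinTM2) (e : tm.Γ tm.k₁ → Γ') (p : Prog) : FinTM2 :=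
  letI := tm.kDecidableEq
  letI := tm.kFin
  let _ := tm.ΛFin
  letI := tm.σFin
  letI := tm.Γk₀Fin
  letI := Lab.fintype p
  { K := tm.K ⊕ Tape
    k₀ := Sum.inl tm.k₀
    k₁ := Sum.inr .main
    Γ := Alph tm.Γ
    Λ := tm.Λ ⊕ Option (Option (Lab p))
    main := Sum.inl tm.main
    σ := tm.σ × Option Γ'
    initialState := (tm.initialState, none)
    Γk₀Fin := inferInstanceAs (Fintype (tm.Γ tm.k₀))
    m := fun
      | .inl l => embed (Sum.inr none) Sum.inl (tm.m l)
      | .inr none => .pop (Sum.inl tm.k₁) (fun v o => (v.1, o.map e))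
          (.branch (fun v => v.2.isSome)
            (.push (Sum.inr .main) (fun v => v.2.getD .blank) (.goto fun _ => Sum.inr none))
            (.goto fun _ => Sum.inr (some (some (entry p)))))
      | .inr (some none) => .load (fun _ => (tm.initialState, none)) .halt
      | .inr (some (some l)) =>
        compile tm.Γ tm.σ p (fun l => Sum.inr (some (some l))) (Sum.inr (some none)) l }

/-- Moving symbols from stack to stack reverses them, which is why the program that follows expects
its input reversed. As the other stacks of the halted machine are empty, the whole machine is clean
after the transfer. -/
theorem combine_transfer (tm : FinTM2) (e : tm.Γ tm.k₁ → Γ') (p : Prog) (l : List (tm.Γ tm.k₁))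
    (S₁ : ∀ k, List (tm.Γ k)) (h₁ : ∀ k, k ≠ tm.k₁ → S₁ k = []) (h₂ : S₁ tm.k₁ = l)
    (r : List Γ') (w : Option Γ') :
    Steps (combine tm e p).m
      ⟨some (Sum.inr none), (tm.initialState, w), join S₁ (stk r [] [] [])⟩ (l.length + 1)
      ⟨some (Sum.inr (some (some (entry p)))), (tm.initialState, none),
        join (fun _ => []) (stk ((l.map e).reverse ++ r) [] [] [])⟩ := by
  classical
  induction l generalizing S₁ r w with
  | nil =>
    have hS : S₁ = fun _ => [] := by
      funext k
      by_cases h : k = tm.k₁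
      · subst h; exact h₂
      · exact h₁ k h
    subst hS
    refine Steps.one rfl ?_
    refine congrArg (TM2.Cfg.mk _ _) ((update_join_inl _ _ _ []).trans ?_)
    congr 1
    exact Function.update_eq_self _ _
  | cons x l ih =>
    have := ih (Function.update S₁ tm.k₁ l)
      (fun k hk => by rw [Function.update_of_ne hk]; exact h₁ k hk)
      (Function.update_self _ _ _) (e x :: r) (some (e x))
    rw [List.length_cons, List.map_cons, List.reverse_cons, List.append_assoc,
      List.singleton_append, show l.length + 1 + 1 = 1 + (l.length + 1) by omega]
    refine Steps.trans (Steps.one rfl ?_) this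
    have u₁ := update_join_inl S₁ (stk r [] [] []) tm.k₁ l
    have u₂ := update_join_inr (Function.update S₁ tm.k₁ l) (stk r [] [] []) .main (e x :: r)
    have u₃ : Function.update (stk r [] [] []) .main (e x :: r) = stk (e x :: r) [] [] [] := by
      funext k; cases k <;> rfl
    rw [u₃] at u₂
    have key : ∀ (o : List (tm.Γ tm.k₁)) (J : ∀ k, List (Alph tm.Γ k)), o = x :: l →
        J (Sum.inr .main) = r →
        TM2.stepAux (Λ := tm.Λ ⊕ Option (Option (Lab p))) (σ := tm.σ × Option Γ')
          (Γ := Alph tm.Γ) (.branch (fun v => v.2.isSome)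
            (.push (Sum.inr .main) (fun v => v.2.getD .blank) (.goto fun _ => Sum.inr none))
            (.goto fun _ => Sum.inr (some (some (entry p)))))
          (tm.initialState, o.head?.map e) J =
          ⟨some (Sum.inr none), (tm.initialState, some (e x)),
            Function.update J (Sum.inr .main) (e x :: r)⟩ := by
      rintro o J rfl rfl
      rfl
    refine (key (S₁ tm.k₁) (Function.update (join S₁ (stk r [] [] [])) (Sum.inl tm.k₁)
      (S₁ tm.k₁).tail) h₂ ?_).trans ?_
    · exact Function.update_of_ne Sum.inr_ne_inl _ _
    · refine congrArg (TM2.Cfg.mk _ _) ?_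
      rw [h₂]
      exact (congrArg (fun J => Function.update J (Sum.inr .main) (e x :: r)) u₁).trans u₂

theorem initList_stk_self (tm : FinTM2) (s : List (tm.Γ tm.k₀)) : (initList tm s).stk tm.k₀ = s :=
  dif_pos rfl

theorem initList_stk_ne (tm : FinTM2) (s : List (tm.Γ tm.k₀)) {k : tm.K} (h : k ≠ tm.k₀) :
    (initList tm s).stk k = [] :=
  dif_neg h

theorem haltList_stk_self (tm : FinTM2) (s : List (tm.Γ tm.k₁)) : (haltList tm s).stk tm.k₁ = s :=
  dif_pos rfl

theorem haltList_stk_ne (tm : FinTM2) (s : List (tm.Γ tm.k₁)) {k : tm.K} (h : k ≠ tm.k₁) :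
    (haltList tm s).stk k = [] :=
  dif_neg h

theorem initList_combine (tm : FinTM2) (e : tm.Γ tm.k₁ → Γ') (p : Prog) (s : List (tm.Γ tm.k₀)) :
    initList (combine tm e p) s =
      lift (Λ := (combine tm e p).Λ) (Sum.inr none) Sum.inl none (stk [] [] [] [])
        (initList tm s) := by
  refine congrArg (TM2.Cfg.mk _ _) ?_
  funext k
  rcases k with k | k
  · by_cases h : k = tm.k₀
    · subst h
      exact (initList_stk_self (combine tm e p) s).trans (initList_stk_self tm s).symm
    · exact (initList_stk_ne (combine tm e p) s (k := Sum.inl k)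
        (fun h' => h (Sum.inl.inj h'))).trans (initList_stk_ne tm s h).symm
  · refine (initList_stk_ne (combine tm e p) s (k := Sum.inr k) Sum.inr_ne_inl).trans ?_
    cases k <;> rfl

theorem haltList_combine (tm : FinTM2) (e : tm.Γ tm.k₁ → Γ') (p : Prog) (s : List Γ') :
    haltList (combine tm e p) s =
      ⟨none, (tm.initialState, none), join (fun _ => []) (stk s [] [] [])⟩ := by
  refine congrArg (TM2.Cfg.mk _ _) ?_
  funext k
  rcases k with k | k
  · exact haltList_stk_ne (combine tm e p) s (k := Sum.inl k) Sum.inl_ne_inr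
  · by_cases h : k = .main
    · subst h
      exact haltList_stk_self (combine tm e p) s
    · refine (haltList_stk_ne (combine tm e p) s (k := Sum.inr k)
        (fun h' => h (Sum.inr.inj h'))).trans ?_
      cases k
      · exact absurd rfl h
      all_goals rfl

/-- A polynomial-time machine may be followed by a structured program whose running time is
polynomial. -/
theorem comp_prog {α ι ι' αΓ : Type} {ea : α → List αΓ} {enc : ι → List Γ'} {enc' : ι' → List Γ'}
    {f : α → ι} (h : TM2ComputableInPolyTime ea enc f) (g : α → ι') (p : Prog) (c : ℕ)
    (hp : ∀ x, ∃ t ≤ ((enc (f x)).length + 2) ^ c,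
      Runs p (stk (enc (f x)).reverse [] [] []) (stk (enc' (g x)) [] [] []) t) :
    Nonempty (TM2ComputableInPolyTime ea enc' g) := by
  obtain ⟨⟨tm, ei, eo⟩, time, hout⟩ := h
  let _ := tm.ΛFin
  set B := ∑ l, pushes (tm.m l) with hB
  refine ⟨{
    tm := combine tm eo p
    inputAlphabet := ei
    outputAlphabet := Equiv.refl Γ'
    -- The summands pay for the given machine, for the transfer of its output, for the program, and
    -- for the final step that resets the register before halting.
    time := time + (Polynomial.X + time * Polynomial.C B + 1) +
      (Polynomial.X + time * Polynomial.C B + 2) ^ c + 1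
    outputsFun := fun x => ?_ }⟩
  apply Classical.choice
  obtain ⟨⟨n, hn⟩, hle⟩ := hout x
  simp only at hn hle
  set c₀ := initList tm (List.map ei.invFun (ea x)) with hc₀
  set c₁ := haltList tm (List.map eo.invFun (enc (f x))) with hc₁
  have hs : Steps tm.m c₀ n c₁ := hn
  have hlen : (enc (f x)).length ≤ (ea x).length + n * B := by
    have := length_stk_le tm.m tm.k₁ n c₀ c₁ hs
    rw [hc₁, haltList_stk_self, List.length_map] at this
    refine this.trans (Nat.add_le_add_right ?_ _)
    -- The output stack may be the input stack, in which case it starts with the input on it.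
    by_cases hk : tm.k₁ = tm.k₀
    · have key : ∀ k, k = tm.k₀ → (c₀.stk k).length = (ea x).length := by
        rintro k rfl
        rw [hc₀, initList_stk_self, List.length_map]
      exact (key _ hk).le
    · rw [hc₀, initList_stk_ne tm _ hk]
      exact Nat.zero_le _
  have s₁ := steps_lift (m := (combine tm eo p).m) (ex := Sum.inr none) (inj := Sum.inl)
    (fun l => rfl) none (stk [] [] [] []) n c₀ c₁ hs
  have s₂ := combine_transfer tm eo p (List.map eo.invFun (enc (f x))) c₁.stk
    (fun k hk => haltList_stk_ne tm _ hk) (haltList_stk_self tm _) [] none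
  obtain ⟨t, ht, hr⟩ := hp x
  obtain ⟨v, -, s₃⟩ := compile_correct (m := (combine tm eo p).m) (fun _ => []) hr
    (fun l => Sum.inr (some (some l))) (Sum.inr (some none)) (fun l => rfl) (tm.initialState, none)
  have s₄ : Steps (combine tm eo p).m ⟨some (Sum.inr (some none)), v,
      join (fun _ => []) (stk (enc' (g x)) [] [] [])⟩ 1 (haltList (combine tm eo p) (enc' (g x))) :=
    Steps.one rfl (haltList_combine tm eo p _).symm
  have hm : (List.map eo (List.map eo.invFun (enc (f x)))).reverse ++ [] = (enc (f x)).reverse := by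
    simp [Function.comp_def]
  rw [hm, List.length_map] at s₂
  have s := ((s₁.trans s₂).trans s₃).trans s₄
  refine ⟨⟨⟨n + ((enc (f x)).length + 1) + t + 1, ?_⟩, ?_⟩⟩
  · have e₁ : List.map (Equiv.refl Γ').invFun (enc' (g x)) = enc' (g x) := List.map_id _
    have e₂ := initList_combine tm eo p (List.map ei.invFun (ea x))
    refine (congrArg _ (congrArg some e₂)).trans (Eq.trans s ?_)
    exact congrArg (fun l => some (haltList (combine tm eo p) l)) e₁.symm
  · simp only [Polynomial.eval_add, Polynomial.eval_mul, Polynomial.eval_pow, Polynomial.eval_X,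
      Polynomial.eval_C, Polynomial.eval_one, Polynomial.eval_ofNat]
    have h₁ : n * B ≤ time.eval (ea x).length * B := Nat.mul_le_mul_right _ hle
    have h₂ : ((enc (f x)).length + 2) ^ c ≤
        ((ea x).length + time.eval (ea x).length * B + 2) ^ c :=
      Nat.pow_le_pow_left (by omega) c
    omega

end Combine

end PolyTime

/-! ### A calculus of polynomial-time functions. -/

namespace PolyTime

open Turing
open Computability (Γ')

/-! ### Programs on serialised binary trees -/

/-- Binary trees, the universal data type. -/
inductive Tr
  | nil : Tr
  | node (l r : Tr) : Tr

/-- Preorder serialisation. -/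
def Tr.ser : Tr → List Γ'
  | .nil => [.bit false]
  | .node l r => .bit true :: (l.ser ++ r.ser)

theorem Tr.ser_length_pos (x : Tr) : 0 < x.ser.length := by
  cases x <;> simp [Tr.ser]

/-- `p` leads from `S` to `S'` in at most `t` steps. -/
def RunsLE (p : Prog) (S S' : Tape → List Γ') (t : ℕ) : Prop := ∃ s ≤ t, Runs p S S' s

theorem RunsLE.mono {p : Prog} {S S' : Tape → List Γ'} {t t' : ℕ} (h : RunsLE p S S' t)
    (ht : t ≤ t') : RunsLE p S S' t' := by
  obtain ⟨s, hs, hr⟩ := h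
  exact ⟨s, hs.trans ht, hr⟩

theorem RunsLE.seq {p q : Prog} {S S' S'' : Tape → List Γ'} {t t' : ℕ} (h : RunsLE p S S' t)
    (h' : RunsLE q S' S'' t') : RunsLE (.seq p q) S S'' (t + t') := by
  obtain ⟨s, hs, hr⟩ := h
  obtain ⟨s', hs', hr'⟩ := h'
  exact ⟨s + s', by omega, .seq hr hr'⟩

theorem RunsLE.skip (S : Tape → List Γ') : RunsLE .skip S S 1 := ⟨1, le_rfl, .skip S⟩

section stk
variable (m a b c l : List Γ')

theorem update_stk_main : Function.update (stk m a b c) .main l = stk l a b c := by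
  funext k; cases k <;> rfl
theorem update_stk_a : Function.update (stk m a b c) .a l = stk m l b c := by
  funext k; cases k <;> rfl
theorem update_stk_b : Function.update (stk m a b c) .b l = stk m a l c := by
  funext k; cases k <;> rfl
theorem update_stk_c : Function.update (stk m a b c) .c l = stk m a b l := by
  funext k; cases k <;> rfl
end stk

section ops
variable {m a b c : List Γ'} {x : Γ'} {f : Γ' → Prog} {g : Option Γ' → Prog}
  {S S' : Tape → List Γ'} {s t : ℕ}

theorem RunsLE.push_main : RunsLE (.push .main x) (stk m a b c) (stk (x :: m) a b c) 1 :=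
  ⟨1, le_rfl, by
    have := Runs.push .main x (stk m a b c)
    rw [update_stk_main] at this
    exact this⟩
theorem RunsLE.push_a : RunsLE (.push .a x) (stk m a b c) (stk m (x :: a) b c) 1 :=
  ⟨1, le_rfl, by
    have := Runs.push .a x (stk m a b c)
    rw [update_stk_a] at this
    exact this⟩
theorem RunsLE.push_b : RunsLE (.push .b x) (stk m a b c) (stk m a (x :: b) c) 1 :=
  ⟨1, le_rfl, by
    have := Runs.push .b x (stk m a b c)
    rw [update_stk_b] at this
    exact this⟩
theorem RunsLE.push_c : RunsLE (.push .c x) (stk m a b c) (stk m a b (x :: c)) 1 :=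
  ⟨1, le_rfl, by
    have := Runs.push .c x (stk m a b c)
    rw [update_stk_c] at this
    exact this⟩

theorem RunsLE.case_main (h : RunsLE (g (some x)) (stk m a b c) S t) :
    RunsLE (.case .main g) (stk (x :: m) a b c) S (t + 1) := by
  obtain ⟨s, hs, hr⟩ := h
  refine ⟨s + 1, by omega, Runs.case ?_⟩
  rw [update_stk_main]
  exact hr

theorem RunsLE.loop_nil {k : Tape} (h : S k = []) : RunsLE (.loop k f) S S 1 :=
  ⟨1, le_rfl, .loop_nil h⟩

theorem RunsLE.loop_a (h : RunsLE (f x) (stk m a b c) S s) (h' : RunsLE (.loop .a f) S S' t) :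
    RunsLE (.loop .a f) (stk m (x :: a) b c) S' (s + t + 1) := by
  obtain ⟨s, hs, hr⟩ := h
  obtain ⟨t, ht, hr'⟩ := h'
  refine ⟨s + t + 1, by omega, Runs.loop_cons (S := stk m (x :: a) b c) rfl ?_ hr'⟩
  rw [update_stk_a]
  exact hr

theorem RunsLE.loop_b (h : RunsLE (f x) (stk m a b c) S s) (h' : RunsLE (.loop .b f) S S' t) :
    RunsLE (.loop .b f) (stk m a (x :: b) c) S' (s + t + 1) := by
  obtain ⟨s, hs, hr⟩ := h
  obtain ⟨t, ht, hr'⟩ := h'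
  refine ⟨s + t + 1, by omega, Runs.loop_cons (S := stk m a (x :: b) c) rfl ?_ hr'⟩
  rw [update_stk_b]
  exact hr

theorem RunsLE.loop_c (h : RunsLE (f x) (stk m a b c) S s) (h' : RunsLE (.loop .c f) S S' t) :
    RunsLE (.loop .c f) (stk m a b (x :: c)) S' (s + t + 1) := by
  obtain ⟨s, hs, hr⟩ := h
  obtain ⟨t, ht, hr'⟩ := h'
  refine ⟨s + t + 1, by omega, Runs.loop_cons (S := stk m a b (x :: c)) rfl ?_ hr'⟩
  rw [update_stk_c]
  exact hr

theorem RunsLE.loop_main (h : RunsLE (f x) (stk m a b c) S s)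
    (h' : RunsLE (.loop .main f) S S' t) :
    RunsLE (.loop .main f) (stk (x :: m) a b c) S' (s + t + 1) := by
  obtain ⟨s, hs, hr⟩ := h
  obtain ⟨t, ht, hr'⟩ := h'
  refine ⟨s + t + 1, by omega, Runs.loop_cons (S := stk (x :: m) a b c) rfl ?_ hr'⟩
  rw [update_stk_main]
  exact hr

end ops

/-- Each step pushes at most one symbol. -/
theorem Runs.length_le {p : Prog} {S S' : Tape → List Γ'} {t : ℕ} (h : Runs p S S' t) :
    ∑ k, (S' k).length ≤ ∑ k, (S k).length + t := by
  have key : ∀ (S : Tape → List Γ') (k : Tape) (l : List Γ'),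
      ∑ j, (Function.update S k l j).length + (S k).length = ∑ j, (S j).length + l.length := by
    intro S k l
    rw [← Finset.add_sum_erase _ _ (Finset.mem_univ k),
      ← Finset.add_sum_erase Finset.univ (fun j => (S j).length) (Finset.mem_univ k),
      Function.update_self,
      Finset.sum_congr rfl (g := fun j => (S j).length) (fun j hj => by
        rw [Function.update_of_ne (Finset.ne_of_mem_erase hj)])]
    omega
  induction h with
  | skip S => omega
  | push k x S =>
    have := key S k (x :: S k)
    rw [List.length_cons] at this
    omega
  | seq _ _ ih₁ ih₂ => omega
  | @case k f S S' t _ ih =>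
    have := key S k (S k).tail
    rw [List.length_tail] at this
    omega
  | loop_nil _ => omega
  | @loop_cons k f S x l S' S'' t t' hS _ _ ih₁ ih₂ =>
    have := key S k l
    rw [hS, List.length_cons] at this
    omega

/-- Run `f` on the symbols of the tree on top of the main stack, removing them. -/
def scan (f : Γ' → Prog) : Prog :=
  .seq (.push .c .blank) (.loop .c fun _ => .case .main fun o => o.elim .skip fun x =>
    .seq (f x) (if x = .bit true then .seq (.push .c .blank) (.push .c .blank) else .skip))

/-- Stack `.c` holds one token for each subtree still to be read: a symbol uses up one token, and
`bit true`, which announces two subtrees, adds two. The tokens therefore run out exactly at the end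
of the tree. In `key` further tokens may lie below, so that the two subtrees can be treated in turn.
-/
theorem scan_runs {f : Γ' → Prog} {φ : List Γ' × List Γ' → Γ' → List Γ' × List Γ'}
    (hf : ∀ x m a b c, RunsLE (f x) (stk m a b c) (stk m (φ (a, b) x).1 (φ (a, b) x).2 c) 2)
    (x : Tr) (r a b : List Γ') :
    RunsLE (scan f) (stk (x.ser ++ r) a b [])
      (stk r (x.ser.foldl φ (a, b)).1 (x.ser.foldl φ (a, b)).2 []) (6 * x.ser.length + 2) := by
  have key : ∀ (x : Tr) (r a b c : List Γ') (S : Tape → List Γ') (t : ℕ),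
      RunsLE (.loop .c fun _ => .case .main fun o => o.elim .skip fun x =>
        .seq (f x) (if x = .bit true then .seq (.push .c .blank) (.push .c .blank) else .skip))
        (stk r (x.ser.foldl φ (a, b)).1 (x.ser.foldl φ (a, b)).2 c) S t →
      RunsLE (.loop .c fun _ => .case .main fun o => o.elim .skip fun x =>
        .seq (f x) (if x = .bit true then .seq (.push .c .blank) (.push .c .blank) else .skip))
        (stk (x.ser ++ r) a b (.blank :: c)) S (6 * x.ser.length + t) := by
    intro x
    induction x with
    | nil =>
      intro r a b c S t h
      refine RunsLE.mono (RunsLE.loop_c (RunsLE.case_main (RunsLE.seq (hf _ _ _ _ _)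
        (RunsLE.skip _))) h) ?_
      simp only [Tr.ser, List.length_singleton]
      omega
    | node l r ihl ihr =>
      intro r' a b c S t h
      have h₂ := ihr r' (l.ser.foldl φ (φ (a, b) (.bit true))).1
        (l.ser.foldl φ (φ (a, b) (.bit true))).2 c S t
        (by simpa only [Tr.ser, List.foldl_cons, List.foldl_append] using h)
      have h₁ := ihl (r.ser ++ r') _ _ _ S _ h₂
      rw [← List.append_assoc] at h₁
      refine RunsLE.mono (RunsLE.loop_c (RunsLE.case_main (RunsLE.seq (hf _ _ _ _ _)
        (RunsLE.seq RunsLE.push_c RunsLE.push_c))) h₁) ?_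
      simp only [Tr.ser, List.length_cons, List.length_append]
      omega
  have h := key x r a b [] _ 1 (RunsLE.loop_nil rfl)
  exact (RunsLE.seq RunsLE.push_c h).mono (by omega)

theorem foldl_push_fst (l a b : List Γ') :
    l.foldl (fun (q : List Γ' × List Γ') x => (x :: q.1, q.2)) (a, b) = (l.reverse ++ a, b) := by
  induction l generalizing a with
  | nil => rfl
  | cons x l ih => simp [ih]

theorem foldl_push_snd (l a b : List Γ') :
    l.foldl (fun (q : List Γ' × List Γ') x => (q.1, x :: q.2)) (a, b) = (a, l.reverse ++ b) := by
  induction l generalizing b with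
  | nil => rfl
  | cons x l ih => simp [ih]

theorem foldl_push_both (l a b : List Γ') :
    l.foldl (fun (q : List Γ' × List Γ') x => (x :: q.1, x :: q.2)) (a, b) =
      (l.reverse ++ a, l.reverse ++ b) := by
  induction l generalizing a b with
  | nil => rfl
  | cons x l ih => simp [ih]

theorem flush_a (l m b c : List Γ') :
    RunsLE (.loop .a fun x => .push .main x) (stk m l b c) (stk (l.reverse ++ m) [] b c)
      (2 * l.length + 1) := by
  induction l generalizing m with
  | nil => exact RunsLE.loop_nil rfl
  | cons x l ih =>
    have := RunsLE.loop_a (f := fun x => .push .main x) (m := m) (a := l) (b := b) (c := c)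
      RunsLE.push_main (ih (x :: m))
    simp only [List.reverse_cons, List.append_assoc, List.singleton_append, List.length_cons]
    exact this.mono (by omega)

theorem flush_b (l m a c : List Γ') :
    RunsLE (.loop .b fun x => .push .main x) (stk m a l c) (stk (l.reverse ++ m) a [] c)
      (2 * l.length + 1) := by
  induction l generalizing m with
  | nil => exact RunsLE.loop_nil rfl
  | cons x l ih =>
    have := RunsLE.loop_b (f := fun x => .push .main x) (m := m) (a := a) (b := l) (c := c)
      RunsLE.push_main (ih (x :: m))
    simp only [List.reverse_cons, List.append_assoc, List.singleton_append, List.length_cons]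
    exact this.mono (by omega)

/-- Remove the top tree. -/
def drop : Prog := scan fun _ => .skip

theorem drop_runs (x : Tr) (r : List Γ') :
    RunsLE drop (stk (x.ser ++ r) [] [] []) (stk r [] [] []) (6 * x.ser.length + 2) := by
  have := scan_runs (f := fun _ => .skip) (φ := fun q _ => q)
    (fun x m a b c => (RunsLE.skip _).mono (by omega)) x r [] []
  rwa [List.foldl_fixed] at this

/-- Duplicate the top tree. -/
def dup : Prog :=
  .seq (scan fun x => .seq (.push .a x) (.push .b x))
    (.seq (.loop .a fun x => .push .main x) (.loop .b fun x => .push .main x))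

theorem dup_runs (x : Tr) (r : List Γ') :
    RunsLE dup (stk (x.ser ++ r) [] [] []) (stk (x.ser ++ (x.ser ++ r)) [] [] [])
      (10 * x.ser.length + 4) := by
  have h₁ := scan_runs (f := fun x => .seq (.push .a x) (.push .b x))
    (φ := fun q x => (x :: q.1, x :: q.2))
    (fun x m a b c => RunsLE.seq RunsLE.push_a RunsLE.push_b) x r [] []
  rw [foldl_push_both] at h₁
  simp only [List.append_nil] at h₁
  have h₂ := flush_a x.ser.reverse r x.ser.reverse []
  have h₃ := flush_b x.ser.reverse (x.ser ++ r) [] []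
  rw [List.reverse_reverse, List.length_reverse] at h₂ h₃
  exact (h₁.seq (h₂.seq h₃)).mono (by omega)

/-- Exchange the two top trees. -/
def swap : Prog :=
  .seq (scan fun x => .push .a x) (.seq (scan fun x => .push .b x)
    (.seq (.loop .a fun x => .push .main x) (.loop .b fun x => .push .main x)))

theorem swap_runs (x y : Tr) (r : List Γ') :
    RunsLE swap (stk (x.ser ++ (y.ser ++ r)) [] [] []) (stk (y.ser ++ (x.ser ++ r)) [] [] [])
      (8 * (x.ser.length + y.ser.length) + 6) := by
  have h₁ := scan_runs (f := fun x => .push .a x) (φ := fun q x => (x :: q.1, q.2))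
    (fun x m a b c => RunsLE.push_a.mono (by omega)) x (y.ser ++ r) [] []
  rw [foldl_push_fst] at h₁
  have h₂ := scan_runs (f := fun x => .push .b x) (φ := fun q x => (q.1, x :: q.2))
    (fun x m a b c => RunsLE.push_b.mono (by omega)) y r (x.ser.reverse ++ []) []
  rw [foldl_push_snd] at h₂
  simp only [List.append_nil] at h₁ h₂
  have h₃ := flush_a x.ser.reverse r y.ser.reverse []
  have h₄ := flush_b y.ser.reverse (x.ser ++ r) [] []
  rw [List.reverse_reverse, List.length_reverse] at h₃ h₄
  exact (h₁.seq (h₂.seq (h₃.seq h₄))).mono (by omega)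

/-- Push the symbols of a fixed string, the last one first. -/
def pushList : List Γ' → Prog
  | [] => .skip
  | x :: l => .seq (pushList l) (.push .main x)

theorem pushList_runs (l m : List Γ') :
    RunsLE (pushList l) (stk m [] [] []) (stk (l ++ m) [] [] []) (l.length + 1) := by
  induction l with
  | nil => exact RunsLE.skip _
  | cons x l ih => exact (ih.seq RunsLE.push_main).mono (by simp)

/-! ### Polynomial bounds -/

/-- `T` is bounded by a polynomial. -/
def PB (T : ℕ → ℕ) : Prop := ∃ c, ∀ n, T n ≤ (n + 2) ^ c

namespace PB

theorem const (k : ℕ) : PB fun _ => k :=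
  ⟨k, fun n => (Nat.lt_two_pow_self).le.trans (Nat.pow_le_pow_left (by omega) k)⟩

theorem id : PB fun n => n := ⟨1, fun n => by rw [pow_one]; exact Nat.le_add_right n 2⟩

theorem pow_self (c : ℕ) : PB fun n => (n + 2) ^ c := ⟨c, fun _ => le_rfl⟩

theorem mul {T T' : ℕ → ℕ} (h : PB T) (h' : PB T') : PB fun n => T n * T' n := by
  obtain ⟨c, hc⟩ := h
  obtain ⟨d, hd⟩ := h'
  exact ⟨c + d, fun n => by rw [pow_add]; exact Nat.mul_le_mul (hc n) (hd n)⟩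

theorem add {T T' : ℕ → ℕ} (h : PB T) (h' : PB T') : PB fun n => T n + T' n := by
  obtain ⟨c, hc⟩ := h
  obtain ⟨d, hd⟩ := h'
  refine ⟨c + d + 1, fun n => ?_⟩
  have h₁ : (n + 2) ^ c ≤ (n + 2) ^ (c + d) := Nat.pow_le_pow_right (by omega) (by omega)
  have h₂ : (n + 2) ^ d ≤ (n + 2) ^ (c + d) := Nat.pow_le_pow_right (by omega) (by omega)
  have h₃ : (n + 2) ^ (c + d + 1) = (n + 2) ^ (c + d) * (n + 2) := pow_succ _ _
  have := hc n
  have := hd n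
  nlinarith

theorem pow {T : ℕ → ℕ} (h : PB T) (k : ℕ) : PB fun n => T n ^ k := by
  obtain ⟨c, hc⟩ := h
  exact ⟨c * k, fun n => by rw [pow_mul]; exact Nat.pow_le_pow_left (hc n) k⟩

end PB

/-! ### Typed polynomial-time functions -/

/-- Data that is represented by trees. -/
class Enc (α : Type) where
  enc : α → Tr

open Enc (enc)

instance : Enc Tr := ⟨fun x => x⟩

/-- The length of the serialised representation. -/
def size {α : Type} [Enc α] (x : α) : ℕ := (enc x).ser.length

variable {α β γ δ : Type} [Enc α] [Enc β] [Enc γ] [Enc δ]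

theorem size_pos (x : α) : 0 < size x := Tr.ser_length_pos _

/-- `f` is computed in polynomial time by a program that replaces the top tree. -/
def PTF (f : α → β) : Prop :=
  ∃ p T, PB T ∧ ∀ x r, RunsLE p (stk ((enc x).ser ++ r) [] [] [])
    (stk ((enc (f x)).ser ++ r) [] [] []) (T (size x))

/-- `f` increases sizes polynomially. -/
def SB (f : α → β) : Prop := ∃ c, ∀ x, size (f x) ≤ (size x + 2) ^ c

/-- A step pushes at most one symbol, so the running time bounds the growth. Hence polynomial-time
functions compose with no separate hypothesis on sizes. -/
theorem PTF.sb {f : α → β} (h : PTF f) : SB f := by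
  obtain ⟨p, T, hT, h⟩ := h
  obtain ⟨c, hc⟩ := PB.add PB.id hT
  refine ⟨c, fun x => le_trans ?_ (hc (size x))⟩
  obtain ⟨t, ht, hr⟩ := h x []
  have key : ∀ l : List Γ', ∑ k, (stk l [] [] [] k).length = l.length := by
    intro l
    rw [show (Finset.univ : Finset Tape) = {.main, .a, .b, .c} from rfl]
    simp [stk]
  have := hr.length_le
  rw [key, key] at this
  simp only [List.append_nil] at this
  unfold size at *
  dsimp only
  omega

namespace PTF

/-- Only the representations of the values matter. -/
theorem congr_enc {f : α → β} {g : α → γ} (h : PTF f) (hfg : ∀ x, enc (f x) = enc (g x)) :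
    PTF g := by
  obtain ⟨p, T, hT, h⟩ := h
  exact ⟨p, T, hT, fun x r => by rw [← hfg]; exact h x r⟩

theorem congr {f g : α → β} (h : PTF f) (hfg : ∀ x, f x = g x) : PTF g :=
  h.congr_enc fun x => by rw [hfg]

theorem id : PTF fun x : α => x :=
  ⟨.skip, fun _ => 1, PB.const 1, fun _ _ => RunsLE.skip _⟩

theorem toTr : PTF fun x : α => enc x := id.congr_enc fun _ => rfl

theorem comp {g : β → γ} {f : α → β} (hg : PTF g) (hf : PTF f) : PTF fun x => g (f x) := by
  obtain ⟨b, hb⟩ := hf.sb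
  obtain ⟨p, T, ⟨c, hc⟩, h⟩ := hg
  obtain ⟨q, U, hU, h'⟩ := hf
  refine ⟨.seq q p, fun n => U n + ((n + 2) ^ b + 2) ^ c,
    hU.add (((PB.pow_self b).add (PB.const 2)).pow c), fun x r => ?_⟩
  refine (h' x r).seq ((h (f x) r).mono ((hc _).trans (Nat.pow_le_pow_left ?_ c)))
  exact Nat.add_le_add_right (hb x) 2

theorem const (y : β) : PTF fun _ : α => y := by
  refine ⟨.seq drop (pushList (enc y).ser), fun n => 6 * n + 2 + ((enc y).ser.length + 1),
    (((PB.const 6).mul PB.id).add (PB.const 2)).add (PB.const _), fun x r => ?_⟩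
  exact (drop_runs (enc x) r).seq (pushList_runs _ _)

end PTF

instance : Enc (α × β) := ⟨fun x => .node (enc x.1) (enc x.2)⟩

theorem enc_prod (x : α × β) : enc x = .node (enc x.1) (enc x.2) := rfl

theorem size_prod (x : α × β) : size x = size x.1 + size x.2 + 1 := by
  simp [size, enc_prod, Tr.ser]

namespace PTF

/-- Programs leave everything below the top tree alone, so the argument can be duplicated, `g`
applied to the upper copy, the trees exchanged, and `f` applied to the other copy. A single `bit
true` in front joins the two results. -/
theorem pair {f : α → β} {g : α → γ} (hf : PTF f) (hg : PTF g) : PTF fun x => (f x, g x) := by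
  obtain ⟨b, hb⟩ := hg.sb
  obtain ⟨p, T, hT, h⟩ := hf
  obtain ⟨q, U, hU, h'⟩ := hg
  refine ⟨.seq dup (.seq q (.seq swap (.seq p (.push .main (.bit true))))),
    fun n => (10 * n + 4) + (U n + ((8 * ((n + 2) ^ b + n) + 6) + (T n + 1))), ?_, fun x r => ?_⟩
  · exact (((PB.const 10).mul PB.id).add (PB.const 4)).add (hU.add
      ((((PB.const 8).mul ((PB.pow_self b).add PB.id)).add (PB.const 6)).add
        (hT.add (PB.const 1))))
  · refine (dup_runs (enc x) r).seq ((h' x _).seq (((swap_runs _ _ r).mono ?_).seq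
      ((h x _).seq ?_)))
    · have := hb x
      unfold size at *
      omega
    · have := RunsLE.push_main (x := .bit true) (a := []) (b := []) (c := [])
        (m := (enc (f x)).ser ++ ((enc (g x)).ser ++ r))
      refine (congrArg (fun l => RunsLE (.push .main (.bit true)) _ (stk (.bit true :: l) [] [] []) 1)
        (List.append_assoc _ _ _)).mpr this

end PTF

/-- Left subtree. -/
def Tr.hd : Tr → Tr
  | .nil => .nil
  | .node l _ => l

/-- Right subtree. -/
def Tr.tl : Tr → Tr
  | .nil => .nil
  | .node _ r => r

instance : Enc Bool := ⟨fun b => bif b then .node .nil .nil else .nil⟩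

/-- Whether a tree is not the empty tree. -/
def Tr.isNode : Tr → Bool
  | .nil => false
  | .node _ _ => true

namespace PTF

theorem hd : PTF Tr.hd := by
  refine ⟨.case .main fun o => if o = some (.bit true) then .seq swap drop
    else .push .main (.bit false), fun n => 14 * n + 10,
    ((PB.const 14).mul PB.id).add (PB.const 10), fun x r => ?_⟩
  cases x with
  | nil =>
    refine (RunsLE.case_main (t := 1) ?_).mono (Nat.le_add_left _ _)
    exact RunsLE.push_main
  | node x y =>
    have h := (swap_runs x y r).seq (drop_runs y (x.ser ++ r))
    rw [← List.append_assoc] at h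
    refine (RunsLE.case_main (g := fun o => if o = some (.bit true) then .seq swap drop
      else .push .main (.bit false)) (x := .bit true) h).mono ?_
    have : size (Tr.node x y) = x.ser.length + y.ser.length + 1 := size_prod (x, y)
    dsimp only
    omega

theorem tl : PTF Tr.tl := by
  refine ⟨.case .main fun o => if o = some (.bit true) then drop
    else .push .main (.bit false), fun n => 6 * n + 10,
    ((PB.const 6).mul PB.id).add (PB.const 10), fun x r => ?_⟩
  cases x with
  | nil =>
    refine (RunsLE.case_main (t := 1) ?_).mono (Nat.le_add_left _ _)
    exact RunsLE.push_main
  | node x y =>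
    have h := drop_runs x (y.ser ++ r)
    rw [← List.append_assoc] at h
    refine (RunsLE.case_main (g := fun o => if o = some (.bit true) then drop
      else .push .main (.bit false)) (x := .bit true) h).mono ?_
    have : size (Tr.node x y) = x.ser.length + y.ser.length + 1 := size_prod (x, y)
    dsimp only
    omega

theorem isNode : PTF Tr.isNode := by
  refine ⟨.case .main fun o => if o = some (.bit true) then
    .seq drop (.seq drop (pushList (enc true).ser))
    else .push .main (.bit false), fun n => 12 * n + 20,
    ((PB.const 12).mul PB.id).add (PB.const 20), fun x r => ?_⟩
  cases x with
  | nil =>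
    refine (RunsLE.case_main (t := 1) ?_).mono (Nat.le_add_left _ _)
    exact RunsLE.push_main
  | node x y =>
    have h := (drop_runs x (y.ser ++ r)).seq ((drop_runs y r).seq
      (pushList_runs (enc true).ser r))
    rw [← List.append_assoc] at h
    refine (RunsLE.case_main (g := fun o => if o = some (.bit true) then
      .seq drop (.seq drop (pushList (enc true).ser))
      else .push .main (.bit false)) (x := .bit true) h).mono ?_
    have : size (Tr.node x y) = x.ser.length + y.ser.length + 1 := size_prod (x, y)
    have : (enc true).ser.length = 3 := rfl
    dsimp only
    omega

theorem fst : PTF (Prod.fst : α × β → α) := (hd.comp toTr).congr_enc fun _ => rfl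

theorem snd : PTF (Prod.snd : α × β → β) := (tl.comp toTr).congr_enc fun _ => rfl

end PTF

instance {p : α → Prop} : Enc {x // p x} := ⟨fun x => enc x.1⟩

namespace PTF

theorem val {p : α → Prop} : PTF (Subtype.val : {x // p x} → α) := toTr.congr_enc fun _ => rfl

/-- Each branch need only be defined where it is taken; a subtype is encoded by its underlying
values, so passing to it costs nothing. The value `true` is a node with two empty subtrees: once its
first symbol is popped, two trees `nil` remain to be dropped. -/
theorem dcond {b : α → Bool} {f : {x // b x = true} → β} {g : {x // ¬b x = true} → β} (hb : PTF b)
    (hf : PTF f) (hg : PTF g) :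
    PTF fun x => if h : b x = true then f ⟨x, h⟩ else g ⟨x, h⟩ := by
  obtain ⟨p, T, hT, h⟩ := hf
  obtain ⟨q, U, hU, h'⟩ := hg
  obtain ⟨s, V, hV, h''⟩ := hb
  refine ⟨.seq dup (.seq s (.case .main fun o => if o = some (.bit true) then
    .seq drop (.seq drop p) else q)),
    fun n => (10 * n + 4) + (V n + ((16 + T n + U n) + 1)), ?_, fun x r => ?_⟩
  · exact (((PB.const 10).mul PB.id).add (PB.const 4)).add (hV.add
      ((((PB.const 16).add hT).add hU).add (PB.const 1)))
  · refine (dup_runs (enc x) r).seq ((h'' x _).seq ?_)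
    by_cases hbx : b x = true
    · have h₁ : RunsLE (.seq drop (.seq drop p))
        (stk (Tr.nil.ser ++ (Tr.nil.ser ++ ((enc x).ser ++ r))) [] [] [])
        (stk ((enc (f ⟨x, hbx⟩)).ser ++ r) [] [] []) (16 + T (size x) + U (size x)) :=
        ((drop_runs .nil _).seq ((drop_runs .nil _).seq (h ⟨x, hbx⟩ r))).mono
          (by simp only [Tr.ser, List.length_singleton, size]; simp only [enc]; omega)
      dsimp only
      rw [dif_pos hbx, hbx]
      exact RunsLE.case_main (g := fun o => if o = some (.bit true) then
        .seq drop (.seq drop p) else q) (x := .bit true) h₁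
    · have h₁ : RunsLE q (stk ((enc x).ser ++ r) [] [] [])
        (stk ((enc (g ⟨x, hbx⟩)).ser ++ r) [] [] []) (16 + T (size x) + U (size x)) :=
        (h' ⟨x, hbx⟩ r).mono (by simp only [size]; simp only [enc]; omega)
      dsimp only
      rw [dif_neg hbx, Bool.eq_false_iff.mpr hbx]
      exact RunsLE.case_main (g := fun o => if o = some (.bit true) then
        .seq drop (.seq drop p) else q) (x := .bit false) h₁

theorem cond {b : α → Bool} {f g : α → β} (hb : PTF b) (hf : PTF f) (hg : PTF g) :
    PTF fun x => bif b x then f x else g x := by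
  refine (dcond hb (hf.comp val) (hg.comp val)).congr fun x => ?_
  by_cases h : b x = true <;> simp [h]

end PTF

/-- Right-nested lists of trees. -/
def encList' : List Tr → Tr
  | [] => .nil
  | x :: l => .node x (encList' l)

instance : Enc (List α) := ⟨fun l => encList' (l.map enc)⟩

theorem enc_cons (x : α) (l : List α) : enc (x :: l) = .node (enc x) (enc l) := rfl

theorem size_nil : size ([] : List α) = 1 := rfl

theorem size_cons (x : α) (l : List α) : size (x :: l) = size x + size l + 1 :=
  size_prod (x, l)

theorem length_lt_size (l : List α) : l.length < size l := by
  induction l with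
  | nil => exact Nat.zero_lt_one
  | cons x l ih =>
    rw [size_cons, List.length_cons]
    omega

/-- Iteration with a polynomial bound on the size of all intermediate values; the number of
iterations is the length of a list. -/
theorem PTF.iterate {step : β → β} {f : α → β} {n : α → List γ} (hs : PTF step) (hf : PTF f)
    (hn : PTF n) {B : ℕ → ℕ} (hB : PB B)
    (hb : ∀ x, ∀ i ≤ (n x).length, size (step^[i] (f x)) ≤ B (size x)) :
    PTF fun x => step^[(n x).length] (f x) := by
  obtain ⟨d, hd⟩ := hn.sb
  obtain ⟨p, T, ⟨c, hc⟩, h⟩ := hs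
  obtain ⟨q, U, hU, h'⟩ := hf
  obtain ⟨s, V, hV, h''⟩ := hn
  -- A single token on `.c` drives the loop. It is popped before the body, so that `p` starts with
  -- `.c` empty as it must, and it is replaced only while the list is not exhausted.
  set body : Γ' → Prog := fun _ => .seq swap (.case .main fun o => if o = some (.bit true) then
    .seq drop (.seq swap (.seq p (.push .c .blank))) else .skip) with hbody
  set W : ℕ → ℕ := fun n => 22 * ((n + 2) ^ d + B n) + 20 + (B n + 2) ^ c with hW
  have key : ∀ (x : α) (r : List Γ') (i : ℕ) (l : List γ), i + l.length = (n x).length →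
      size l ≤ (size x + 2) ^ d →
      RunsLE (.loop .c body) (stk ((enc (step^[i] (f x))).ser ++ ((enc l).ser ++ r)) [] []
        [.blank]) (stk ((enc (step^[(n x).length] (f x))).ser ++ r) [] [] [])
        ((l.length + 1) * (W (size x) + 1)) := by
    intro x r i l hij hl
    induction l generalizing i with
    | nil =>
      have e : i = (n x).length := hij
      have h₁ := swap_runs (enc (step^[i] (f x))) (enc ([] : List γ)) r
      refine (RunsLE.loop_c (h₁.seq (RunsLE.case_main (RunsLE.skip _))) (t := 1)
        (by rw [e]; exact RunsLE.loop_nil rfl)).mono ?_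
      have h₂ := hb x i (by omega)
      simp only [W, List.length_nil, zero_add, one_mul]
      generalize (B _ + 2) ^ c = Z
      unfold size at *
      omega
    | cons y l ih =>
      rw [List.length_cons] at hij
      have hl' := hl
      rw [size_cons] at hl'
      have ih' := ih (i + 1) (by omega) (by omega)
      rw [Function.iterate_succ_apply'] at ih'
      have h₁ := swap_runs (enc (step^[i] (f x))) (enc (y :: l)) r
      have h₀ := drop_runs (enc y) ((enc l).ser ++ ((enc (step^[i] (f x))).ser ++ r))
      have h₂ := swap_runs (enc l) (enc (step^[i] (f x))) r
      have h₃ := h (step^[i] (f x)) ((enc l).ser ++ r)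
      rw [← List.append_assoc] at h₀
      have h₄ := (h₁.seq (RunsLE.case_main (g := fun o => if o = some (.bit true) then
        .seq drop (.seq swap (.seq p (.push .c .blank))) else .skip) (x := .bit true)
        (h₀.seq (h₂.seq (h₃.seq RunsLE.push_c)))))
      refine (RunsLE.loop_c h₄ ih').mono ?_
      have b₁ := hb x i (by omega)
      have b₄ : T (size (step^[i] (f x))) ≤ (B (size x) + 2) ^ c :=
        (hc _).trans (Nat.pow_le_pow_left (by omega) c)
      rw [List.length_cons, Nat.succ_mul (l.length + 1)]
      simp only [W]
      unfold size at *
      generalize (l.length + 1) * _ = Z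
      omega
  refine ⟨.seq dup (.seq s (.seq swap (.seq q (.seq (.push .c .blank) (.loop .c body))))),
    fun n => (10 * n + 4) + (V n + ((8 * ((n + 2) ^ d + n) + 6) + (U n + (1 +
      ((n + 2) ^ d + 1) * (W n + 1))))), ?_, fun x r => ?_⟩
  · have hWP : PB W := (((PB.const 22).mul ((PB.pow_self d).add hB)).add (PB.const 20)).add
      ((hB.add (PB.const 2)).pow c)
    exact (((PB.const 10).mul PB.id).add (PB.const 4)).add (hV.add
      ((((PB.const 8).mul ((PB.pow_self d).add PB.id)).add (PB.const 6)).add (hU.add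
        ((PB.const 1).add (((PB.pow_self d).add (PB.const 1)).mul (hWP.add (PB.const 1)))))))
  · have hdx := hd x
    refine (dup_runs (enc x) r).seq ((h'' x _).seq (((swap_runs _ _ r).mono ?_).seq
      ((h' x _).seq (RunsLE.push_c.seq ((key x r 0 (n x) (by omega) hdx).mono ?_)))))
    · unfold size at *
      omega
    · refine Nat.mul_le_mul_right _ ?_
      have := length_lt_size (n x)
      omega

end PolyTime

namespace PolyTime

open Turing
open Computability (Γ')
open Enc (enc)

variable {α β γ δ : Type} [Enc α] [Enc β] [Enc γ] [Enc δ]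

/-! ### Lists -/

theorem size_bool_le (b : Bool) : size b ≤ 3 := by cases b <;> decide

theorem size_mem {x : α} {l : List α} (h : x ∈ l) : size x < size l := by
  induction l with
  | nil => simp at h
  | cons y l ih =>
    rw [size_cons]
    rcases List.mem_cons.mp h with rfl | h
    · omega
    · have := ih h
      omega

theorem size_append (l l' : List α) : size (l ++ l') + 1 = size l + size l' := by
  induction l with
  | nil => rw [List.nil_append, size_nil]; omega
  | cons x l ih =>
    rw [List.cons_append, size_cons, size_cons]
    omega

theorem size_reverse (l : List α) : size l.reverse = size l := by
  induction l with
  | nil => rfl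
  | cons x l ih =>
    have := size_append l.reverse [x]
    rw [size_cons, size_nil] at this
    rw [List.reverse_cons, size_cons]
    omega

theorem size_sublist {l l' : List α} (h : l.Sublist l') : size l ≤ size l' := by
  induction h with
  | slnil => exact le_rfl
  | cons a _ ih => rw [size_cons]; omega
  | cons_cons a _ ih => rw [size_cons, size_cons]; omega

theorem size_le_of_forall_le {l : List α} {B : ℕ} (h : ∀ x ∈ l, size x ≤ B) :
    size l ≤ l.length * (B + 1) + 1 := by
  induction l with
  | nil => rw [size_nil]; omega
  | cons x l ih =>
    have h₁ := h x (by simp)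
    have h₂ := ih fun y hy => h y (by simp [hy])
    rw [size_cons, List.length_cons, Nat.succ_mul]
    omega

namespace PTF

theorem cons {f : α → β} {l : α → List β} (hf : PTF f) (hl : PTF l) : PTF fun x => f x :: l x :=
  (hf.pair hl).congr_enc fun _ => rfl

theorem tail {l : α → List β} (hl : PTF l) : PTF fun x => (l x).tail :=
  (PTF.tl.comp (toTr.comp hl)).congr_enc fun x => by cases l x <;> rfl

theorem isEmpty {l : α → List β} (hl : PTF l) : PTF fun x => (l x).isEmpty :=
  (cond (PTF.isNode.comp (toTr.comp hl)) (const false) (const true)).congr fun x => by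
    cases l x <;> rfl

theorem not {b : α → Bool} (hb : PTF b) : PTF fun x => !b x :=
  (cond hb (const false) (const true)).congr fun x => by cases b x <;> rfl

theorem and {b b' : α → Bool} (hb : PTF b) (hb' : PTF b') : PTF fun x => b x && b' x :=
  (cond hb hb' (const false)).congr fun x => by cases b x <;> rfl

theorem or {b b' : α → Bool} (hb : PTF b) (hb' : PTF b') : PTF fun x => b x || b' x :=
  (cond hb (const true) hb').congr fun x => by cases b x <;> rfl

/-- The case distinction goes through `dcond`, so that the head is taken only of lists known to be
nonempty and `β` needs no default element. -/
theorem matchList {l : α → List β} {f : α → γ} {g : α × β × List β → γ} (hl : PTF l) (hf : PTF f)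
    (hg : PTF g) :
    PTF fun x => match l x with
      | [] => f x
      | b :: t => g (x, b, t) := by
  have h₁ : PTF fun x : {x // ¬(l x).isEmpty = true} =>
      ((l x.1).head (by simpa using x.2)) := by
    refine (PTF.hd.comp (toTr.comp (hl.comp val))).congr_enc fun x => ?_
    have key : ∀ (L : List β) (h : L ≠ []), (enc L).hd = enc (L.head h) := by
      intro L h
      cases L with
      | nil => exact absurd rfl h
      | cons b t => rfl
    exact key _ _
  refine (dcond (isEmpty hl) (hf.comp val)
    (hg.comp (pair val (pair h₁ (tail (hl.comp val)))))).congr fun x => ?_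
  have key : ∀ (M : List β → γ), (∀ b t, M (b :: t) = g (x, b, t)) →
      ∀ (L : List β) (h : ¬L.isEmpty = true),
      g (x, L.head (by simpa using h), L.tail) = M L := by
    intro M hM L h
    cases L with
    | nil => simp at h
    | cons b t => exact (hM b t).symm
  by_cases h : (l x).isEmpty = true
  · rw [dif_pos h]
    rw [List.isEmpty_iff] at h
    rw [h]
  · rw [dif_neg h]
    exact key (fun L => match L with
      | [] => f x
      | b :: t => g (x, b, t)) (fun _ _ => rfl) _ h

/-- The fold is iterated on triples of the parameter, the accumulator and the remaining list; only
accumulators arising from prefixes of the list need a size bound. -/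
theorem foldl {l : α → List β} {f : α → γ} {step : α × γ × β → γ} (hl : PTF l) (hf : PTF f)
    (hs : PTF step) {B : ℕ → ℕ} (hB : PB B)
    (hb : ∀ x p, p <+: l x → size (p.foldl (fun acc b => step (x, acc, b)) (f x)) ≤ B (size x)) :
    PTF fun x => (l x).foldl (fun acc b => step (x, acc, b)) (f x) := by
  obtain ⟨d, hd⟩ := hl.sb
  have key : ∀ (x : α) (i : ℕ), i ≤ (l x).length →
      (fun q : α × γ × List β => match q.2.2 with
        | [] => q
        | b :: t => (q.1, step (q.1, q.2.1, b), t))^[i] (x, f x, l x) =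
      (x, ((l x).take i).foldl (fun acc b => step (x, acc, b)) (f x), (l x).drop i) := by
    intro x i hi
    induction i with
    | zero => rfl
    | succ i ih =>
      rw [Function.iterate_succ_apply', ih (by omega)]
      have hlt : i < (l x).length := by omega
      rw [List.drop_eq_getElem_cons hlt, List.take_succ_eq_append_getElem hlt]
      simp only [List.foldl_append, List.foldl_cons, List.foldl_nil]
  have hstep : PTF (fun q : α × γ × List β => match q.2.2 with
        | [] => q
        | b :: t => (q.1, step (q.1, q.2.1, b), t)) :=
    matchList (l := fun q : α × γ × List β => q.2.2) (f := fun q => q)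
      (g := fun r : (α × γ × List β) × β × List β =>
        (r.1.1, step (r.1.1, r.1.2.1, r.2.1), r.2.2)) (snd.comp snd) id
      (pair (fst.comp fst) (pair (hs.comp (pair (fst.comp fst)
        (pair (fst.comp (snd.comp fst)) (fst.comp snd)))) (snd.comp snd)))
  have := PTF.iterate hstep (pair id (pair hf hl)) hl
    (B := fun n => n + (B n + (n + 2) ^ d + 1) + 1)
    (((PB.id.add ((hB.add (PB.pow_self d)).add (PB.const 1))).add (PB.const 1)))
    (fun x i hi => by
      rw [key x i hi, size_prod, size_prod]
      have h₁ := hb x _ (List.take_prefix i (l x))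
      have h₂ := (size_sublist (List.drop_sublist i (l x))).trans (hd x)
      dsimp only
      omega)
  refine ((fst.comp snd).comp this).congr fun x => ?_
  rw [key x _ le_rfl, List.take_length]

/-- Growth by a summand that does not depend on the accumulator stays polynomial over polynomially
many steps, whereas repeated doubling would not. This criterion serves most folds below. -/
theorem foldl_of_growth {l : α → List β} {f : α → γ} {step : α × γ × β → γ} (hl : PTF l)
    (hf : PTF f) (hs : PTF step) {G : ℕ → ℕ} (hG : PB G)
    (hg : ∀ x acc, ∀ b ∈ l x, size (step (x, acc, b)) ≤ size acc + G (size x)) :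
    PTF fun x => (l x).foldl (fun acc b => step (x, acc, b)) (f x) := by
  obtain ⟨d, hd⟩ := hl.sb
  obtain ⟨e, he⟩ := hf.sb
  refine foldl hl hf hs (B := fun n => (n + 2) ^ e + (n + 2) ^ d * G n)
    ((PB.pow_self e).add ((PB.pow_self d).mul hG)) fun x p hp => ?_
  have key : ∀ (p : List β) (acc : γ), (∀ b ∈ p, b ∈ l x) →
      size (p.foldl (fun acc b => step (x, acc, b)) acc) ≤ size acc + p.length * G (size x) := by
    intro p
    induction p with
    | nil => intro acc _; simp
    | cons b p ih =>
      intro acc hp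
      rw [List.foldl_cons, List.length_cons, Nat.succ_mul]
      have h₁ := hg x acc b (hp b (by simp))
      have h₂ := ih (step (x, acc, b)) fun c hc => hp c (by simp [hc])
      omega
  refine (key p (f x) fun b hb => hp.subset hb).trans (Nat.add_le_add (he x) ?_)
  exact Nat.mul_le_mul_right _ (hp.length_le.trans ((length_lt_size _).le.trans (hd x)))

theorem reverse {l : α → List β} (hl : PTF l) : PTF fun x => (l x).reverse := by
  obtain ⟨d, hd⟩ := hl.sb
  refine (foldl_of_growth (γ := List β) (step := fun q => q.2.2 :: q.2.1) hl (const [])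
    (cons (snd.comp snd) (fst.comp snd)) (G := fun n => (n + 2) ^ d + 1)
    ((PB.pow_self d).add (PB.const 1)) fun x acc b hb => ?_).congr fun x => ?_
  · rw [size_cons]
    have := (size_mem hb).le.trans (hd x)
    dsimp only
    omega
  · dsimp only
    rw [List.foldl_flip_cons_eq_append', List.append_nil]

theorem append {l l' : α → List β} (hl : PTF l) (hl' : PTF l') : PTF fun x => l x ++ l' x := by
  obtain ⟨d, hd⟩ := (reverse hl).sb
  refine (foldl_of_growth (γ := List β) (step := fun q => q.2.2 :: q.2.1) (reverse hl) hl'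
    (cons (snd.comp snd) (fst.comp snd)) (G := fun n => (n + 2) ^ d + 1)
    ((PB.pow_self d).add (PB.const 1)) fun x acc b hb => ?_).congr fun x => ?_
  · rw [size_cons]
    have := (size_mem hb).le.trans (hd x)
    dsimp only
    omega
  · dsimp only
    rw [List.foldl_flip_cons_eq_append', List.reverse_reverse]

theorem map {l : α → List β} {g : α × β → γ} (hl : PTF l) (hg : PTF g) :
    PTF fun x => (l x).map fun b => g (x, b) := by
  obtain ⟨d, hd⟩ := hl.sb
  obtain ⟨e, he⟩ := hg.sb
  refine (reverse (foldl_of_growth (γ := List γ) (step := fun q => g (q.1, q.2.2) :: q.2.1) hl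
    (const []) (cons (hg.comp (pair fst (snd.comp snd))) (fst.comp snd))
    (G := fun n => (n + (n + 2) ^ d + 1 + 2) ^ e + 1)
    (((((PB.id.add (PB.pow_self d)).add (PB.const 1)).add (PB.const 2)).pow e).add (PB.const 1))
    fun x acc b hb => ?_)).congr fun x => ?_
  · rw [size_cons]
    have h₁ := (size_mem hb).le.trans (hd x)
    have h₂ := he (x, b)
    rw [size_prod] at h₂
    have h₃ : (size x + size b + 1 + 2) ^ e ≤ (size x + (size x + 2) ^ d + 1 + 2) ^ e :=
      Nat.pow_le_pow_left (by omega) e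
    dsimp only at h₂ ⊢
    omega
  · dsimp only
    have key : ∀ (l : List β) (acc : List γ),
        (l.foldl (fun acc b => g (x, b) :: acc) acc).reverse =
          acc.reverse ++ l.map fun b => g (x, b) := by
      intro l
      induction l with
      | nil => simp
      | cons b l ih => intro acc; rw [List.foldl_cons, ih]; simp
    rw [key]
    rfl

theorem flatten {l : α → List (List β)} (hl : PTF l) : PTF fun x => (l x).flatten := by
  obtain ⟨d, hd⟩ := hl.sb
  refine (foldl_of_growth (γ := List β) (step := fun q => q.2.1 ++ q.2.2) hl (const [])
    (append (fst.comp snd) (snd.comp snd)) (G := fun n => (n + 2) ^ d)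
    (PB.pow_self d) fun x acc b hb => ?_).congr fun x => ?_
  · have := (size_mem hb).le.trans (hd x)
    have := size_append acc b
    dsimp only
    omega
  · dsimp only
    have key : ∀ (l : List (List β)) (acc : List β),
        l.foldl (fun acc b => acc ++ b) acc = acc ++ l.flatten := by
      intro l
      induction l with
      | nil => simp
      | cons b l ih => intro acc; rw [List.foldl_cons, ih]; simp
    rw [key]
    rfl

theorem flatMap {l : α → List β} {g : α × β → List γ} (hl : PTF l) (hg : PTF g) :
    PTF fun x => (l x).flatMap fun b => g (x, b) :=
  (flatten (map hl hg)).congr fun x => by rw [List.flatMap_def]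

theorem all {l : α → List β} {g : α × β → Bool} (hl : PTF l) (hg : PTF g) :
    PTF fun x => (l x).all fun b => g (x, b) := by
  refine (foldl_of_growth (γ := Bool) (step := fun q => q.2.1 && g (q.1, q.2.2)) hl (const true)
    (and (fst.comp snd) (hg.comp (pair fst (snd.comp snd)))) (G := fun _ => 3) (PB.const 3)
    fun x acc b _ => ?_).congr fun x => ?_
  · exact (size_bool_le _).trans (Nat.le_add_left _ _)
  · dsimp only
    have key : ∀ (l : List β) (acc : Bool),
        l.foldl (fun acc b => acc && g (x, b)) acc = (acc && l.all fun b => g (x, b)) := by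
      intro l
      induction l with
      | nil => simp
      | cons b l ih => intro acc; rw [List.foldl_cons, ih, List.all_cons, Bool.and_assoc]
    rw [key]
    rfl

/-- A fold over `l` whose accumulator holds the unread part of `l'` and the reversed result. What a
step adds depends on the accumulator, so `foldl_of_growth` does not apply, and the sizes are read
off the closed form in `key`. -/
theorem zipWith {l : α → List β} {l' : α → List γ} {g : α × β × γ → δ} (hl : PTF l)
    (hl' : PTF l') (hg : PTF g) :
    PTF fun x => List.zipWith (fun b c => g (x, b, c)) (l x) (l' x) := by
  obtain ⟨d, hd⟩ := hl.sb
  obtain ⟨d', hd'⟩ := hl'.sb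
  obtain ⟨e, he⟩ := hg.sb
  have hs : PTF fun q : α × (List γ × List δ) × β => match q.2.1.1 with
      | [] => q.2.1
      | c :: t => (t, g (q.1, q.2.2, c) :: q.2.1.2) :=
    matchList (l := fun q : α × (List γ × List δ) × β => q.2.1.1) (f := fun q => q.2.1)
      (g := fun r : (α × (List γ × List δ) × β) × γ × List γ =>
        (r.2.2, g (r.1.1, r.1.2.2, r.2.1) :: r.1.2.1.2)) (fst.comp (fst.comp snd)) (fst.comp snd)
      (pair (snd.comp snd) (cons (hg.comp (pair (fst.comp fst) (pair (snd.comp (snd.comp fst))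
        (fst.comp snd)))) (snd.comp (fst.comp (snd.comp fst)))))
  have key : ∀ (x : α) (p : List β) (m : List γ) (acc : List δ),
      p.foldl (fun acc b => match acc.1 with
        | [] => acc
        | c :: t => (t, g (x, b, c) :: acc.2)) (m, acc) =
      (m.drop p.length, (List.zipWith (fun b c => g (x, b, c)) p m).reverse ++ acc) := by
    intro x p
    induction p with
    | nil => intro m acc; simp
    | cons b p ih =>
      intro m acc
      cases m with
      | nil => rw [List.foldl_cons]; simp only; rw [ih]; simp
      | cons c m => rw [List.foldl_cons]; simp only; rw [ih]; simp
  refine (reverse (snd.comp (foldl hl (pair hl' (const [])) hs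
    (B := fun n => (n + 2) ^ d' +
      ((n + 2) ^ d * ((n + ((n + 2) ^ d + (n + 2) ^ d' + 1) + 1 + 2) ^ e + 1) + 1) + 1)
    (((PB.pow_self d').add (((PB.pow_self d).mul (((((PB.id.add (((PB.pow_self d).add
      (PB.pow_self d')).add (PB.const 1))).add (PB.const 1)).add (PB.const 2)).pow e).add
        (PB.const 1))).add (PB.const 1))).add (PB.const 1)) fun x p hp => ?_))).congr fun x => ?_
  · dsimp only
    rw [key, size_prod, List.append_nil]
    have h₁ := (size_sublist (List.drop_sublist p.length (l' x))).trans (hd' x)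
    have h₂ : size (List.zipWith (fun b c => g (x, b, c)) p (l' x)).reverse ≤
        (size x + 2) ^ d * ((size x + ((size x + 2) ^ d + (size x + 2) ^ d' + 1) + 1 + 2) ^ e + 1)
          + 1 := by
      rw [size_reverse]
      refine (size_le_of_forall_le
        (B := (size x + ((size x + 2) ^ d + (size x + 2) ^ d' + 1) + 1 + 2) ^ e) ?_).trans
        (Nat.add_le_add_right (Nat.mul_le_mul_right _ ?_) 1)
      · intro y hy
        rw [← List.map_uncurry_zip_eq_zipWith, List.mem_map] at hy
        obtain ⟨⟨b, c⟩, hbc, rfl⟩ := hy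
        obtain ⟨hb, hc⟩ := List.of_mem_zip hbc
        refine (he _).trans (Nat.pow_le_pow_left ?_ e)
        rw [size_prod, size_prod]
        have := (size_mem (hp.subset hb)).le.trans (hd x)
        have := (size_mem hc).le.trans (hd' x)
        dsimp only
        omega
      · rw [List.length_zipWith]
        exact (Nat.min_le_left _ _).trans (hp.length_le.trans
          ((length_lt_size _).le.trans (hd x)))
    dsimp only
    omega
  · dsimp only
    rw [key]
    simp

end PTF

end PolyTime

namespace PolyTime

open Turing
open Computability (Γ')
open Enc (enc)

variable {α β γ δ : Type} [Enc α] [Enc β] [Enc γ] [Enc δ]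

/-! ### Unary numbers -/

/-- Unary natural numbers. -/
instance : Enc ℕ := ⟨fun n => enc (List.replicate n false)⟩

theorem enc_nat (n : ℕ) : enc n = enc (List.replicate n false) := rfl

theorem size_nat (n : ℕ) : size n = 2 * n + 1 := by
  show size (List.replicate n false) = _
  induction n with
  | zero => rfl
  | succ n ih =>
    rw [List.replicate_succ, size_cons, ih, show size false = 1 from rfl]
    omega

namespace PTF

theorem replicateFalse {n : α → ℕ} (hn : PTF n) : PTF fun x => List.replicate (n x) false :=
  hn.congr_enc fun _ => rfl

theorem replicate {n : α → ℕ} {f : α → β} (hn : PTF n) (hf : PTF f) :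
    PTF fun x => List.replicate (n x) (f x) :=
  (map (replicateFalse hn) (hf.comp fst)).congr fun x => by simp

theorem length {l : α → List β} (hl : PTF l) : PTF fun x => (l x).length :=
  (map hl (const false)).congr_enc fun x => by rw [enc_nat, List.map_const']

theorem succ {n : α → ℕ} (hn : PTF n) : PTF fun x => n x + 1 :=
  (cons (const false) (replicateFalse hn)).congr_enc fun _ => rfl

theorem pred {n : α → ℕ} (hn : PTF n) : PTF fun x => n x - 1 :=
  (tail (replicateFalse hn)).congr_enc fun x => by rw [enc_nat, List.tail_replicate]

theorem add {n m : α → ℕ} (hn : PTF n) (hm : PTF m) : PTF fun x => n x + m x :=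
  (append (replicateFalse hn) (replicateFalse hm)).congr_enc fun x => by
    rw [enc_nat, List.replicate_append_replicate]

theorem mul {n m : α → ℕ} (hn : PTF n) (hm : PTF m) : PTF fun x => n x * m x :=
  (length (flatMap (replicateFalse hn) (replicateFalse (hm.comp fst)))).congr fun x => by
    simp

theorem isZero {n : α → ℕ} (hn : PTF n) : PTF fun x => decide (n x = 0) :=
  (isEmpty (replicateFalse hn)).congr fun x => by cases n x <;> simp [List.replicate_succ]

theorem iterateNat {step : β → β} {f : α → β} {n : α → ℕ} (hs : PTF step) (hf : PTF f)
    (hn : PTF n) {B : ℕ → ℕ} (hB : PB B) (hb : ∀ x, ∀ i ≤ n x, size (step^[i] (f x)) ≤ B (size x)) :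
    PTF fun x => step^[n x] (f x) :=
  (iterate hs hf (replicateFalse hn) hB fun x i hi => hb x i (by simpa using hi)).congr
    fun x => by rw [List.length_replicate]

theorem le {n m : α → ℕ} (hn : PTF n) (hm : PTF m) : PTF fun x => decide (n x ≤ m x) := by
  obtain ⟨d, hd⟩ := (succ hm).sb
  have key : ∀ i k : ℕ, (fun j => j - 1)^[i] k = k - i := by
    intro i
    induction i with
    | zero => intro k; rfl
    | succ i ih => intro k; rw [Function.iterate_succ_apply, ih]; omega
  refine (not (isZero (iterateNat (pred id) (succ hm) hn (B := fun n => (n + 2) ^ d)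
    (PB.pow_self d) fun x i _ => ?_))).congr fun x => ?_
  · rw [key]
    refine le_trans ?_ (hd x)
    rw [size_nat, size_nat]
    dsimp only
    omega
  · rw [key, ← decide_not]
    exact decide_eq_decide.mpr (by omega)

/-- Finite tables. -/
theorem table (K : ℕ) (F : ℕ → β) (d : β) : PTF fun n : ℕ => if n < K then F n else d := by
  induction K generalizing F with
  | zero => exact const d
  | succ K ih =>
    refine (cond (isZero id) (const (F 0)) ((ih fun n => F (n + 1)).comp (pred id))).congr
      fun n => ?_
    cases n with
    | zero => simp
    | succ n => simp

end PTF

/-! ### Symbols and strings -/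

/-- The symbols in a fixed order. -/
def symbols : List Γ' := [.blank, .bit false, .bit true, .bra, .ket, .comma]

/-- The position of a symbol in the fixed order. -/
def symbolIndex : Γ' → ℕ
  | .blank => 0
  | .bit false => 1
  | .bit true => 2
  | .bra => 3
  | .ket => 4
  | .comma => 5

instance : Enc Γ' := ⟨fun s => enc (symbolIndex s)⟩

theorem size_symbol_le (s : Γ') : size s ≤ 11 := by
  show size (symbolIndex s) ≤ 11
  rw [size_nat]
  rcases s with _ | (_ | _) | _ | _ | _ <;> decide

theorem size_string_le (s : List Γ') : size s ≤ s.length * 12 + 1 :=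
  size_le_of_forall_le fun x _ => size_symbol_le x

namespace PTF

theorem symbol (F : Γ' → β) : PTF F := by
  have h : PTF fun s : Γ' => symbolIndex s := toTr.congr_enc fun _ => rfl
  refine ((table 6 (fun n => F (symbols.getD n .blank)) (F .blank)).comp h).congr fun s => ?_
  rcases s with _ | (_ | _) | _ | _ | _ <;> rfl

theorem symbolEq {f g : α → Γ'} (hf : PTF f) (hg : PTF g) : PTF fun x => decide (f x = g x) := by
  have key : ∀ l : List Γ', PTF fun x => l.any fun s => decide (f x = s) && decide (g x = s) := by
    intro l
    induction l with
    | nil => exact const false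
    | cons s l ih =>
      refine (or (and ((symbol fun t => decide (t = s)).comp hf)
        ((symbol fun t => decide (t = s)).comp hg)) ih).congr fun x => ?_
      rw [List.any_cons]
  refine (key symbols).congr fun x => ?_
  generalize f x = a
  generalize g x = b
  revert a b
  decide

theorem takeWhile {l : α → List β} {p : β → Bool} (hl : PTF l) (hp : PTF p) :
    PTF fun x => (l x).takeWhile p := by
  obtain ⟨d, hd⟩ := hl.sb
  have hs : PTF fun q : α × (Bool × List β) × β =>
      bif q.2.1.1 && p q.2.2 then (true, q.2.2 :: q.2.1.2) else (false, q.2.1.2) :=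
    cond (and (fst.comp (fst.comp snd)) (hp.comp (snd.comp snd)))
      (pair (const true) (cons (snd.comp snd) (snd.comp (fst.comp snd))))
      (pair (const false) (snd.comp (fst.comp snd)))
  have key₀ : ∀ (l acc : List β), l.foldl (fun (q : Bool × List β) b =>
      bif q.1 && p b then (true, b :: q.2) else (false, q.2)) (false, acc) = (false, acc) := by
    intro l
    induction l with
    | nil => intro acc; rfl
    | cons b l ih => intro acc; rw [List.foldl_cons]; exact ih acc
  have key : ∀ (l acc : List β), (l.foldl (fun (q : Bool × List β) b =>
      bif q.1 && p b then (true, b :: q.2) else (false, q.2)) (true, acc)).2 =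
        (l.takeWhile p).reverse ++ acc := by
    intro l
    induction l with
    | nil => intro acc; rfl
    | cons b l ih =>
      intro acc
      rw [List.foldl_cons, List.takeWhile_cons]
      cases hb : p b
      · simp only [Bool.and_false, cond_false, key₀]
        rfl
      · simp only [Bool.and_true, cond_true, ih]
        simp
  refine (reverse (snd.comp (foldl_of_growth hl (const (true, [])) hs
    (G := fun n => (n + 2) ^ d + 4) ((PB.pow_self d).add (PB.const 4))
    fun x acc b hb => ?_))).congr fun x => ?_
  · have h₁ := (size_mem hb).le.trans (hd x)
    dsimp only
    have h₂ := size_prod acc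
    have h₃ := size_pos acc.1
    cases acc.1 && p b
    · rw [cond_false, size_prod, show size false = 1 from rfl]
      dsimp only
      omega
    · rw [cond_true, size_prod, size_cons, show size true = 3 from rfl]
      omega
  · dsimp only
    rw [key]
    simp

theorem dropWhile {l : α → List β} {p : β → Bool} (hl : PTF l) (hp : PTF p) :
    PTF fun x => (l x).dropWhile p := by
  obtain ⟨d, hd⟩ := hl.sb
  have hs : PTF fun q : α × (Bool × List β) × β =>
      bif q.2.1.1 && p q.2.2 then q.2.1 else (false, q.2.2 :: q.2.1.2) :=
    cond (and (fst.comp (fst.comp snd)) (hp.comp (snd.comp snd))) (fst.comp snd)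
      (pair (const false) (cons (snd.comp snd) (snd.comp (fst.comp snd))))
  have key₀ : ∀ (l acc : List β), l.foldl (fun (q : Bool × List β) b =>
      bif q.1 && p b then q else (false, b :: q.2)) (false, acc) =
        (false, l.reverse ++ acc) := by
    intro l
    induction l with
    | nil => intro acc; rfl
    | cons b l ih =>
      intro acc
      rw [List.foldl_cons]
      exact (ih (b :: acc)).trans (by simp)
  have key : ∀ l : List β, (l.foldl (fun (q : Bool × List β) b =>
      bif q.1 && p b then q else (false, b :: q.2)) (true, [])).2 = (l.dropWhile p).reverse := by
    intro l
    induction l with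
    | nil => rfl
    | cons b l ih =>
      rw [List.foldl_cons, List.dropWhile_cons]
      cases hb : p b
      · simp only [Bool.and_false, cond_false, key₀]
        simp
      · simp only [Bool.and_true, cond_true, ih]
        simp
  refine (reverse (snd.comp (foldl_of_growth hl (const (true, [])) hs
    (G := fun n => (n + 2) ^ d + 4) ((PB.pow_self d).add (PB.const 4))
    fun x acc b hb => ?_))).congr fun x => ?_
  · have h₁ := (size_mem hb).le.trans (hd x)
    dsimp only
    have h₂ := size_prod acc
    have h₃ := size_pos acc.1
    cases acc.1 && p b
    · rw [cond_false, size_prod, size_cons, show size false = 1 from rfl]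
      omega
    · rw [cond_true]
      omega
  · dsimp only
    rw [key, List.reverse_reverse]

theorem stringEq {f g : α → List Γ'} (hf : PTF f) (hg : PTF g) :
    PTF fun x => decide (f x = g x) := by
  refine (and (all (zipWith hf hg (g := fun q => decide (q.2.1 = q.2.2))
    (symbolEq (fst.comp snd) (snd.comp snd))) (g := fun q => q.2) snd)
    (and (le (length hf) (length hg)) (le (length hg) (length hf)))).congr fun x => ?_
  generalize f x = s
  generalize g x = t
  induction s generalizing t with
  | nil => cases t <;> simp
  | cons a s ih =>
    cases t with
    | nil => simp
    | cons b t =>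
      have h := ih t
      by_cases hab : a = b <;>
        simp only [List.zipWith_cons_cons, List.all_cons, List.length_cons, List.cons.injEq, hab,
          Nat.add_le_add_iff_right, decide_true, decide_false, Bool.true_and, Bool.false_and,
          true_and, false_and]
      exact h

/-- Membership in a fixed finite set of strings. -/
theorem stringMem {f : α → List Γ'} (hf : PTF f) (L : List (List Γ')) :
    PTF fun x => decide (f x ∈ L) := by
  induction L with
  | nil => exact (const false).congr fun x => by simp
  | cons s L ih =>
    refine (or (stringEq hf (const s)) ih).congr fun x => ?_
    simp

end PTF

/-! ### Input and output -/

/-- Push symbols on the second auxiliary stack, the first one first. -/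
def pushListB : List Γ' → Prog
  | [] => .skip
  | x :: l => .seq (.push .b x) (pushListB l)

theorem pushListB_runs (l m a b : List Γ') :
    RunsLE (pushListB l) (stk m a b []) (stk m a (l.reverse ++ b) []) (l.length + 1) := by
  induction l generalizing b with
  | nil => exact RunsLE.skip _
  | cons x l ih =>
    have := RunsLE.push_b.seq (ih (x :: b))
    rw [List.reverse_cons, List.append_assoc, List.length_cons]
    exact this.mono (by omega)

/-- Convert a string, stored in reverse, to the tree that represents it. -/
def readInput : Prog :=
  .seq (.loop .main fun x => .push .a x) (.seq
    (.loop .a fun x => pushListB (.bit true :: (enc x).ser))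
    (.seq (.push .b (.bit false)) (.loop .b fun x => .push .main x)))

/-- A list is serialised as `bit true` and the tree of the entry, for each entry, followed by one
`bit false`. The input arrives reversed; it is reversed onto `.a`, expanded onto `.b`, and flushed
back in the right order. -/
theorem readInput_runs (s : List Γ') :
    RunsLE readInput (stk s.reverse [] [] []) (stk (enc s).ser [] [] []) (100 * s.length + 100) := by
  have h₁ : ∀ (w a : List Γ'), RunsLE (.loop .main fun x => .push .a x) (stk w a [] [])
      (stk [] (w.reverse ++ a) [] []) (2 * w.length + 1) := by
    intro w
    induction w with
    | nil => intro a; exact RunsLE.loop_nil rfl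
    | cons x w ih =>
      intro a
      have := RunsLE.loop_main (f := fun x => .push .a x) (m := w) (a := a) (b := []) (c := [])
        RunsLE.push_a (ih (x :: a))
      simp only [List.reverse_cons, List.append_assoc, List.singleton_append, List.length_cons]
      exact this.mono (by omega)
  have h₂ : ∀ (s b : List Γ'), RunsLE (.seq
      (.loop .a fun x => pushListB (.bit true :: (enc x).ser)) (.push .b (.bit false)))
      (stk [] s b []) (stk [] [] ((enc s).ser.reverse ++ b) []) (20 * s.length + 2) := by
    intro s
    induction s with
    | nil =>
      intro b
      have h : RunsLE (.push .b (.bit false)) (stk [] [] b [])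
        (stk [] [] ((enc ([] : List Γ')).ser.reverse ++ b) []) 1 := RunsLE.push_b
      exact (RunsLE.seq (RunsLE.loop_nil rfl) h).mono (by simp)
    | cons x s ih =>
      intro b
      have e : (enc (x :: s)).ser.reverse ++ b =
          (enc s).ser.reverse ++ ((.bit true :: (enc x).ser).reverse ++ b) := by
        rw [enc_cons]
        simp [Tr.ser]
      rw [e]
      obtain ⟨t, ht, hr⟩ := ih ((.bit true :: (enc x).ser).reverse ++ b)
      cases hr with
      | @seq _ _ _ S' _ t₁ t₂ hr₁ hr₂ =>
        have := (RunsLE.loop_a (f := fun x => pushListB (.bit true :: (enc x).ser))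
          (pushListB_runs (.bit true :: (enc x).ser) [] s b) ⟨t₁, le_rfl, hr₁⟩).seq
          ⟨t₂, le_rfl, hr₂⟩
        refine this.mono ?_
        have := size_symbol_le x
        unfold size at this
        simp only [List.length_cons]
        omega
  have h₃ := h₁ s.reverse []
  rw [List.reverse_reverse, List.append_nil, List.length_reverse] at h₃
  obtain ⟨t, ht, hr⟩ := h₂ s []
  rw [List.append_nil] at hr
  cases hr with
  | @seq _ _ _ S' _ t₁ t₂ hr₁ hr₂ =>
    have h₄ := flush_b (enc s).ser.reverse [] [] []
    rw [List.reverse_reverse, List.append_nil, List.length_reverse] at h₄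
    have := size_string_le s
    unfold size at this
    have h₅ : RunsLE _ _ _ _ := ⟨t₁, le_rfl, hr₁⟩
    have h₆ : RunsLE _ _ _ _ := ⟨t₂, le_rfl, hr₂⟩
    exact (h₃.seq (RunsLE.seq h₅ (RunsLE.seq h₆ h₄))).mono (by omega)

/-- Read the number of a symbol and put the symbol on the first auxiliary stack. -/
def readSymbol : List Γ' → Prog
  | [] => .skip
  | s :: l => .case .main fun o => if o = some (.bit true) then .case .main fun _ => readSymbol l
    else .seq (.push .a s) (.push .c .blank)

/-- The number `n` of a symbol is serialised as `n` pairs `bit true`, `bit false` and a last `bit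
false`, so each entry passed in the table consumes one pair. The token left on `.c` restarts the
surrounding loop. -/
theorem readSymbol_runs (s : Γ') (r a : List Γ') :
    RunsLE (readSymbol symbols) (stk ((enc s).ser ++ r) a [] []) (stk r (s :: a) [] [.blank])
      20 := by
  have key : ∀ (n : ℕ) (l : List Γ') (h : n < l.length),
      RunsLE (readSymbol l) (stk ((enc n).ser ++ r) a [] []) (stk r (l[n] :: a) [] [.blank])
        (2 * n + 3) := by
    intro n
    induction n with
    | zero =>
      intro l h
      cases l with
      | nil => simp at h
      | cons s l =>
        exact RunsLE.case_main (g := fun o => if o = some (.bit true) then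
          .case .main fun _ => readSymbol l else .seq (.push .a s) (.push .c .blank))
          (x := .bit false) (RunsLE.push_a.seq RunsLE.push_c)
    | succ n ih =>
      intro l h
      cases l with
      | nil => simp at h
      | cons s l =>
        have h' : n < l.length := by simpa using h
        exact RunsLE.case_main (g := fun o => if o = some (.bit true) then
          .case .main fun _ => readSymbol l else .seq (.push .a s) (.push .c .blank))
          (x := .bit true) (RunsLE.case_main (x := .bit false) (g := fun _ => readSymbol l)
            (ih l h'))
  have hs : symbolIndex s < symbols.length := by
    rcases s with _ | (_ | _) | _ | _ | _ <;> decide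
  have e : symbols[symbolIndex s] = s := by
    rcases s with _ | (_ | _) | _ | _ | _ <;> rfl
  have := key (symbolIndex s) symbols hs
  rw [e] at this
  have hs' : symbolIndex s < 6 := hs
  exact this.mono (by omega)

/-- Convert the tree that represents a string to the string. -/
def writeOutput : Prog :=
  .seq (.push .c .blank) (.seq (.loop .c fun _ => .case .main fun o =>
    if o = some (.bit true) then readSymbol symbols else .skip)
    (.loop .a fun x => .push .main x))

theorem writeOutput_runs (s : List Γ') :
    RunsLE writeOutput (stk (enc s).ser [] [] []) (stk s [] [] []) (100 * s.length + 100) := by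
  have h : ∀ (s a : List Γ'), RunsLE (.loop .c fun _ => .case .main fun o =>
      if o = some (.bit true) then readSymbol symbols else .skip)
      (stk (enc s).ser a [] [.blank]) (stk [] (s.reverse ++ a) [] []) (40 * s.length + 10) := by
    intro s
    induction s with
    | nil =>
      intro a
      exact (RunsLE.loop_c (f := fun _ => .case .main fun o =>
        if o = some (.bit true) then readSymbol symbols else .skip)
        (RunsLE.case_main (x := .bit false) (RunsLE.skip _)) (RunsLE.loop_nil rfl)).mono (by omega)
    | cons x s ih =>
      intro a
      have h₁ := readSymbol_runs x (enc s).ser a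
      refine (RunsLE.loop_c (f := fun _ => .case .main fun o =>
        if o = some (.bit true) then readSymbol symbols else .skip)
        (RunsLE.case_main (x := .bit true) h₁) (t := 40 * s.length + 10) ?_).mono ?_
      · have := ih (x :: a)
        rw [List.reverse_cons, List.append_assoc]
        exact this
      · rw [List.length_cons]
        omega
  have h₁ := h s []
  rw [List.append_nil] at h₁
  have h₂ := flush_a s.reverse [] [] []
  rw [List.reverse_reverse, List.append_nil, List.length_reverse] at h₂
  exact (RunsLE.push_c.seq (h₁.seq h₂)).mono (by omega)

/-- A polynomial-time machine may be followed by a polynomial-time function on strings. -/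
theorem comp_ptf {σ ι ι' σΓ : Type} {ea : σ → List σΓ} {eb : ι → List Γ'} {ec : ι' → List Γ'}
    {f : σ → ι} (h : TM2ComputableInPolyTime ea eb f) {F : List Γ' → List Γ'} (hF : PTF F)
    (g : σ → ι') (hg : ∀ x, ec (g x) = F (eb (f x))) :
    Nonempty (TM2ComputableInPolyTime ea ec g) := by
  obtain ⟨d, hd⟩ := hF.sb
  obtain ⟨p, T, ⟨e, he⟩, hp⟩ := hF
  have hB : PB fun n => (100 * n + 100) + ((n * 12 + 1 + 2) ^ e +
      (100 * (n * 12 + 1 + 2) ^ d + 100)) := by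
    have h₀ : PB fun n => n * 12 + 1 + 2 :=
      ((PB.id.mul (PB.const 12)).add (PB.const 1)).add (PB.const 2)
    exact (((PB.const 100).mul PB.id).add (PB.const 100)).add
      ((h₀.pow e).add (((PB.const 100).mul (h₀.pow d)).add (PB.const 100)))
  obtain ⟨c, hc⟩ := hB
  refine comp_prog h g (.seq readInput (.seq p writeOutput)) c fun x => ?_
  set s := eb (f x) with hs
  have h₁ := hp s []
  rw [List.append_nil, List.append_nil] at h₁
  have h₂ := (readInput_runs s).seq (h₁.seq (writeOutput_runs (F s)))
  rw [hg x]
  refine h₂.mono (le_trans ?_ (hc s.length))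
  have h₃ : size s ≤ s.length * 12 + 1 := size_string_le s
  have h₄ : T (size s) ≤ (s.length * 12 + 1 + 2) ^ e :=
    (he _).trans (Nat.pow_le_pow_left (by omega) e)
  have h₅ : (F s).length ≤ (s.length * 12 + 1 + 2) ^ d :=
    (length_lt_size _).le.trans ((hd s).trans (Nat.pow_le_pow_left (by omega) d))
  dsimp only
  omega

end PolyTime

/-! ### The reduction as a polynomial-time function on strings. -/

namespace PolyTime

open Turing
open Computability (Γ')
open Enc (enc)

variable {α β γ δ : Type} [Enc α] [Enc β] [Enc γ] [Enc δ]

/-! ### Binary words and the greedy code -/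

/-- All binary words of a given length. -/
def words : ℕ → List (List Bool)
  | 0 => [[]]
  | n + 1 => (words n).map (fun w => true :: w) ++ (words n).map (fun w => false :: w)

theorem mem_words {n : ℕ} {w : List Bool} : w ∈ words n ↔ w.length = n := by
  induction n generalizing w with
  | zero => simp [words]
  | succ n ih =>
    cases w with
    | nil => simp [words]
    | cons b w => cases b <;> simp [words, ih]

theorem length_words (n : ℕ) : (words n).length = 2 ^ n := by
  induction n with
  | zero => rfl
  | succ n ih => simp [words, ih, pow_succ]; omega

/-- The number of places where two words differ. -/
def differ (u v : List Bool) : ℕ := (List.zipWith (fun a b => xor a b) u v).count true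

/-- Two words are nearly orthogonal as `±1` vectors, up to `1 / K` of their length. -/
def nearOrth (K : ℕ) (u v : List Bool) : Bool :=
  decide (K * u.length ≤ u.length + 2 * K * differ u v) &&
    decide (2 * K * differ u v ≤ K * u.length + u.length)

/-- Greedy choice of pairwise nearly orthogonal words. -/
def greedy (K : ℕ) (ws : List (List Bool)) : List (List Bool) :=
  ws.foldl (fun acc u => bif acc.all (fun v => nearOrth K u v) then u :: acc else acc) []

theorem size_word_le (w : List Bool) : size w ≤ w.length * 4 + 1 :=
  size_le_of_forall_le fun b _ => size_bool_le b

namespace PTF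

/-- The list is exponential in `D`; the hypothesis `hb` says that this is still polynomial in the
input, as it is for dimensions logarithmic in the input size. -/
theorem words {D : α → ℕ} (hD : PTF D) {B : ℕ → ℕ} (hB : PB B)
    (hb : ∀ x, 2 ^ D x ≤ B (size x)) : PTF fun x => words (D x) := by
  have key : ∀ i, (fun ws : List (List Bool) => ws.map (fun w => true :: w) ++
      ws.map (fun w => false :: w))^[i] [[]] = PolyTime.words i := by
    intro i
    induction i with
    | zero => rfl
    | succ i ih => rw [Function.iterate_succ_apply', ih]; rfl
  refine (iterateNat (append (map id (cons (const true) snd)) (map id (cons (const false) snd)))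
    (const [[]]) hD (B := fun n => B n * (B n * 4 + 1 + 1) + 1)
    ((hB.mul (((hB.mul (PB.const 4)).add (PB.const 1)).add (PB.const 1))).add (PB.const 1))
    fun x i hi => ?_).congr fun x => key (D x)
  have h₁ : 2 ^ i ≤ B (size x) := (Nat.pow_le_pow_right (by omega) hi).trans (hb x)
  have h₂ : i < 2 ^ i := Nat.lt_two_pow_self
  refine (congrArg size (key i)).le.trans ((size_le_of_forall_le (B := B (size x) * 4 + 1)
    fun w hw => ?_).trans ?_)
  · rw [mem_words] at hw
    have := size_word_le w
    omega
  · rw [length_words]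
    exact Nat.add_le_add_right (Nat.mul_le_mul_right _ h₁) 1

theorem count {l : α → List Bool} (hl : PTF l) : PTF fun x => (l x).count true := by
  refine (length (flatMap hl (g := fun q => bif q.2 then [false] else [])
    (cond snd (const [false]) (const [])))).congr fun x => ?_
  dsimp only
  induction l x with
  | nil => rfl
  | cons b l ih => cases b <;> simp [ih]

theorem differ {u v : α → List Bool} (hu : PTF u) (hv : PTF v) :
    PTF fun x => differ (u x) (v x) :=
  count (zipWith hu hv (g := fun q => xor q.2.1 q.2.2)
    ((cond (fst.comp snd) (not (snd.comp snd)) (snd.comp snd)).congr fun q => by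
      obtain ⟨_, b, c⟩ := q
      cases b <;> cases c <;> rfl))

theorem nearOrth (K : ℕ) {u v : α → List Bool} (hu : PTF u) (hv : PTF v) :
    PTF fun x => nearOrth K (u x) (v x) :=
  and (le (mul (const K) (length hu)) (add (length hu) (mul (const (2 * K)) (differ hu hv))))
    (le (mul (const (2 * K)) (differ hu hv)) (add (mul (const K) (length hu)) (length hu)))

theorem greedy (K : ℕ) {ws : α → List (List Bool)} (hw : PTF ws) : PTF fun x => greedy K (ws x) := by
  obtain ⟨d, hd⟩ := hw.sb
  have hs : PTF fun q : α × List (List Bool) × List Bool =>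
      bif q.2.1.all (fun v => PolyTime.nearOrth K q.2.2 v) then q.2.2 :: q.2.1 else q.2.1 :=
    cond (all (fst.comp snd)
      (g := fun r : (α × List (List Bool) × List Bool) × List Bool =>
        PolyTime.nearOrth K r.1.2.2 r.2)
      (nearOrth K (snd.comp (snd.comp fst)) snd))
      (cons (snd.comp snd) (fst.comp snd)) (fst.comp snd)
  refine foldl_of_growth hw (const []) hs (G := fun n => (n + 2) ^ d + 1)
    ((PB.pow_self d).add (PB.const 1)) fun x acc b hb => ?_
  have := (size_mem hb).le.trans (hd x)
  dsimp only
  cases acc.all fun v => PolyTime.nearOrth K b v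
  · rw [cond_false]; omega
  · rw [cond_true, size_cons]; omega

end PTF

/-! ### The dimension -/

/-- One step of the search for the dimension. -/
def dimStep (q : ℕ × ℕ × ℕ × ℕ) : ℕ × ℕ × ℕ × ℕ :=
  bif decide (q.1 ≤ q.2.2.2) then q
  else (q.1, q.2.1 + 1, 4 * q.2.2.1, q.2.2.2 * q.2.2.2 * (q.2.2.2 * q.2.2.2))

/-- A step raises the last entry `2 ^ 4 ^ s` to its fourth power, and the search stops at the first
`s` with `M ≤ 2 ^ 4 ^ s`. The last conjunct records minimality, on which both the polynomial bound
on `2 ^ D` and the logarithmic bound on `D` rest. -/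
theorem dimStep_iterate (M e i : ℕ) :
    ∃ s, dimStep^[i] (M, e, 4 ^ e, 2) = (M, e + s, 4 ^ (e + s), 2 ^ 4 ^ s) ∧
      (s = i ∨ M ≤ 2 ^ 4 ^ s) ∧ (s = 0 ∨ 2 ^ 4 ^ (s - 1) < M) := by
  induction i with
  | zero => exact ⟨0, rfl, Or.inl rfl, Or.inl rfl⟩
  | succ i ih =>
    obtain ⟨s, h, h₁, h₂⟩ := ih
    rw [Function.iterate_succ_apply', h]
    by_cases hM : M ≤ 2 ^ 4 ^ s
    · exact ⟨s, by simp [dimStep, hM], Or.inr hM, h₂⟩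
    · refine ⟨s + 1, ?_, Or.inl (by rw [h₁.resolve_right hM]), Or.inr (by simpa using hM)⟩
      simp only [dimStep, hM, decide_false, cond_false, Prod.mk.injEq, true_and]
      refine ⟨by omega, by rw [← add_assoc, pow_succ]; ring, ?_⟩
      rw [← pow_add, ← pow_add, pow_succ 4 s]
      congr 1
      ring

/-- The exponent `s` of the dimension `4 ^ s` that is used for `M` words. -/
def dimExp (e M : ℕ) : ℕ := (dimStep^[M] (M, e, 4 ^ e, 2)).2.1

theorem dimExp_spec (e M : ℕ) : ∃ s, dimExp e M = e + s ∧ M ≤ 2 ^ 4 ^ s ∧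
    (s = 0 ∨ 2 ^ 4 ^ (s - 1) < M) := by
  obtain ⟨s, h, h₁, h₂⟩ := dimStep_iterate M e M
  refine ⟨s, by rw [dimExp, h], ?_, h₂⟩
  rcases h₁ with rfl | h₁
  · exact (Nat.lt_pow_self (by omega : 1 < 4)).le.trans (Nat.lt_two_pow_self).le
  · exact h₁

theorem pow_dimExp_le (e M : ℕ) : 4 ^ dimExp e M ≤ 4 ^ e * (4 * M + 1) := by
  obtain ⟨s, h, -, h₂⟩ := dimExp_spec e M
  rw [h, pow_add]
  refine Nat.mul_le_mul_left _ ?_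
  rcases h₂ with rfl | h₂
  · simp
  · cases s with
    | zero => simp
    | succ s =>
      rw [Nat.add_sub_cancel] at h₂
      have : 4 ^ s < M := (Nat.lt_two_pow_self).trans h₂
      rw [pow_succ]
      omega

/-- By minimality `2 ^ 4 ^ (s - 1) < M` for positive `s`, and `2 ^ D` is the power of the left side
with the constant exponent `4 * 4 ^ e`. So exhaustive search over all words is affordable. -/
theorem two_pow_pow_dimExp_le (e M : ℕ) : 2 ^ 4 ^ dimExp e M ≤ (M + 2) ^ (4 * 4 ^ e) := by
  obtain ⟨s, h, -, h₂⟩ := dimExp_spec e M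
  rw [h, pow_add]
  rcases h₂ with rfl | h₂
  · rw [pow_zero, mul_one]
    exact (Nat.pow_le_pow_left (by omega) _).trans (Nat.pow_le_pow_right (by omega) (by omega))
  · cases s with
    | zero =>
      rw [pow_zero, mul_one]
      exact (Nat.pow_le_pow_left (by omega) _).trans (Nat.pow_le_pow_right (by omega) (by omega))
    | succ s =>
      rw [Nat.add_sub_cancel] at h₂
      rw [show 4 ^ e * 4 ^ (s + 1) = 4 ^ s * (4 * 4 ^ e) by ring, pow_mul]
      exact Nat.pow_le_pow_left (by omega) _

theorem PTF.dimExp (e : ℕ) {M : α → ℕ} (hM : PTF M) : PTF fun x => dimExp e (M x) := by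
  obtain ⟨d, hd⟩ := hM.sb
  have hs : PTF dimStep :=
    cond (le fst (snd.comp (snd.comp snd))) id (pair fst (pair (succ (fst.comp snd))
      (pair (mul (const 4) (fst.comp (snd.comp snd)))
        (mul (mul (snd.comp (snd.comp snd)) (snd.comp (snd.comp snd)))
          (mul (snd.comp (snd.comp snd)) (snd.comp (snd.comp snd)))))))
  have hP : PB fun n => (n + 2) ^ d + (e + 4 ^ e * 4 ^ e * ((n + 2) ^ d * 4 + 5) +
      4 ^ e * ((n + 2) ^ d * 4 + 5) + ((n + 2) ^ d + 2) ^ 4) := by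
    have h := ((PB.pow_self d).mul (PB.const 4)).add (PB.const 5)
    exact (PB.pow_self d).add ((((PB.const e).add ((PB.const _).mul h)).add
      ((PB.const _).mul h)).add (((PB.pow_self d).add (PB.const 2)).pow 4))
  refine (fst.comp snd).comp (iterateNat hs
    (pair hM (pair (const e) (pair (const (4 ^ e)) (const 2)))) hM
    (B := fun n => 2 * ((n + 2) ^ d + (e + 4 ^ e * 4 ^ e * ((n + 2) ^ d * 4 + 5) +
      4 ^ e * ((n + 2) ^ d * 4 + 5) + ((n + 2) ^ d + 2) ^ 4)) + 7)
    (((PB.const 2).mul hP).add (PB.const 7)) fun x i hi => ?_)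
  obtain ⟨s, h, h₁, h₂⟩ := dimStep_iterate (M x) e i
  have hMx := hd x
  rw [h, size_prod, size_prod, size_prod, size_nat, size_nat, size_nat, size_nat]
  rw [size_nat] at hMx
  set m := M x
  set p := (size x + 2) ^ d
  have hs4 : 4 ^ s ≤ p * 4 + 5 := by
    rcases h₂ with rfl | h₂
    · simp
    · cases s with
      | zero => simp
      | succ s =>
        rw [Nat.add_sub_cancel] at h₂
        have : 4 ^ s < m := (Nat.lt_two_pow_self).trans h₂
        rw [pow_succ]
        omega
  have hs1 : s < 4 ^ s := Nat.lt_pow_self (by omega)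
  have hW : 2 ^ 4 ^ s ≤ (p + 2) ^ 4 := by
    rcases h₂ with rfl | h₂
    · rw [pow_zero, pow_one]
      exact le_trans (by omega : 2 ≤ 2 ^ 4) (Nat.pow_le_pow_left (by omega) 4)
    · cases s with
      | zero => exact le_trans (by norm_num : 2 ^ 4 ^ 0 ≤ 2 ^ 4) (Nat.pow_le_pow_left (by omega) 4)
      | succ s =>
        rw [Nat.add_sub_cancel] at h₂
        rw [pow_succ 4 s, pow_mul]
        exact Nat.pow_le_pow_left (by omega) 4
  have hD : 4 ^ (e + s) ≤ 4 ^ e * (p * 4 + 5) := by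
    rw [pow_add]
    exact Nat.mul_le_mul_left _ hs4
  have hs2 : s ≤ 4 ^ e * 4 ^ e * (p * 4 + 5) := by
    refine (hs1.le.trans hs4).trans (Nat.le_mul_of_pos_left _ (by positivity))
  dsimp only
  omega

/-! ### Parsing -/

/-- Parser state: the current number, the current set, and the sets read so far. -/
abbrev ParserState := List Γ' × List (List Γ') × List (List (List Γ'))

/-- Reading a symbol. -/
def token (q : ParserState) (s : Γ') : ParserState :=
  match s with
  | .blank => q
  | .bit b => (.bit b :: q.1, q.2)
  | .bra => ([], [], q.2.2)
  | .ket => ([], [], q.2.1 :: q.2.2)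
  | .comma => ([], q.1 :: q.2.1, q.2.2)

/-- The sets that are listed in a string. -/
def parseSets (s : List Γ') : List (List (List Γ')) := (s.foldl token ([], [], [])).2.2.tail

/-- Whether a symbol is not a comma. -/
def notComma (s : Γ') : Bool := decide (s ≠ .comma)

/-- The part of a string after its first comma. -/
def afterComma (s : List Γ') : List Γ' := (s.dropWhile notComma).tail

namespace PTF

theorem notComma : PTF notComma := symbol _

theorem afterComma {s : α → List Γ'} (hs : PTF s) : PTF fun x => afterComma (s x) :=
  tail (dropWhile hs notComma)

theorem parseSets {s : α → List Γ'} (hs : PTF s) : PTF fun x => parseSets (s x) := by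
  have hsym : ∀ a : Γ', PTF fun q : α × ParserState × Γ' => decide (q.2.2 = a) := fun a =>
    symbolEq (snd.comp snd) (const a)
  have hq : PTF fun q : α × ParserState × Γ' => q.2.1 := fst.comp snd
  have ht : PTF fun q : α × ParserState × Γ' => token q.2.1 q.2.2 := by
    refine (cond (hsym .blank) hq (cond (hsym .bra) (pair (const []) (pair (const [])
      (snd.comp (snd.comp hq)))) (cond (hsym .ket) (pair (const []) (pair (const [])
      (cons (fst.comp (snd.comp hq)) (snd.comp (snd.comp hq))))) (cond (hsym .comma)
      (pair (const []) (pair (cons (fst.comp hq) (fst.comp (snd.comp hq)))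
        (snd.comp (snd.comp hq))))
      (pair (cons (snd.comp snd) (fst.comp hq)) (snd.comp hq)))))).congr fun q => ?_
    obtain ⟨x, q, s⟩ := q
    cases s <;> rfl
  refine tail (snd.comp (snd.comp (foldl_of_growth hs (const ([], [], [])) ht (G := fun _ => 20)
    (PB.const 20) fun x acc s _ => ?_)))
  obtain ⟨a, b, c⟩ := acc
  have h₁ := size_pos a
  have h₂ := size_pos b
  cases s with
  | blank => exact Nat.le_add_right _ _
  | bit t =>
    have := size_symbol_le (.bit t)
    simp only [token, size_prod, size_cons]
    omega
  | bra => simp only [token, size_prod, size_nil]; omega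
  | ket => simp only [token, size_prod, size_cons, size_nil]; omega
  | comma => simp only [token, size_prod, size_cons, size_nil]; omega

end PTF

/-! ### The points -/

/-- The last word that is stored under a key. -/
def lookup (dict : List (List Γ' × List Bool)) (key : List Γ') : List Bool :=
  dict.foldl (fun acc p => bif decide (p.1 = key) then p.2 else acc) []

/-- The numbers of words, among those of the keys in `T`, that have `true` in each place. -/
def counts (dict : List (List Γ' × List Bool)) (D : ℕ) (T : List (List Γ')) : List ℕ :=
  T.foldl (fun acc key => List.zipWith (fun n b => bif b then n + 1 else n) acc (lookup dict key))
    (List.replicate D 0)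

/-- The string for a coordinate, composed from a table. -/
def coordString (A : ℕ → List Γ' × Bool × List Γ') (s c : ℕ) : List Γ' :=
  (A c).1 ++ (List.replicate (bif (A c).2.1 then s else 0) (.bit false) ++ (A c).2.2)

/-- The string for a point. -/
def pointString (A : ℕ → List Γ' × Bool × List Γ') (s : ℕ) (l : List ℕ) : List Γ' :=
  .bra :: ((l.flatMap fun c => coordString A s c ++ [.comma]) ++ [.ket])

namespace PTF

theorem lookup {dict : α → List (List Γ' × List Bool)} {key : α → List Γ'} (hd : PTF dict)
    (hk : PTF key) : PTF fun x => lookup (dict x) (key x) := by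
  obtain ⟨d, hd'⟩ := hd.sb
  have hs : PTF fun q : α × List Bool × (List Γ' × List Bool) =>
      bif decide (q.2.2.1 = key q.1) then q.2.2.2 else q.2.1 :=
    cond (stringEq (fst.comp (snd.comp snd)) (hk.comp fst)) (snd.comp (snd.comp snd))
      (fst.comp snd)
  refine foldl_of_growth hd (const []) hs (G := fun n => (n + 2) ^ d) (PB.pow_self d)
    fun x acc b hb => ?_
  have h₁ := (size_mem hb).le.trans (hd' x)
  rw [size_prod] at h₁
  dsimp only
  cases decide (b.1 = key x)
  · rw [cond_false]; omega
  · rw [cond_true]; omega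

theorem counts {dict : α → List (List Γ' × List Bool)} {D : α → ℕ} {T : α → List (List Γ')}
    (hd : PTF dict) (hD : PTF D) (hT : PTF T) : PTF fun x => counts (dict x) (D x) (T x) := by
  have hl : PTF fun q : α × List Γ' => PolyTime.lookup (dict q.1) q.2 :=
    lookup (hd.comp fst) snd
  obtain ⟨d, hd'⟩ := hl.sb
  obtain ⟨t, ht⟩ := hT.sb
  have hs : PTF fun q : α × List ℕ × List Γ' =>
      List.zipWith (fun n b => bif b then n + 1 else n) q.2.1 (PolyTime.lookup (dict q.1) q.2.2) :=
    zipWith (fst.comp snd) (hl.comp (pair fst (snd.comp snd)))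
      (g := fun r : (α × List ℕ × List Γ') × ℕ × Bool => bif r.2.2 then r.2.1 + 1 else r.2.1)
      (cond (snd.comp snd) (succ (fst.comp snd)) (fst.comp snd))
  refine foldl_of_growth hT (replicate hD (const 0)) hs
    (G := fun n => 2 * (n + (n + 2) ^ t + 1 + 2) ^ d)
    ((PB.const 2).mul ((((PB.id.add (PB.pow_self t)).add (PB.const 1)).add (PB.const 2)).pow d))
    fun x acc b hb => ?_
  have key : ∀ (l : List ℕ) (v : List Bool),
      size (List.zipWith (fun n b => bif b then n + 1 else n) l v) ≤ size l + 2 * v.length := by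
    intro l
    induction l with
    | nil => intro v; simp
    | cons n l ih =>
      intro v
      cases v with
      | nil => rw [List.zipWith_nil_right, size_nil]; have := size_pos (n :: l); omega
      | cons b v =>
        have := ih v
        rw [List.zipWith_cons_cons, size_cons, size_cons, List.length_cons]
        cases b <;> simp only [cond_false, cond_true, size_nat] <;> omega
  refine (key _ _).trans (Nat.add_le_add_left (Nat.mul_le_mul_left 2 ?_) _)
  refine ((length_lt_size _).le.trans (hd' (x, b))).trans (Nat.pow_le_pow_left ?_ d)
  have := (size_mem hb).le.trans (ht x)
  rw [size_prod]
  dsimp only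
  omega

/-- A table that is constant from `K` on is finite data. In the application a coordinate depends on
a count between `0` and `z`, with `z` constant. -/
theorem coordString (K : ℕ) (A : ℕ → List Γ' × Bool × List Γ') (hA : ∀ n, K ≤ n → A n = A K)
    {s c : α → ℕ} (hs : PTF s) (hc : PTF c) : PTF fun x => coordString A (s x) (c x) := by
  have hA' : PTF A := (table K A (A K)).congr fun n => by
    by_cases h : n < K
    · rw [if_pos h]
    · rw [if_neg h, hA n (by omega)]
  have h := hA'.comp hc
  exact append (fst.comp h) (append (replicate (cond (fst.comp (snd.comp h)) hs (const 0))
    (const _)) (snd.comp (snd.comp h)))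

theorem pointString (K : ℕ) (A : ℕ → List Γ' × Bool × List Γ') (hA : ∀ n, K ≤ n → A n = A K)
    {s : α → ℕ} {l : α → List ℕ} (hs : PTF s) (hl : PTF l) :
    PTF fun x => pointString A (s x) (l x) :=
  cons (const _) (append (flatMap hl
    (g := fun q => PolyTime.coordString A (s q.1) q.2 ++ [.comma])
    (append (coordString K A hA (hs.comp fst) snd) (const _))) (const _))

end PTF

/-! ### The reduction on strings -/

section Reduction

variable (e K : ℕ) (A : ℕ → List Γ' × Bool × List Γ')

/-- The words assigned to the (occurrences of) elements. -/
def dictOf (sets : List (List (List Γ'))) : List (List Γ' × List Bool) :=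
  List.zipWith (fun a b => (a, b)) sets.flatten
    (greedy K (words (4 ^ dimExp e sets.flatten.length)))

/-- The string for the point set. -/
def pointsString (sets : List (List (List Γ'))) : List Γ' :=
  .bra :: ((sets.flatMap fun T => pointString A (dimExp e sets.flatten.length)
    (counts (dictOf e K sets) (4 ^ dimExp e sets.flatten.length) T) ++ [.comma]) ++ [.ket])

/-- The string for the median instance. -/
def medianString (x : List Γ') : List Γ' :=
  List.replicate (2 * dimExp e (parseSets (afterComma (afterComma x))).flatten.length)
      (.bit false) ++
    (.bit true :: .comma :: ((afterComma x).takeWhile notComma ++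
      .comma :: pointsString e K A (parseSets (afterComma (afterComma x)))))

/-- The reduction on strings, with fixed answers for finitely many parameters. -/
def reduction (small bad : List (List Γ')) (yes no : List Γ') (x : List Γ') : List Γ' :=
  bif decide (x ∈ bad) then no
  else bif decide (x.takeWhile notComma ∈ small) then yes
  else medianString e K A x

variable {e K A}

/-- No binary arithmetic is involved: `k` is copied, names of elements serve only as keys, the
dimension `4 ^ s'` is `2 * s'` zero bits and a one, and coordinates come from a finite table with a
padding of zeros. Only quantities polynomial in the input are held in unary. -/
theorem PTF.medianString {K' : ℕ} (hA : ∀ n, K' ≤ n → A n = A K') : PTF (medianString e K A) := by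
  have hsets : PTF fun x => PolyTime.parseSets (PolyTime.afterComma (PolyTime.afterComma x)) :=
    parseSets (afterComma (afterComma id))
  have hM := length (flatten hsets)
  obtain ⟨d, hd⟩ := hM.sb
  have hs := dimExp e hM
  have hpow : ∀ {n : List Γ' → ℕ}, PTF n → (∃ B : ℕ → ℕ, PB B ∧ ∀ x, 4 ^ n x ≤ B (size x)) →
      PTF fun x => 4 ^ n x := by
    rintro n hn ⟨B, hB, hb⟩
    have key : ∀ i, (fun m : ℕ => 4 * m)^[i] 1 = 4 ^ i := by
      intro i
      induction i with
      | zero => rfl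
      | succ i ih => rw [Function.iterate_succ_apply', ih, pow_succ, mul_comm]
    refine (iterateNat (mul (const 4) id) (const 1) hn (B := fun n => 2 * B n + 1)
      (((PB.const 2).mul hB).add (PB.const 1)) fun x i hi => ?_).congr fun x => key _
    refine (congrArg size (key i)).le.trans ?_
    rw [size_nat]
    have := (Nat.pow_le_pow_right (by omega : 0 < 4) hi).trans (hb x)
    omega
  have hMd : ∀ x : List Γ', (PolyTime.parseSets (PolyTime.afterComma
      (PolyTime.afterComma x))).flatten.length ≤ (size x + 2) ^ d := fun x => by
    have := hd x
    rw [size_nat] at this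
    dsimp only at this
    omega
  have hD := hpow hs ⟨fun n => 4 ^ e * (4 * (n + 2) ^ d + 1),
    (PB.const _).mul (((PB.const 4).mul (PB.pow_self d)).add (PB.const 1)), fun x =>
      (pow_dimExp_le _ _).trans (Nat.mul_le_mul_left _ (by have := hMd x; omega))⟩
  have hw := words hD (B := fun n => ((n + 2) ^ d + 2) ^ (4 * 4 ^ e))
    (((PB.pow_self d).add (PB.const 2)).pow _) fun x =>
      (two_pow_pow_dimExp_le _ _).trans (Nat.pow_le_pow_left (by have := hMd x; omega) _)
  have hdict : PTF fun x => dictOf e K (PolyTime.parseSets (PolyTime.afterComma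
      (PolyTime.afterComma x))) := zipWith (flatten hsets) (greedy K hw) (g := fun q => q.2) snd
  have hpts : PTF fun x => pointsString e K A (PolyTime.parseSets (PolyTime.afterComma
      (PolyTime.afterComma x))) :=
    cons (const _) (append (flatMap hsets (g := fun q => PolyTime.pointString A
      (PolyTime.dimExp e (PolyTime.parseSets (PolyTime.afterComma
        (PolyTime.afterComma q.1))).flatten.length)
      (PolyTime.counts (dictOf e K (PolyTime.parseSets (PolyTime.afterComma
        (PolyTime.afterComma q.1)))) (4 ^ PolyTime.dimExp e (PolyTime.parseSets
          (PolyTime.afterComma (PolyTime.afterComma q.1))).flatten.length) q.2) ++ [.comma])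
      (append (pointString K' A hA (hs.comp fst) (counts (hdict.comp fst) (hD.comp fst) snd))
        (const _))) (const _))
  exact append (replicate (mul (const 2) hs) (const _)) (cons (const _) (cons (const _)
    (append (takeWhile (afterComma id) notComma) (cons (const _) hpts))))

theorem PTF.reduction {K' : ℕ} (hA : ∀ n, K' ≤ n → A n = A K') (small bad : List (List Γ'))
    (yes no : List Γ') : PTF (reduction e K A small bad yes no) :=
  cond (stringMem id bad) (const no) (cond (stringMem (takeWhile id notComma) small) (const yes)
    (medianString hA))

end Reduction

end PolyTime

/-! ### The Gilbert–Varshamov bound for the greedy code. -/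

namespace PolyTime

/-! ### Existence of large codes -/

theorem differ_cons (a b : Bool) (u v : List Bool) :
    differ (a :: u) (b :: v) = (if a = b then 0 else 1) + differ u v := by
  cases a <;> cases b <;> simp [differ, Nat.add_comm]

theorem differ_self (u : List Bool) : differ u u = 0 := by
  induction u with
  | nil => rfl
  | cons a u ih => simp [differ_cons, ih]

/-- This is the moment generating function of the inner product `D - 2 * differ u v` of sign
vectors; the coordinates of `u` are independent, each contributing a factor `exp t + exp (-t)`. -/
theorem sum_words_exp (t : ℝ) (v : List Bool) :
    ((words v.length).map fun u => Real.exp (t * (v.length - 2 * differ u v))).sum =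
      (2 * Real.cosh t) ^ v.length := by
  induction v with
  | nil => simp [words, differ]
  | cons b v ih =>
    have key : ∀ a : Bool, ((words v.length).map fun u =>
        Real.exp (t * ((b :: v).length - 2 * differ (a :: u) (b :: v)))).sum =
        Real.exp (if a = b then t else -t) * (2 * Real.cosh t) ^ v.length := by
      intro a
      rw [← ih, ← List.sum_map_mul_left]
      congr 1
      refine List.map_congr_left fun u _ => ?_
      rw [← Real.exp_add, differ_cons, List.length_cons]
      congr 1
      split_ifs <;> push_cast <;> ring
    rw [List.length_cons, words, List.map_append, List.sum_append, List.map_map, List.map_map]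
    have h₁ := key true
    have h₂ := key false
    rw [List.length_cons] at h₁ h₂
    simp only [Function.comp_def]
    rw [h₁, h₂, pow_succ, Real.cosh_eq]
    cases b <;> simp <;> ring

/-- Chernoff's bound with `t = 1 / K`. A word that is not nearly orthogonal to `v` has `|D - 2 *
differ u v| > D / K`, so one of the two exponentials is at least `exp (D / K ^ 2)`, while `cosh t ≤
exp (t ^ 2 / 2)` bounds their total by `2 * 2 ^ D * exp (D / (2 * K ^ 2))`. -/
theorem countP_not_nearOrth_le {K : ℕ} (hK : 0 < K) (v : List Bool) :
    ((words v.length).countP fun u => !nearOrth K u v) * Real.exp (v.length / (2 * K ^ 2 : ℝ)) ≤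
      2 * 2 ^ v.length := by
  set D := v.length with hD
  set t : ℝ := 1 / K with ht
  have hK' : (0 : ℝ) < K := by exact_mod_cast hK
  have h₁ : ∀ l : List (List Bool), (∀ u ∈ l, u.length = D) →
      (l.countP fun u => !nearOrth K u v) * Real.exp (D / (K : ℝ) ^ 2) ≤
        (l.map fun u => Real.exp (t * (D - 2 * differ u v)) +
          Real.exp (-t * (D - 2 * differ u v))).sum := by
    intro l
    induction l with
    | nil => intro _; simp
    | cons u l ih =>
      intro hl
      have hu := hl u (by simp)
      have ih' := ih fun w hw => hl w (by simp [hw])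
      rw [List.countP_cons, List.map_cons, List.sum_cons]
      by_cases hn : nearOrth K u v = true
      · simp only [hn, Bool.not_true, Bool.false_eq_true, if_false, add_zero]
        have := Real.exp_pos (t * (D - 2 * differ u v))
        have := Real.exp_pos (-t * (D - 2 * differ u v))
        linarith
      · have hX : (D : ℝ) / K < |(D : ℝ) - 2 * differ u v| := by
          rw [nearOrth, Bool.and_eq_true, decide_eq_true_eq, decide_eq_true_eq, not_and_or, not_le,
            not_le, hu] at hn
          rw [div_lt_iff₀ hK', ← abs_of_pos hK', ← abs_mul, lt_abs]
          rcases hn with hn | hn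
          · left
            have : (D : ℝ) + 2 * K * differ u v < K * D := by exact_mod_cast hn
            linarith
          · right
            have : (K : ℝ) * D + D < 2 * K * differ u v := by exact_mod_cast hn
            linarith
        have hexp : Real.exp (D / (K : ℝ) ^ 2) ≤ Real.exp (t * (D - 2 * differ u v)) +
            Real.exp (-t * (D - 2 * differ u v)) := by
          have e : (D : ℝ) / (K : ℝ) ^ 2 = t * (D / K) := by rw [ht]; field_simp
          have ht' : 0 < t := by positivity
          rw [e]
          rcases le_total 0 ((D : ℝ) - 2 * differ u v) with h | h
          · rw [abs_of_nonneg h] at hX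
            have := Real.exp_le_exp.mpr (mul_le_mul_of_nonneg_left hX.le ht'.le)
            have := Real.exp_pos (-t * (D - 2 * differ u v))
            linarith
          · rw [abs_of_nonpos h] at hX
            have := Real.exp_le_exp.mpr (mul_le_mul_of_nonneg_left hX.le ht'.le)
            rw [mul_neg, ← neg_mul] at this
            have := Real.exp_pos (t * (D - 2 * differ u v))
            linarith
        have hn' : nearOrth K u v = false := by simpa using hn
        simp only [hn', Bool.not_false, if_true, Nat.cast_add, Nat.cast_one, add_mul, one_mul]
        linarith
  have h₂ := h₁ (words D) fun u hu => mem_words.mp hu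
  rw [List.sum_map_add, sum_words_exp, sum_words_exp, Real.cosh_neg, mul_pow] at h₂
  have h₃ : Real.cosh t ^ D ≤ Real.exp (D / (2 * K ^ 2 : ℝ)) := by
    refine (pow_le_pow_left₀ (Real.cosh_pos t).le (Real.cosh_le_exp_half_sq t) D).trans ?_
    rw [← Real.exp_nat_mul]
    refine Real.exp_le_exp.mpr (le_of_eq ?_)
    rw [ht]
    field_simp
  have h₄ : Real.exp (D / (K : ℝ) ^ 2) =
      Real.exp (D / (2 * K ^ 2 : ℝ)) * Real.exp (D / (2 * K ^ 2 : ℝ)) := by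
    rw [← Real.exp_add]
    congr 1
    field_simp
    ring
  rw [h₄] at h₂
  have h₅ := Real.exp_pos (D / (2 * K ^ 2 : ℝ))
  have h₆ : (2 : ℝ) ^ D * Real.cosh t ^ D ≤ 2 ^ D * Real.exp (D / (2 * K ^ 2 : ℝ)) :=
    mul_le_mul_of_nonneg_left h₃ (by positivity)
  refine le_of_mul_le_mul_right ?_ h₅
  calc _ = _ := mul_assoc _ _ _
    _ ≤ _ := h₂
    _ ≤ 2 * 2 ^ D * Real.exp (D / (2 * K ^ 2 : ℝ)) := by linarith

theorem greedy_subset {K : ℕ} {ws : List (List Bool)} {u : List Bool} (h : u ∈ greedy K ws) :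
    u ∈ ws := by
  have key : ∀ (ws acc : List (List Bool)), u ∈ ws.foldl (fun acc u =>
      bif acc.all (fun v => nearOrth K u v) then u :: acc else acc) acc → u ∈ acc ∨ u ∈ ws := by
    intro ws
    induction ws with
    | nil => intro acc h; exact Or.inl h
    | cons w ws ih =>
      intro acc h
      rw [List.foldl_cons] at h
      rcases ih _ h with h | h
      · cases hb : acc.all (fun v => nearOrth K w v)
        · rw [hb] at h; exact Or.inl h
        · rw [hb] at h
          rcases List.mem_cons.mp h with rfl | h
          · exact Or.inr (by simp)
          · exact Or.inl h
      · exact Or.inr (by simp [h])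
  simpa using key ws [] h

theorem greedy_pairwise (K : ℕ) (ws : List (List Bool)) :
    (greedy K ws).Pairwise fun u v => nearOrth K u v = true := by
  have key : ∀ (ws acc : List (List Bool)), acc.Pairwise (fun u v => nearOrth K u v = true) →
      (ws.foldl (fun acc u => bif acc.all (fun v => nearOrth K u v) then u :: acc else acc)
        acc).Pairwise fun u v => nearOrth K u v = true := by
    intro ws
    induction ws with
    | nil => intro acc h; exact h
    | cons w ws ih =>
      intro acc h
      rw [List.foldl_cons]
      refine ih _ ?_
      cases hb : acc.all (fun v => nearOrth K w v)
      · exact h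
      · rw [List.all_eq_true] at hb
        exact List.pairwise_cons.mpr ⟨hb, h⟩
  exact key ws [] List.Pairwise.nil

theorem nearOrth_self {K : ℕ} (hK : 2 ≤ K) {u : List Bool} (hu : u ≠ []) :
    nearOrth K u u = false := by
  have h₁ := List.length_pos_of_ne_nil hu
  have h₂ : u.length < K * u.length := by nlinarith
  simp [nearOrth, differ_self, h₂]

/-- A rejected word conflicts with a word already chosen; an accepted one conflicts with itself, as
it is not orthogonal to itself. -/
theorem greedy_maximal {K : ℕ} (hK : 2 ≤ K) {ws : List (List Bool)} {u : List Bool} (hu : u ∈ ws)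
    (hu' : u ≠ []) : ∃ v ∈ greedy K ws, nearOrth K u v = false := by
  have mono : ∀ (ws acc : List (List Bool)) (v : List Bool), v ∈ acc →
      v ∈ ws.foldl (fun acc u => bif acc.all (fun v => nearOrth K u v) then u :: acc else acc)
        acc := by
    intro ws
    induction ws with
    | nil => intro acc v h; exact h
    | cons w ws ih =>
      intro acc v h
      rw [List.foldl_cons]
      refine ih _ v ?_
      cases acc.all (fun v => nearOrth K w v)
      · exact h
      · exact List.mem_cons_of_mem _ h
  have key : ∀ (ws acc : List (List Bool)), u ∈ ws → ∃ v ∈ ws.foldl (fun acc u =>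
      bif acc.all (fun v => nearOrth K u v) then u :: acc else acc) acc,
        nearOrth K u v = false := by
    intro ws
    induction ws with
    | nil => intro acc h; simp at h
    | cons w ws ih =>
      intro acc h
      rw [List.foldl_cons]
      rcases List.mem_cons.mp h with rfl | h
      · cases hb : acc.all (fun v => nearOrth K u v)
        · rw [List.all_eq_false] at hb
          obtain ⟨v, hv, hv'⟩ := hb
          exact ⟨v, mono ws _ v hv, by simpa using hv'⟩
        · exact ⟨u, mono ws _ u (by simp), nearOrth_self hK hu'⟩
      · exact ih _ h
  exact key ws [] hu

/-- Every word conflicts with some chosen word, and each chosen word has at most `2 * 2 ^ D / exp (D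
/ (2 * K ^ 2))` conflicts, so that many sets must cover all `2 ^ D` words. -/
theorem le_length_greedy {K D : ℕ} (hK : 2 ≤ K) (hD : 0 < D) :
    Real.exp (D / (2 * K ^ 2 : ℝ)) ≤ 2 * (greedy K (words D)).length := by
  have h₁ : ∀ (ws code : List (List Bool)), (∀ u ∈ ws, ∃ v ∈ code, nearOrth K u v = false) →
      ws.length ≤ (code.map fun v => ws.countP fun u => !nearOrth K u v).sum := by
    intro ws code
    induction ws with
    | nil => intro _; simp
    | cons u ws ih =>
      intro h
      have ih' := ih fun w hw => h w (by simp [hw])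
      obtain ⟨v, hv, huv⟩ := h u (by simp)
      have hs : (code.map fun v => (u :: ws).countP fun u => !nearOrth K u v).sum =
          (code.map fun v => ws.countP fun u => !nearOrth K u v).sum +
            (code.map fun v => if nearOrth K u v = false then 1 else 0).sum := by
        rw [← List.sum_map_add]
        congr 1
        refine List.map_congr_left fun v _ => ?_
        rw [List.countP_cons]
        simp
      have h1 : 1 ≤ (code.map fun v => if nearOrth K u v = false then 1 else 0).sum := by
        refine List.single_le_sum (by simp) 1 ?_ 
        exact List.mem_map.mpr ⟨v, hv, by simp [huv]⟩
      rw [List.length_cons, hs]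
      omega
  have h₂ := h₁ (words D) (greedy K (words D)) fun u hu => greedy_maximal hK hu fun h => by
    rw [mem_words, h] at hu
    simp at hu
    omega
  rw [length_words] at h₂
  have h₃ : ∀ code : List (List Bool), (∀ v ∈ code, v.length = D) →
      ((code.map fun v => (words D).countP fun u => !nearOrth K u v).sum : ℝ) *
        Real.exp (D / (2 * K ^ 2 : ℝ)) ≤ code.length * (2 * 2 ^ D) := by
    intro code
    induction code with
    | nil => intro _; simp
    | cons v code ih =>
      intro h
      have ih' := ih fun w hw => h w (by simp [hw])
      have hv := countP_not_nearOrth_le (K := K) (by omega) v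
      rw [h v (by simp)] at hv
      rw [List.map_cons, List.sum_cons, List.length_cons]
      push_cast at ih' ⊢
      rw [add_mul, add_mul, one_mul]
      linarith
  have h₄ := h₃ (greedy K (words D)) fun v hv => mem_words.mp (greedy_subset hv)
  have h₅ : ((2 : ℝ) ^ D) ≤
      (((greedy K (words D)).map fun v => (words D).countP fun u => !nearOrth K u v).sum : ℕ) := by
    exact_mod_cast h₂
  have h₆ := Real.exp_pos (D / (2 * K ^ 2 : ℝ))
  have h₇ : (0 : ℝ) < 2 ^ D := by positivity
  have h₈ := (mul_le_mul_of_nonneg_right h₅ h₆.le).trans h₄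
  refine le_of_mul_le_mul_left ?_ h₇
  linarith

/-- The base dimension absorbs the constant of the counting bound: `4 * K ^ 2 ≤ 4 ^ e` gives `D / (2
* K ^ 2) ≥ 2 * 4 ^ s`, and `exp (2 * 4 ^ s) ≥ 2 ^ (2 * 4 ^ s) ≥ 2 * 2 ^ 4 ^ s ≥ 2 * M`. -/
theorem dimExp_length_greedy {K e : ℕ} (hK : 2 ≤ K) (he : 4 * K ^ 2 ≤ 4 ^ e) (M : ℕ) :
    M ≤ (greedy K (words (4 ^ dimExp e M))).length := by
  obtain ⟨s, hs, hM, -⟩ := dimExp_spec e M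
  have h₁ := le_length_greedy (D := 4 ^ dimExp e M) hK (by positivity)
  have hK' : (0 : ℝ) < K := by exact_mod_cast (by omega : 0 < K)
  have h₂ : (2 * 4 ^ s : ℝ) ≤ ((4 ^ dimExp e M : ℕ) : ℝ) / (2 * K ^ 2 : ℝ) := by
    rw [le_div_iff₀ (by positivity), hs, pow_add]
    have : (4 * K ^ 2 : ℝ) ≤ 4 ^ e := by exact_mod_cast he
    push_cast
    nlinarith [pow_pos (by norm_num : (0 : ℝ) < 4) s]
  have h₃ : ((2 : ℝ) ^ (2 * 4 ^ s)) ≤ Real.exp (2 * 4 ^ s) := by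
    have : Real.exp (2 * 4 ^ s) = Real.exp 1 ^ (2 * 4 ^ s) := by
      rw [← Real.exp_nat_mul]
      push_cast
      rw [mul_one]
    rw [this]
    exact pow_le_pow_left₀ (by norm_num) (by linarith [Real.add_one_le_exp (1 : ℝ)]) _
  have h₄ := (h₃.trans (Real.exp_le_exp.mpr h₂)).trans h₁
  have h₅ : 2 ^ (2 * 4 ^ s) ≤ 2 * (greedy K (words (4 ^ dimExp e M))).length := by
    exact_mod_cast h₄
  have h₆ : 2 * 2 ^ 4 ^ s ≤ 2 ^ (2 * 4 ^ s) := by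
    rw [← pow_succ']
    have : 0 < 4 ^ s := by positivity
    exact Nat.pow_le_pow_right (by omega) (by omega)
  omega

end PolyTime

namespace JCov

open Finset

/-! ### Nearly orthogonal vectors -/

section Geometry

variable {V : Type*} [NormedAddCommGroup V] [InnerProductSpace ℝ V]

/-- The vectors `v i`, for `i ∈ U`, have squared length `r` and nearly vanishing inner products. -/
structure NearlyOrthogonal (v : ℕ → V) (U : Finset ℕ) (r δ : ℝ) : Prop where
  sq : ∀ i ∈ U, inner ℝ (v i) (v i) = r
  inner_le : ∀ i ∈ U, ∀ j ∈ U, i ≠ j → |inner ℝ (v i) (v j)| ≤ δ * r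

variable {v : ℕ → V} {U : Finset ℕ} {r δ : ℝ}

/-- In the expanded square the diagonal gives the main term exactly, and each of the at most `#F ^
2` remaining terms is at most `δ * r`. -/
theorem NearlyOrthogonal.abs_norm_sq_sub_le (h : NearlyOrthogonal v U r δ) (hδ : 0 ≤ δ)
    (hr : 0 ≤ r) {F : Finset ℕ} (hF : F ⊆ U) {x : ℕ → ℝ} (hx : ∀ i ∈ F, |x i| ≤ 1) :
    |‖∑ i ∈ F, x i • v i‖ ^ 2 - r * ∑ i ∈ F, x i ^ 2| ≤ δ * r * (#F : ℝ) ^ 2 := by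
  have e : ‖∑ i ∈ F, x i • v i‖ ^ 2 - r * ∑ i ∈ F, x i ^ 2 =
      ∑ i ∈ F, ∑ j ∈ F, (x i * x j * inner ℝ (v i) (v j) - if i = j then r * x i ^ 2 else 0) := by
    rw [← real_inner_self_eq_norm_sq, sum_inner, mul_sum, ← sum_sub_distrib]
    refine sum_congr rfl fun i hi => ?_
    rw [inner_sum, sum_sub_distrib, sum_ite_eq, if_pos hi]
    congr 1
    refine sum_congr rfl fun j _ => ?_
    rw [real_inner_smul_left, real_inner_smul_right]
    ring
  rw [e]
  refine (abs_sum_le_sum_abs _ _).trans ?_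
  have : ∀ i ∈ F, |∑ j ∈ F, (x i * x j * inner ℝ (v i) (v j) -
      if i = j then r * x i ^ 2 else 0)| ≤ ∑ j ∈ F, δ * r := by
    intro i hi
    refine (abs_sum_le_sum_abs _ _).trans (sum_le_sum fun j hj => ?_)
    by_cases hij : i = j
    · subst hij
      rw [if_pos rfl, h.sq i (hF hi)]
      rw [show x i * x i * r - r * x i ^ 2 = 0 by ring, abs_zero]
      positivity
    · rw [if_neg hij, sub_zero, abs_mul, abs_mul]
      have h₁ := h.inner_le i (hF hi) j (hF hj) hij
      have h₂ : |x i| * |x j| ≤ 1 := mul_le_one₀ (hx i hi) (abs_nonneg _) (hx j hj)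
      calc _ ≤ 1 * |inner ℝ (v i) (v j)| := mul_le_mul_of_nonneg_right h₂ (abs_nonneg _)
        _ ≤ _ := by rw [one_mul]; exact h₁
  refine (sum_le_sum this).trans (le_of_eq ?_)
  simp only [sum_const, nsmul_eq_mul]
  ring

theorem NearlyOrthogonal.abs_norm_sum_sq_sub_le (h : NearlyOrthogonal v U r δ) (hδ : 0 ≤ δ)
    (hr : 0 ≤ r) {F : Finset ℕ} (hF : F ⊆ U) :
    |‖∑ i ∈ F, v i‖ ^ 2 - r * #F| ≤ δ * r * (#F : ℝ) ^ 2 := by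
  simpa using h.abs_norm_sq_sub_le hδ hr hF (x := fun _ => 1) (by simp)

/-- The difference has coefficients `±1` on the symmetric difference, which contains an element of
each set outside the other because the cardinalities agree. -/
theorem NearlyOrthogonal.le_norm_sub_sq (h : NearlyOrthogonal v U r δ) (hδ : 0 ≤ δ) (hr : 0 ≤ r)
    {S S' : Finset ℕ} (hS : S ⊆ U) (hS' : S' ⊆ U) (hcard : #S = #S') (hne : S ≠ S') :
    2 * r - δ * r * (2 * #S : ℝ) ^ 2 ≤ ‖∑ i ∈ S, v i - ∑ i ∈ S', v i‖ ^ 2 := by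
  set x : ℕ → ℝ := fun i => (if i ∈ S then 1 else 0) - if i ∈ S' then 1 else 0 with hx
  have e : ∑ i ∈ S, v i - ∑ i ∈ S', v i = ∑ i ∈ S ∪ S', x i • v i := by
    simp only [hx, sub_smul, ite_smul, one_smul, zero_smul, sum_sub_distrib]
    rw [sum_ite_mem, sum_ite_mem, union_inter_cancel_left, union_inter_cancel_right]
  have h₁ := h.abs_norm_sq_sub_le hδ hr (union_subset hS hS') (x := x) (by
    intro i _
    simp only [hx]
    split_ifs <;> norm_num)
  rw [← e, abs_le] at h₁
  have h₂ : (2 : ℝ) ≤ ∑ i ∈ S ∪ S', x i ^ 2 := by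
    have hnS : ¬S ⊆ S' := fun hs => hne (eq_of_subset_of_card_le hs hcard.ge)
    have hnS' : ¬S' ⊆ S := fun hs => hne (eq_of_subset_of_card_le hs hcard.le).symm
    obtain ⟨i, hi, hi'⟩ := not_subset.mp hnS
    obtain ⟨j, hj, hj'⟩ := not_subset.mp hnS'
    have hij : i ≠ j := fun h => hj' (h ▸ hi)
    have : ∑ l ∈ {i, j}, x l ^ 2 ≤ ∑ l ∈ S ∪ S', x l ^ 2 :=
      sum_le_sum_of_subset_of_nonneg (by
        intro l hl
        rcases mem_insert.mp hl with rfl | hl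
        · exact mem_union_left _ hi
        · rw [mem_singleton.mp hl]; exact mem_union_right _ hj) fun _ _ _ => sq_nonneg _
    rw [sum_pair hij] at this
    simp only [hx, hi, hi', hj, hj', if_true, if_false] at this
    norm_num at this
    simpa [hx] using this
  have h₃ : (#(S ∪ S') : ℝ) ≤ 2 * #S := by
    have := card_union_le S S'
    rw [← hcard] at this
    exact_mod_cast (by omega : #(S ∪ S') ≤ 2 * #S)
  have h₄ : δ * r * (#(S ∪ S') : ℝ) ^ 2 ≤ δ * r * (2 * #S : ℝ) ^ 2 :=
    mul_le_mul_of_nonneg_left (pow_le_pow_left₀ (by positivity) h₃ 2) (by positivity)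
  have h₅ : r * 2 ≤ r * ∑ i ∈ S ∪ S', x i ^ 2 := mul_le_mul_of_nonneg_left h₂ hr
  linarith [h₁.1]

/-- Only boundedly many of the vectors have a large inner product with a given vector. -/
theorem NearlyOrthogonal.card_lt (h : NearlyOrthogonal v U r δ) (hδ : 0 ≤ δ) (hr : 0 ≤ r)
    {τ R : ℝ} (hτ : 0 < τ) {m : ℕ} (hm : 0 < m) (hδm : δ * m ≤ 1) (hmR : R ^ 2 * (2 * r) < τ ^ 2 * m)
    {c : V} (hc : ‖c‖ ≤ R) : #{i ∈ U | τ < inner ℝ (v i) c} < m := by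
  by_contra hlt
  obtain ⟨F, hF, hFm⟩ := exists_subset_card_eq (not_lt.mp hlt)
  have hFU : F ⊆ U := hF.trans (filter_subset _ _)
  have h₁ := h.abs_norm_sum_sq_sub_le hδ hr hFU
  rw [hFm, abs_le] at h₁
  -- The sum of `m` such vectors has inner product at least `τ * m` with `c`, but its norm is only
  -- of order `√(r * m)`; Cauchy–Schwarz then bounds `m`.
  have h₂ : τ * m ≤ inner ℝ (∑ i ∈ F, v i) c := by
    rw [sum_inner, ← hFm, mul_comm, ← nsmul_eq_mul]
    exact card_nsmul_le_sum _ _ _ fun i hi => (mem_filter.mp (hF hi)).2.le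
  have h₃ : τ * m ≤ ‖∑ i ∈ F, v i‖ * R :=
    h₂.trans ((real_inner_le_norm _ _).trans (mul_le_mul_of_nonneg_left hc (norm_nonneg _)))
  have hm' : (0 : ℝ) < m := by exact_mod_cast hm
  have h₄ : (τ * m) ^ 2 ≤ (‖∑ i ∈ F, v i‖ * R) ^ 2 := pow_le_pow_left₀ (by positivity) h₃ 2
  have h₅ : ‖∑ i ∈ F, v i‖ ^ 2 ≤ 2 * r * m := by
    have : δ * r * (m : ℝ) ^ 2 ≤ r * m := by
      calc δ * r * (m : ℝ) ^ 2 = (δ * m) * (r * m) := by ring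
        _ ≤ 1 * (r * m) := mul_le_mul_of_nonneg_right hδm (by positivity)
        _ = r * m := one_mul _
    linarith [h₁.2]
  rw [mul_pow, mul_pow] at h₄
  have h₆ : ‖∑ i ∈ F, v i‖ ^ 2 * R ^ 2 ≤ 2 * r * m * R ^ 2 :=
    mul_le_mul_of_nonneg_right h₅ (sq_nonneg R)
  nlinarith

/-- The distance of a sum of vectors from a point that is nearly orthogonal to some of them. -/
theorem NearlyOrthogonal.le_dist_sq (h : NearlyOrthogonal v U r δ) (hδ : 0 ≤ δ) (hr : 0 ≤ r)
    {τ : ℝ} (hτ : 0 ≤ τ) {S T : Finset ℕ} (hT : T ⊆ U) (hST : S ⊆ T) {c : V}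
    (hc : ∀ i ∈ T \ S, inner ℝ (v i) c ≤ τ) :
    r * (#T - #S : ℝ) + ‖∑ i ∈ S, v i - c‖ ^ 2 - (2 * (δ * r * (#T : ℝ) ^ 2) + 2 * (#T * τ)) ≤
      ‖∑ i ∈ T, v i - c‖ ^ 2 := by
  have h₁ := abs_le.mp (h.abs_norm_sum_sq_sub_le hδ hr hT)
  have h₂ := abs_le.mp (h.abs_norm_sum_sq_sub_le hδ hr (hST.trans hT))
  have hcard : (#S : ℝ) ≤ #T := by exact_mod_cast card_le_card hST
  have h₃ : δ * r * (#S : ℝ) ^ 2 ≤ δ * r * (#T : ℝ) ^ 2 :=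
    mul_le_mul_of_nonneg_left (pow_le_pow_left₀ (by positivity) hcard 2) (by positivity)
  have h₄ : inner ℝ (∑ i ∈ T, v i) c = inner ℝ (∑ i ∈ T \ S, v i) c + inner ℝ (∑ i ∈ S, v i) c := by
    rw [← inner_add_left, sum_sdiff hST]
  have h₅ : inner ℝ (∑ i ∈ T \ S, v i) c ≤ #T * τ := by
    rw [sum_inner]
    refine (sum_le_card_nsmul _ _ _ hc).trans ?_
    rw [nsmul_eq_mul]
    exact mul_le_mul_of_nonneg_right (by exact_mod_cast card_le_card sdiff_subset) hτ
  rw [norm_sub_sq_real, norm_sub_sq_real, h₄]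
  linarith [h₁.1, h₂.2]

end Geometry

theorem norm_sub_sq_le_two {V : Type*} [NormedAddCommGroup V] [InnerProductSpace ℝ V] (a b c : V) :
    ‖a - b‖ ^ 2 ≤ 2 * (‖a - c‖ ^ 2 + ‖b - c‖ ^ 2) := by
  have := parallelogram_law_with_norm ℝ (a - c) (b - c)
  have e : a - c - (b - c) = a - b := by abel
  rw [e] at this
  nlinarith [norm_nonneg (a - c + (b - c))]

/-- The number of `z`-subsets of `[n]` that meet `B` in more than `y` elements. -/
theorem card_filter_inter_le {n y z : ℕ} (hyz : y < z) (E : Finset (Finset ℕ))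
    (hE : ∀ T ∈ E, T ⊆ Icc 1 n ∧ #T = z) (B : Finset ℕ) :
    #{T ∈ E | y < #(T ∩ B)} ≤ 2 ^ #B * n ^ (z - y - 1) := by
  -- Such a `T` consists of `y + 1` elements of `B` and `z - y - 1` further elements of `[n]`.
  have h : {T ∈ E | y < #(T ∩ B)} ⊆ (B.powersetCard (y + 1)).biUnion fun A =>
      ((Icc 1 n).powersetCard (z - y - 1)).image fun D => A ∪ D := by
    intro T hT
    obtain ⟨hTE, hTB⟩ := mem_filter.mp hT
    obtain ⟨hTn, hTz⟩ := hE T hTE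
    obtain ⟨A, hA, hAc⟩ := exists_subset_card_eq (Nat.succ_le_of_lt hTB)
    have hAT : A ⊆ T := hA.trans inter_subset_left
    refine mem_biUnion.mpr ⟨A, mem_powersetCard.mpr ⟨hA.trans inter_subset_right, hAc⟩, ?_⟩
    refine mem_image.mpr ⟨T \ A, mem_powersetCard.mpr ⟨sdiff_subset.trans hTn, ?_⟩,
      union_sdiff_of_subset hAT⟩
    rw [card_sdiff_of_subset hAT, hTz, hAc]
    omega
  refine (card_le_card h).trans (card_biUnion_le.trans ?_)
  refine (sum_le_card_nsmul _ _ (n ^ (z - y - 1)) fun A _ => ?_).trans ?_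
  · refine card_image_le.trans ?_
    rw [card_powersetCard, Nat.card_Icc, Nat.add_sub_cancel]
    exact Nat.choose_le_pow _ _
  · rw [smul_eq_mul, card_powersetCard]
    exact Nat.mul_le_mul_right _ (Nat.choose_le_two_pow _ _)

end JCov

namespace JCov

open Finset

/-! ### The cost of arbitrary centers, and of sums over `y`-sets as centers. -/

section Soundness

variable {V : Type*} [NormedAddCommGroup V] [InnerProductSpace ℝ V]
  {v : ℕ → V} {U : Finset ℕ} {r δ κ τ : ℝ} {n m y z : ℕ}

/-- A center `c` determines a `y`-set such that the sets that do not contain it are far from `c`,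
up to the few sets that contain more than `y` elements of a small set. -/
theorem NearlyOrthogonal.exists_set_of_center (h : NearlyOrthogonal v U r δ) (hδ : 0 ≤ δ)
    (hr : 0 < r) (hr1 : r ≤ 1) (hU : U ⊆ Icc 1 n) (hyn : y ≤ n) (hyz : y < z)
    (hrz : r * ((z : ℝ) - y + 1 / 2) ≤ 4)
    (hκ : 0 ≤ κ) (hτ : 0 < τ) (hsmall : 2 * (δ * r * (z : ℝ) ^ 2) + 2 * (z * τ) ≤ κ / 2 * r)
    (hδz : 4 * (δ * (z : ℝ) ^ 2) ≤ κ) (hδ1 : δ * z ≤ 1) (hm : 0 < m) (hδm : δ * m ≤ 1)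
    (hmR : (2 * z + 4 : ℝ) ^ 2 * (2 * r) < τ ^ 2 * m) (c : V) :
    ∃ S ∈ (Icc 1 n).powersetCard y, ∃ B : Finset ℕ, #B < m ∧
      ∀ T ⊆ U, #T = z → #(T ∩ B) ≤ y →
        r * ((z : ℝ) - y - κ) ≤ ‖∑ i ∈ T, v i - c‖ ^ 2 ∧
          (¬S ⊆ T → r * ((z : ℝ) - y + 1 / 2 - κ) ≤ ‖∑ i ∈ T, v i - c‖ ^ 2) := by
  obtain ⟨S₀, hS₀⟩ : ((Icc 1 n).powersetCard y).Nonempty := by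
    rw [powersetCard_nonempty, Nat.card_Icc]
    omega
  have hrκ : 0 ≤ r * κ := by positivity
  have hz1 : (1 : ℝ) ≤ z := by exact_mod_cast (by omega : 1 ≤ z)
  by_cases hc : ‖c‖ ≤ 2 * z + 4
  swap
  -- A center this far out has distance at least 4 from every point, since all points have norm at
  -- most `2 * z`; by `hrz` both required squared distances are at most 4, so any `y`-set will do.
  · refine ⟨S₀, hS₀, ∅, by simpa using hm, fun T hT hTz _ => ?_⟩
    have h₁ := abs_le.mp (h.abs_norm_sum_sq_sub_le hδ hr.le hT)
    rw [hTz] at h₁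
    have h₂ : ‖∑ i ∈ T, v i‖ ^ 2 ≤ (2 * z : ℝ) ^ 2 := by
      have : δ * r * (z : ℝ) ^ 2 ≤ z := by
        calc δ * r * (z : ℝ) ^ 2 = (δ * z) * (r * z) := by ring
          _ ≤ 1 * (1 * z) := by
            refine mul_le_mul hδ1 (mul_le_mul_of_nonneg_right hr1 (by positivity)) (by positivity)
              (by norm_num)
          _ = z := by ring
      nlinarith [h₁.2]
    have h₃ : ‖∑ i ∈ T, v i‖ ≤ 2 * z := le_of_sq_le_sq h₂ (by positivity)
    have h₄ : 4 ≤ ‖∑ i ∈ T, v i - c‖ := by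
      have := norm_sub_norm_le c (∑ i ∈ T, v i)
      rw [norm_sub_rev] at this
      linarith
    have h₅ : r * ((z : ℝ) - y + 1 / 2 - κ) ≤ ‖∑ i ∈ T, v i - c‖ ^ 2 := by nlinarith
    exact ⟨by nlinarith, fun _ => h₅⟩
  -- `P` singles out the `y`-sets whose sum is close to `c`. If one exists it is taken for `S`,
  -- otherwise `S` is arbitrary.
  set P : Finset ℕ → Prop := fun S => S ⊆ U ∧ #S = y ∧
    ‖∑ i ∈ S, v i - c‖ ^ 2 < r * (1 / 2 - κ / 2) with hP
  have hex : ∃ S ∈ (Icc 1 n).powersetCard y, (∃ S', P S') → P S := by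
    by_cases hS : ∃ S', P S'
    · obtain ⟨S', hS'⟩ := hS
      exact ⟨S', mem_powersetCard.mpr ⟨hS'.1.trans hU, hS'.2.1⟩, fun _ => hS'⟩
    · exact ⟨S₀, hS₀, fun h => absurd h hS⟩
  obtain ⟨S, hS, hPS⟩ := hex
  refine ⟨S, hS, {i ∈ U | τ < inner ℝ (v i) c}, h.card_lt hδ hr.le hτ hm hδm hmR hc,
    fun T hT hTz hTB => ?_⟩
  set S₁ := T ∩ {i ∈ U | τ < inner ℝ (v i) c} with hS₁
  have hd := h.le_dist_sq hδ hr.le hτ.le hT (inter_subset_left : S₁ ⊆ T) (c := c) (by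
    intro i hi
    rw [mem_sdiff, mem_inter, mem_filter] at hi
    by_contra hlt
    exact hi.2 ⟨hi.1, hT hi.1, not_le.mp hlt⟩)
  rw [hTz] at hd
  have hn := sq_nonneg ‖∑ i ∈ S₁, v i - c‖
  have hTB' : (#S₁ : ℝ) ≤ y := by exact_mod_cast hTB
  have hbase : r * ((z : ℝ) - y) ≤ r * (z - #S₁) := mul_le_mul_of_nonneg_left (by linarith) hr.le
  refine ⟨by nlinarith, fun hST => ?_⟩
  -- With fewer than `y` elements in `T ∩ B` a full further `r` is gained. With exactly `y`
  -- elements, either the sum over `T ∩ B` is far from `c`, which gains `r / 2`, or `T ∩ B`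
  -- satisfies `P`.
  rcases hTB.lt_or_eq with hlt | heq
  · have : (#S₁ : ℝ) + 1 ≤ y := by exact_mod_cast hlt
    have : r * ((z : ℝ) - y + 1) ≤ r * (z - #S₁) := mul_le_mul_of_nonneg_left (by linarith) hr.le
    nlinarith
  · by_cases hS₁P : ‖∑ i ∈ S₁, v i - c‖ ^ 2 < r * (1 / 2 - κ / 2)
    -- Here `S₁` and `S` are distinct and both close to `c`. Their sums would be at squared distance
    -- below `2 * r * (1 - κ)` by the parallelogram law, but at least `r * (2 - κ)` by near
    -- orthogonality.
    · exfalso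
      have hS₁U : S₁ ⊆ U := inter_subset_left.trans hT
      have hP' := hPS ⟨S₁, hS₁U, heq, hS₁P⟩
      have hne : S₁ ≠ S := by
        rintro rfl
        exact hST inter_subset_left
      have h₁ := h.le_norm_sub_sq hδ hr.le hS₁U hP'.1 (heq.trans hP'.2.1.symm) hne
      have h₂ := norm_sub_sq_le_two (∑ i ∈ S₁, v i) (∑ i ∈ S, v i) c
      have h₃ := hP'.2.2
      rw [heq] at h₁
      have hy : (y : ℝ) ≤ z := by exact_mod_cast hyz.le
      have h₄ : δ * (y : ℝ) ^ 2 ≤ δ * (z : ℝ) ^ 2 :=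
        mul_le_mul_of_nonneg_left (pow_le_pow_left₀ (by positivity) hy 2) hδ
      have h₅ : r * (4 * (δ * (y : ℝ) ^ 2)) ≤ r * κ := mul_le_mul_of_nonneg_left (by linarith) hr.le
      nlinarith
    · rw [not_lt] at hS₁P
      nlinarith

/-- The `y`-sets assigned to the `k` centers cover at most `α * #E` sets. These pay at least `a`,
the others at least `b ≥ a`, except for the few sets that meet some `B j` too often, each of which
forfeits at most `b`. -/
theorem NearlyOrthogonal.le_sum_dist (h : NearlyOrthogonal v U r δ) (hδ : 0 ≤ δ)
    (hr : 0 < r) (hr1 : r ≤ 1) (hU : U ⊆ Icc 1 n) (hyn : y ≤ n) (hyz : y < z)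
    (hrz : r * ((z : ℝ) - y + 1 / 2) ≤ 4)
    (hκ : 0 ≤ κ) (hτ : 0 < τ) (hsmall : 2 * (δ * r * (z : ℝ) ^ 2) + 2 * (z * τ) ≤ κ / 2 * r)
    (hδz : 4 * (δ * (z : ℝ) ^ 2) ≤ κ) (hδ1 : δ * z ≤ 1) (hm : 0 < m) (hδm : δ * m ≤ 1)
    (hmR : (2 * z + 4 : ℝ) ^ 2 * (2 * r) < τ ^ 2 * m) {E : Finset (Finset ℕ)}
    (hE : ∀ T ∈ E, T ⊆ U ∧ #T = z) {k : ℕ} {α : ℝ}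
    (hcov : ∀ S : Fin k → Finset ℕ, (∀ j, S j ∈ (Icc 1 n).powersetCard y) →
      (#(covFamily S E) : ℝ) ≤ α * #E) (c : Fin k → V) (σ : Finset ℕ → Fin k) :
    (α * √(r * ((z : ℝ) - y - κ)) + (1 - α) * √(r * ((z : ℝ) - y + 1 / 2 - κ))) * #E -
        √(r * ((z : ℝ) - y + 1 / 2 - κ)) * (2 ^ m * (k * (n : ℝ) ^ (z - y - 1))) ≤
      ∑ T ∈ E, ‖∑ i ∈ T, v i - c (σ T)‖ := by
  choose S hS B hB hSB using fun j => h.exists_set_of_center hδ hr hr1 hU hyn hyz hrz hκ hτ hsmall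
    hδz hδ1 hm hδm hmR (c j)
  set a := √(r * ((z : ℝ) - y - κ)) with ha
  set b := √(r * ((z : ℝ) - y + 1 / 2 - κ)) with hb
  have hab : a ≤ b := Real.sqrt_le_sqrt (mul_le_mul_of_nonneg_left (by linarith) hr.le)
  have hb0 : 0 ≤ b := Real.sqrt_nonneg _
  set bad := {T ∈ E | y < #(T ∩ B (σ T))} with hbad
  have hbadc : (#bad : ℝ) ≤ 2 ^ m * (k * (n : ℝ) ^ (z - y - 1)) := by
    have h₁ : bad ⊆ univ.biUnion fun j => {T ∈ E | y < #(T ∩ B j)} := fun T hT => by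
      rw [hbad, mem_filter] at hT
      exact mem_biUnion.mpr ⟨σ T, mem_univ _, mem_filter.mpr hT⟩
    have h₂ : #bad ≤ k * (2 ^ m * n ^ (z - y - 1)) := by
      refine (card_le_card h₁).trans (card_biUnion_le.trans ?_)
      refine (sum_le_card_nsmul _ _ (2 ^ m * n ^ (z - y - 1)) fun j _ => ?_).trans ?_
      · refine (card_filter_inter_le hyz E (fun T hT => ⟨(hE T hT).1.trans hU, (hE T hT).2⟩)
          (B j)).trans (Nat.mul_le_mul_right _ ?_)
        exact Nat.pow_le_pow_right (by omega) (hB j).le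
      · rw [card_univ, Fintype.card_fin, smul_eq_mul]
    have h₃ : (#bad : ℝ) ≤ k * (2 ^ m * (n : ℝ) ^ (z - y - 1)) := by exact_mod_cast h₂
    linarith
  -- One inequality for all cases, ready to be summed: a covered set gives up `b - a`, an
  -- exceptional one gives up `b`.
  have hterm : ∀ T ∈ E, b - (b - a) * (if T ∈ covFamily S E then 1 else 0) -
      b * (if T ∈ bad then 1 else 0) ≤ ‖∑ i ∈ T, v i - c (σ T)‖ := by
    intro T hT
    obtain ⟨hTU, hTz⟩ := hE T hT
    by_cases hTb : T ∈ bad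
    · rw [if_pos hTb]
      have : 0 ≤ (b - a) * (if T ∈ covFamily S E then 1 else 0) :=
        mul_nonneg (by linarith) (by split_ifs <;> norm_num)
      have := norm_nonneg (∑ i ∈ T, v i - c (σ T))
      linarith
    · rw [if_neg hTb]
      have hTB : #(T ∩ B (σ T)) ≤ y := by
        by_contra hlt
        exact hTb (mem_filter.mpr ⟨hT, not_le.mp hlt⟩)
      obtain ⟨h₁, h₂⟩ := hSB (σ T) T hTU hTz hTB
      by_cases hTc : T ∈ covFamily S E
      · rw [if_pos hTc]
        have : a ≤ ‖∑ i ∈ T, v i - c (σ T)‖ := Real.sqrt_le_iff.mpr ⟨norm_nonneg _, h₁⟩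
        linarith
      · rw [if_neg hTc]
        have hST : ¬S (σ T) ⊆ T := fun hs => hTc (mem_biUnion.mpr ⟨σ T, mem_univ _,
          mem_filter.mpr ⟨hT, hs⟩⟩)
        have : b ≤ ‖∑ i ∈ T, v i - c (σ T)‖ := Real.sqrt_le_iff.mpr ⟨norm_nonneg _, h₂ hST⟩
        linarith
  refine le_trans ?_ (sum_le_sum hterm)
  rw [sum_sub_distrib, sum_sub_distrib, ← mul_sum, ← mul_sum, sum_ite_mem, sum_ite_mem, sum_const,
    sum_const, sum_const, nsmul_eq_mul, nsmul_eq_mul, nsmul_eq_mul, mul_one, mul_one]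
  have hc := hcov S hS
  have h₁ : (#(E ∩ covFamily S E) : ℝ) ≤ α * #E :=
    le_trans (by exact_mod_cast card_le_card inter_subset_right) hc
  have h₂ : (#(E ∩ bad) : ℝ) ≤ 2 ^ m * (k * (n : ℝ) ^ (z - y - 1)) :=
    le_trans (by exact_mod_cast card_le_card inter_subset_right) hbadc
  have h₃ := mul_le_mul_of_nonneg_left h₁ (sub_nonneg.mpr hab)
  have h₄ := mul_le_mul_of_nonneg_left h₂ hb0
  linarith

/-- Sums over `y`-sets are good centers. -/
theorem NearlyOrthogonal.norm_sub_sq_le (h : NearlyOrthogonal v U r δ) (hδ : 0 ≤ δ) (hr : 0 ≤ r)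
    {S T : Finset ℕ} (hT : T ⊆ U) (hST : S ⊆ T) (hTz : #T = z) (hSy : #S = y) :
    ‖∑ i ∈ T, v i - ∑ i ∈ S, v i‖ ^ 2 ≤ r * (((z : ℝ) - y) + δ * ((z : ℝ) - y) ^ 2) := by
  have e : ∑ i ∈ T, v i - ∑ i ∈ S, v i = ∑ i ∈ T \ S, v i := by
    rw [sub_eq_iff_eq_add, sum_sdiff hST]
  have hc : (#(T \ S) : ℝ) = z - y := by
    have := card_sdiff_add_card_eq_card hST
    rw [hTz, hSy] at this
    rw [eq_sub_iff_add_eq]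
    exact_mod_cast this
  have h₁ := abs_le.mp (h.abs_norm_sum_sq_sub_le hδ hr (sdiff_subset.trans hT : T \ S ⊆ U))
  rw [← e, hc] at h₁
  linarith [h₁.2]

end Soundness

end JCov

/-! ### Agreement of the string reduction with the geometric construction. -/

namespace JCov

open Computability (Γ')
open PolyTime

/-! ### Encodings of numbers -/

theorem encNat_eq (n : ℕ) : encNat n = (Computability.encodeNat n).map Γ'.bit := rfl

theorem encNat_injective : Function.Injective encNat :=
  Computability.encodingNatΓ'.encode_injective

theorem comma_notMem_encNat (n : ℕ) : Γ'.comma ∉ encNat n := by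
  rw [encNat_eq]
  simp

/-- Binary numbers are written with the lowest bit first, so doubling prepends a zero; the number
`0` is the empty word and is excluded. -/
theorem encNat_two_mul {n : ℕ} (hn : 0 < n) : encNat (2 * n) = Γ'.bit false :: encNat n := by
  rw [encNat_eq, encNat_eq, Computability.encodeNat, Computability.encodeNat, two_mul,
    Num.add_of_nat]
  have h : ((n : ℕ) : Num) ≠ 0 := by
    rw [Ne, ← Num.to_nat_inj, Num.to_of_nat]
    simpa using hn.ne'
  generalize ((n : ℕ) : Num) = m at h
  rw [Num.bit0_of_bit0]
  cases m with
  | zero => exact absurd rfl h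
  | pos p => rfl

theorem encNat_two_pow (s : ℕ) :
    encNat (2 ^ s) = List.replicate s (Γ'.bit false) ++ [Γ'.bit true] := by
  induction s with
  | zero => rfl
  | succ s ih => rw [pow_succ', encNat_two_mul (by positivity), ih]; rfl

/-! ### Parsing an instance -/

theorem foldl_token_bits (l : List Bool) (q : ParserState) :
    (l.map Γ'.bit).foldl token q = ((l.map Γ'.bit).reverse ++ q.1, q.2) := by
  induction l generalizing q with
  | nil => rfl
  | cons b l ih => simp [ih, token]

theorem foldl_token_set (T : List ℕ) (q : ParserState) :
    (encList encNat T).foldl token q =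
      ([], [], (T.map fun i => (encNat i).reverse).reverse :: q.2.2) := by
  have key : ∀ (T : List ℕ) (c : List (List Γ')) (d : List (List (List Γ'))),
      (T.flatMap fun a => encNat a ++ [Γ'.comma]).foldl token ([], c, d) =
        ([], (T.map fun i => (encNat i).reverse).reverse ++ c, d) := by
    intro T
    induction T with
    | nil => intro c d; rfl
    | cons i T ih =>
      intro c d
      rw [List.flatMap_cons, List.foldl_append, List.foldl_append, encNat_eq, foldl_token_bits]
      simp only [List.foldl_cons, List.foldl_nil, token, List.append_nil]
      rw [ih]
      simp [encNat_eq]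
  rw [encList, List.foldl_cons, List.foldl_append]
  simp only [token]
  rw [key]
  simp [token]

/-- The commas after the sets leave spurious entries in the current set. An opening bracket discards
them, and the closing bracket of the outer list turns what is left into one spurious set at the
head, removed by `tail` in `parseSets`. The parser stores sets and elements in reverse order. -/
theorem parseSets_encList (l : List (List ℕ)) :
    parseSets (encList (encList encNat) l) =
      (l.map fun T => (T.map fun i => (encNat i).reverse).reverse).reverse := by
  have key : ∀ (l : List (List ℕ)) (q : ParserState), q.1 = [] →
      ∃ c, (l.flatMap fun a => encList encNat a ++ [Γ'.comma]).foldl token q =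
        ([], c, (l.map fun T => (T.map fun i => (encNat i).reverse).reverse).reverse ++ q.2.2) := by
    intro l
    induction l with
    | nil => rintro ⟨a, b, d⟩ rfl; exact ⟨b, rfl⟩
    | cons T l ih =>
      intro q hq
      obtain ⟨c, hc⟩ := ih (token ([], [], (T.map fun i => (encNat i).reverse).reverse :: q.2.2)
        Γ'.comma) rfl
      refine ⟨c, ?_⟩
      rw [List.flatMap_cons, List.foldl_append, List.foldl_append, foldl_token_set, List.foldl_cons,
        List.foldl_nil, hc]
      simp [token]
  obtain ⟨c, hc⟩ := key l (token ([], [], []) Γ'.bra) rfl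
  rw [parseSets, encList, List.foldl_cons, List.foldl_append, hc]
  simp [token]

theorem notComma_of_mem {l : List Γ'} (h : Γ'.comma ∉ l) : ∀ s ∈ l, notComma s = true := by
  intro s hs
  rw [notComma, decide_eq_true_eq]
  rintro rfl
  exact h hs

theorem takeWhile_notComma {l : List Γ'} (h : Γ'.comma ∉ l) (l' : List Γ') :
    (l ++ Γ'.comma :: l').takeWhile notComma = l := by
  rw [List.takeWhile_append_of_pos (notComma_of_mem h)]
  simp [notComma]

theorem afterComma_append {l : List Γ'} (h : Γ'.comma ∉ l) (l' : List Γ') :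
    afterComma (l ++ Γ'.comma :: l') = l' := by
  rw [afterComma, List.dropWhile_append_of_pos (notComma_of_mem h)]
  simp [notComma]

theorem JohnsonInstance.enc_eq (I : JohnsonInstance) :
    I.enc = encNat I.n ++ Γ'.comma :: (encNat I.k ++ Γ'.comma :: encList (encList encNat) I.sets) := by
  simp [JohnsonInstance.enc]

/-! ### Encodings of coordinates -/

/-- The table of the strings for `(2 c - z) u / 2 ^ (t + s)`, up to `s` symbols. -/
def coordTable (z u t c : ℕ) : List Γ' × Bool × List Γ' :=
  if z + 1 ≤ c then ([], false, []) else
  if 2 * c = z then (encRat 0, false, []) else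
  let a := (2 * (c : ℤ) - z).natAbs * u
  (Γ'.bra :: Γ'.bit (decide (2 * c < z)) :: (encNat (ordCompl[2] a) ++ [Γ'.comma]), true,
    List.replicate (t - a.factorization 2) (Γ'.bit false) ++ [Γ'.bit true, Γ'.ket])

theorem coordTable_eq_of_le {z u t c : ℕ} (h : z + 1 ≤ c) :
    coordTable z u t c = coordTable z u t (z + 1) := by
  rw [coordTable, if_pos h, coordTable, if_pos le_rfl]

theorem encRat_coord {z u t c : ℕ} (hu : Odd u) (hz : z < 2 ^ t) (hc : c ≤ z) (s : ℕ) :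
    encRat ((2 * (c : ℚ) - z) * (u / 2 ^ (t + s))) = coordString (coordTable z u t) s c := by
  rw [coordString, coordTable, if_neg (by omega)]
  by_cases h0 : 2 * c = z
  · rw [if_pos h0]
    have : (2 * (c : ℚ) - z) = 0 := by rw [← h0]; push_cast; ring
    simp [this]
  rw [if_neg h0]
  simp only [cond_true]
  set b := (2 * (c : ℤ) - z).natAbs with hb
  have hb0 : b ≠ 0 := by omega
  have hu0 : u ≠ 0 := by rintro rfl; simp at hu
  have ha0 : b * u ≠ 0 := Nat.mul_ne_zero hb0 hu0
  set j := (b * u).factorization 2 with hj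
  set m := ordCompl[2] (b * u) with hm
  have hjm : 2 ^ j * m = b * u := Nat.ordProj_mul_ordCompl_eq_self _ _
  have hm2 : Nat.Coprime 2 m := Nat.coprime_ordCompl Nat.prime_two ha0
  have hjt : j ≤ t := by
    have h₁ : 2 ^ j ∣ b := by
      have : Nat.Coprime (2 ^ j) u := Nat.Coprime.pow_left _ ((Nat.coprime_two_left).mpr hu)
      exact this.dvd_of_dvd_mul_right ⟨m, hjm.symm⟩
    have h₂ := Nat.le_of_dvd (Nat.pos_of_ne_zero hb0) h₁
    have h₃ : 2 ^ j < 2 ^ t := by omega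
    exact ((Nat.pow_lt_pow_iff_right (by omega)).mp h₃).le
  have hpos : ((b : ℚ)) * (u / 2 ^ (t + s)) = (m : ℤ) / (2 ^ (t - j + s) : ℕ) := by
    have h₁ : (2 : ℚ) ^ j * m = b * u := by exact_mod_cast hjm
    have h₂ : (2 : ℚ) ^ (t + s) = 2 ^ j * 2 ^ (t - j + s) := by
      rw [← pow_add]; congr 1; omega
    rw [h₂]
    push_cast
    rw [mul_div_assoc', ← h₁]
    field_simp
  have hcop : Nat.Coprime ((m : ℤ).natAbs) (2 ^ (t - j + s)) := by
    rw [Int.natAbs_natCast]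
    exact (Nat.Coprime.pow_left _ hm2).symm
  have hnum : ((m : ℤ) / ((2 ^ (t - j + s) : ℕ) : ℚ) : ℚ).num = m := by
    have h := Rat.num_div_eq_of_coprime (a := (m : ℤ)) (b := ((2 ^ (t - j + s) : ℕ) : ℤ))
      (by positivity) (by simpa using hcop)
    rwa [Int.cast_natCast (2 ^ (t - j + s))] at h
  have hden : ((m : ℤ) / ((2 ^ (t - j + s) : ℕ) : ℚ) : ℚ).den = 2 ^ (t - j + s) := by
    have h := Rat.den_div_eq_of_coprime (a := (m : ℤ)) (b := ((2 ^ (t - j + s) : ℕ) : ℤ))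
      (by positivity) (by simpa using hcop)
    rw [Int.cast_natCast (2 ^ (t - j + s))] at h
    exact_mod_cast h
  have hrep : List.replicate (t - j + s) (Γ'.bit false) =
      List.replicate s (Γ'.bit false) ++ List.replicate (t - j) (Γ'.bit false) := by
    rw [List.replicate_append_replicate, Nat.add_comm]
  have hup : (0 : ℚ) < u / 2 ^ (t + s) := by positivity
  by_cases hlt : 2 * c < z
  · have hbe : (2 * (c : ℚ) - z) = -(b : ℚ) := by
      have : (2 * (c : ℤ) - z) = -(b : ℤ) := by omega
      exact_mod_cast this
    have hneg : (2 * (c : ℚ) - z) * (u / 2 ^ (t + s)) < 0 := by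
      rw [hbe]
      have : (0 : ℚ) < b := by exact_mod_cast Nat.pos_of_ne_zero hb0
      nlinarith
    rw [encRat, decide_eq_true hneg, decide_eq_true hlt, hbe, neg_mul, hpos, Rat.num_neg_eq_neg_num,
      Rat.den_neg_eq_den, hnum, hden, Int.natAbs_neg, Int.natAbs_natCast]
    rw [encNat_two_pow, hrep]
    simp only [List.cons_append, List.append_assoc, List.nil_append]
  · have hbe : (2 * (c : ℚ) - z) = (b : ℚ) := by
      have : (2 * (c : ℤ) - z) = (b : ℤ) := by omega
      exact_mod_cast this
    have hneg : ¬(2 * (c : ℚ) - z) * (u / 2 ^ (t + s)) < 0 := by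
      rw [hbe, not_lt]
      positivity
    rw [encRat, decide_eq_false hneg, decide_eq_false hlt, hbe, hpos, hnum, hden, Int.natAbs_natCast]
    rw [encNat_two_pow, hrep]
    simp only [List.cons_append, List.append_assoc, List.nil_append]

end JCov

namespace PolyTime

open Computability (Γ')

/-! ### The code and its dictionary -/

theorem differ_comm (u v : List Bool) : differ u v = differ v u := by
  rw [differ, differ, List.zipWith_comm_of_comm Bool.xor_comm]

theorem pair_lookup_mem {dict : List (List Γ' × List Bool)} {key : List Γ'}
    (h : key ∈ dict.map Prod.fst) : (key, lookup dict key) ∈ dict := by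
  have aux : ∀ (dict : List (List Γ' × List Bool)) (acc : List Bool),
      (key, dict.foldl (fun acc p => bif decide (p.1 = key) then p.2 else acc) acc) ∈ dict ∨
        key ∉ dict.map Prod.fst ∧
          dict.foldl (fun acc p => bif decide (p.1 = key) then p.2 else acc) acc = acc := by
    intro dict
    induction dict with
    | nil => intro acc; exact Or.inr ⟨by simp, rfl⟩
    | cons p dict ih =>
      intro acc
      rw [List.foldl_cons]
      rcases ih (bif decide (p.1 = key) then p.2 else acc) with h | ⟨h₁, h₂⟩
      · exact Or.inl (List.mem_cons_of_mem _ h)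
      · rw [h₂]
        by_cases hp : p.1 = key
        · left
          rw [decide_eq_true hp, ← hp]
          exact List.mem_cons_self
        · right
          rw [decide_eq_false hp, List.map_cons, List.mem_cons]
          exact ⟨fun h => h.elim (fun h => hp h.symm) h₁, rfl⟩
  exact (aux dict []).resolve_right fun h' => h'.1 h

theorem counts_eq {dict : List (List Γ' × List Bool)} {D : ℕ} {T : List (List Γ')}
    (h : ∀ key ∈ T, (lookup dict key).length = D) :
    counts dict D T = List.ofFn fun p : Fin D =>
      T.countP fun key => (lookup dict key).getD p false := by
  have aux : ∀ (T : List (List Γ')) (acc : List ℕ), (∀ key ∈ T, (lookup dict key).length = D) →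
      acc.length = D →
      T.foldl (fun acc key => List.zipWith (fun n b => bif b then n + 1 else n) acc
        (lookup dict key)) acc = List.ofFn fun p : Fin D =>
          acc.getD p 0 + T.countP fun key => (lookup dict key).getD p false := by
    intro T
    induction T with
    | nil =>
      intro acc _ hacc
      subst hacc
      refine List.ext_getElem (by simp) fun i h₁ h₂ => ?_
      have hi : i < acc.length := h₁
      simp
    | cons key T ih =>
      intro acc hT hacc
      have hk := hT key List.mem_cons_self
      rw [List.foldl_cons, ih _ (fun k hk => hT k (List.mem_cons_of_mem _ hk)) (by simp [hacc, hk])]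
      congr 1
      funext p
      have h₁ : (p : ℕ) < acc.length := by rw [hacc]; exact p.2
      have h₂ : (p : ℕ) < (lookup dict key).length := by rw [hk]; exact p.2
      rw [List.countP_cons, List.getD_eq_getElem _ _ h₁, List.getD_eq_getElem _ _ h₂,
        List.getD_eq_getElem _ _ (by simpa using ⟨h₁, h₂⟩), List.getElem_zipWith]
      cases (lookup dict key)[(p : ℕ)] 
      · simp
      · simp
        omega
  rw [counts, aux T _ h (by simp)]
  congr 1
  funext p
  simp

section

variable {e K : ℕ} {sets : List (List (List Γ'))}

/-- The code has at least as many words as there are occurrences of elements, so zipping drops no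
key. -/
theorem map_fst_dictOf (hK : 2 ≤ K) (he : 4 * K ^ 2 ≤ 4 ^ e) :
    (dictOf e K sets).map Prod.fst = sets.flatten :=
  List.map_fst_zip (dimExp_length_greedy hK he _)

theorem lookup_mem_greedy (hK : 2 ≤ K) (he : 4 * K ^ 2 ≤ 4 ^ e) {key : List Γ'}
    (hkey : key ∈ sets.flatten) :
    lookup (dictOf e K sets) key ∈ greedy K (words (4 ^ dimExp e sets.flatten.length)) := by
  rw [← map_fst_dictOf hK he] at hkey
  exact (List.of_mem_zip (pair_lookup_mem hkey)).2

theorem length_lookup (hK : 2 ≤ K) (he : 4 * K ^ 2 ≤ 4 ^ e) {key : List Γ'}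
    (hkey : key ∈ sets.flatten) :
    (lookup (dictOf e K sets) key).length = 4 ^ dimExp e sets.flatten.length :=
  mem_words.mp (greedy_subset (lookup_mem_greedy hK he hkey))

theorem nodup_greedy (hK : 2 ≤ K) {D : ℕ} (hD : 0 < D) : (greedy K (words D)).Nodup := by
  refine (List.Pairwise.and_mem.mp (greedy_pairwise K (words D))).imp ?_
  rintro u v ⟨hu, -, huv⟩ rfl
  have : u ≠ [] := by
    rintro rfl
    have := mem_words.mp (greedy_subset hu)
    simp at this
    omega
  rw [nearOrth_self hK this] at huv
  exact absurd huv (by simp)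

/-- Words at different positions of the code differ, so equal words come from the same position and
hence belong to the same key. -/
theorem lookup_ne (hK : 2 ≤ K) (he : 4 * K ^ 2 ≤ 4 ^ e) {key key' : List Γ'}
    (hkey : key ∈ sets.flatten) (hkey' : key' ∈ sets.flatten) (hne : key ≠ key') :
    lookup (dictOf e K sets) key ≠ lookup (dictOf e K sets) key' := by
  intro h
  rw [← map_fst_dictOf hK he] at hkey hkey'
  obtain ⟨i, hi, hi'⟩ := List.mem_iff_getElem.mp (pair_lookup_mem hkey)
  obtain ⟨j, hj, hj'⟩ := List.mem_iff_getElem.mp (pair_lookup_mem hkey')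
  have hd : dictOf e K sets = List.zip sets.flatten
    (greedy K (words (4 ^ dimExp e sets.flatten.length))) := rfl
  simp only [hd, List.getElem_zip, Prod.mk.injEq] at hi' hj'
  have h₁ : i = j := by
    rw [hd, List.length_zip] at hi hj
    have := hi'.2.trans ((congrArg _ rfl).trans (h.trans hj'.2.symm))
    exact (nodup_greedy hK (by positivity)).getElem_inj_iff.mp this
  subst h₁
  exact hne (hi'.1.symm.trans hj'.1)

theorem nearOrth_or_of_mem_greedy {D : ℕ} {u v : List Bool} (hu : u ∈ greedy K (words D))
    (hv : v ∈ greedy K (words D)) (hne : u ≠ v) :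
    nearOrth K u v = true ∨ nearOrth K v u = true := by
  have : Std.Symm fun u v => nearOrth K u v = true ∨ nearOrth K v u = true := ⟨fun _ _ => Or.symm⟩
  exact ((greedy_pairwise K (words D)).imp (S := fun u v => nearOrth K u v = true ∨ nearOrth K v u = true)
    Or.inl).forall hu hv hne

end

end PolyTime

namespace JCov

open Finset
open Computability (Γ')
open PolyTime

/-! ### Words as vectors -/

/-- The vector with entries `± q` given by a word. -/
noncomputable def wordVec (D : ℕ) (q : ℝ) (w : List Bool) : EuclideanSpace ℝ (Fin D) :=
  WithLp.toLp 2 fun p => if w.getD p false then q else -q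

theorem inner_wordVec {D : ℕ} (q : ℝ) {u v : List Bool} (hu : u.length = D) (hv : v.length = D) :
    inner ℝ (wordVec D q u) (wordVec D q v) = q ^ 2 * (D - 2 * differ u v) := by
  have aux : ∑ p : Fin D, (if v.getD p false then q else -q) * (if u.getD p false then q else -q) =
      q ^ 2 * (D - 2 * differ u v) := by
    induction D generalizing u v with
    | zero =>
      rw [List.length_eq_zero_iff] at hu hv
      subst hu hv
      simp [differ]
    | succ D ih =>
      match u, v, hu, hv with
      | a :: u, b :: v, hu, hv =>
        rw [Fin.sum_univ_succ]
        simp only [Fin.val_zero, List.getD_cons_zero, Fin.val_succ, List.getD_cons_succ]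
        rw [ih (by simpa using hu) (by simpa using hv), differ_cons]
        cases a <;> cases b <;> simp <;> ring
  rw [← aux]
  simp [wordVec, PiLp.inner_apply]

theorem abs_inner_wordVec_le {K D : ℕ} (hK : 0 < K) (q : ℝ) {u v : List Bool} (hu : u.length = D)
    (hv : v.length = D) (h : nearOrth K u v = true ∨ nearOrth K v u = true) :
    |inner ℝ (wordVec D q u) (wordVec D q v)| ≤ 1 / K * (q ^ 2 * D) := by
  have h' : nearOrth K u v = true := by
    rcases h with h | h
    · exact h
    · rw [nearOrth, differ_comm u v, hu, ← hv]
      exact h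
  rw [nearOrth, Bool.and_eq_true, decide_eq_true_eq, decide_eq_true_eq, hu] at h'
  obtain ⟨h₁, h₂⟩ := h'
  have hK' : (0 : ℝ) < K := by exact_mod_cast hK
  have h₁' : (K : ℝ) * D ≤ D + 2 * K * differ u v := by exact_mod_cast h₁
  have h₂' : 2 * (K : ℝ) * differ u v ≤ K * D + D := by exact_mod_cast h₂
  rw [inner_wordVec q hu hv, abs_mul, abs_of_nonneg (sq_nonneg q), mul_left_comm]
  refine mul_le_mul_of_nonneg_left ?_ (sq_nonneg q)
  rw [abs_le, one_div, inv_mul_eq_div, ← neg_div, div_le_iff₀ hK', le_div_iff₀ hK']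
  constructor <;> nlinarith

end JCov

namespace JCov

open Finset
open Computability (Γ')
open PolyTime

/-! ### The median instance of a Johnson Coverage instance -/

namespace JohnsonInstance

/-- The sets, as lists of reversed strings, in the order produced by the parser. -/
def parsed (I : JohnsonInstance) : List (List (List Γ')) :=
  (I.sets.map fun T => (T.map fun i => (encNat i).reverse).reverse).reverse

/-- The base-`4` logarithm of the dimension. -/
def exponent (e : ℕ) (I : JohnsonInstance) : ℕ := dimExp e I.parsed.flatten.length

/-- The codeword of an element. -/
def codeword (e K : ℕ) (I : JohnsonInstance) (i : ℕ) : List Bool :=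
  lookup (dictOf e K I.parsed) (encNat i).reverse

/-- The point of a set: the sum of the scaled sign vectors of its elements. -/
def point (e K z u t : ℕ) (I : JohnsonInstance) (F : Finset ℕ) : Fin (4 ^ I.exponent e) → ℚ :=
  fun p => (2 * (#{i ∈ F | (I.codeword e K i).getD p false} : ℚ) - z) *
    (u / 2 ^ (t + I.exponent e))

/-- The median instance. -/
def toMedian (e K z u t : ℕ) (I : JohnsonInstance) : MedianInstance where
  d := 4 ^ I.exponent e
  k := I.k
  points := (I.sets.map fun T => I.point e K z u t T.toFinset).reverse

/-- The scaled sign vector of an element. -/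
noncomputable def vec (e K u t : ℕ) (I : JohnsonInstance) (i : ℕ) :
    EuclideanSpace ℝ (Fin (4 ^ I.exponent e)) :=
  wordVec (4 ^ I.exponent e) (u / 2 ^ (t + I.exponent e)) (I.codeword e K i)

variable {e K z u t : ℕ} {I : JohnsonInstance}

theorem IsValid.nodup (hI : I.IsValid z) {T : List ℕ} (hT : T ∈ I.sets) : T.Nodup :=
  (hI.2.2.2 T hT).1.imp (fun h => h.ne)

theorem IsValid.injOn_toFinset (hI : I.IsValid z) :
    ∀ T ∈ I.sets, ∀ T' ∈ I.sets, T.toFinset = T'.toFinset → T = T' := by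
  have : ∀ T ∈ I.sets, T.toFinset.sort (· ≤ ·) = T := fun T hT =>
    (List.toFinset_sort (· ≤ ·) (hI.nodup hT)).mpr ((hI.2.2.2 T hT).1.imp (fun h => h.le))
  intro T hT T' hT' h
  rw [← this T hT, h, this T' hT']

theorem mem_E {F : Finset ℕ} : F ∈ I.E ↔ ∃ T ∈ I.sets, T.toFinset = F := by
  simp [E]

theorem IsValid.card_of_mem_E (hI : I.IsValid z) {F : Finset ℕ} (hF : F ∈ I.E) : #F = z := by
  obtain ⟨T, hT, rfl⟩ := mem_E.mp hF
  rw [List.toFinset_card_of_nodup (hI.nodup hT), (hI.2.2.2 T hT).2.1]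

theorem IsValid.subset_of_mem_E (hI : I.IsValid z) {F : Finset ℕ} (hF : F ∈ I.E) :
    F ⊆ Icc 1 I.n := by
  obtain ⟨T, hT, rfl⟩ := mem_E.mp hF
  intro i hi
  exact mem_Icc.mpr ((hI.2.2.2 T hT).2.2 i (List.mem_toFinset.mp hi))

theorem IsValid.card_E (hI : I.IsValid z) : #I.E = I.sets.length := by
  rw [E, List.toFinset_card_of_nodup, List.length_map]
  exact List.Nodup.map_on (fun T hT T' hT' => hI.injOn_toFinset T hT T' hT') hI.2.2.1

theorem IsValid.length_flatten_parsed (hI : I.IsValid z) :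
    I.parsed.flatten.length = z * I.sets.length := by
  rw [List.length_flatten, parsed, List.map_reverse, List.sum_reverse, List.map_map,
    List.map_congr_left (g := fun _ => z), List.map_const', List.sum_replicate, smul_eq_mul, mul_comm]
  intro T hT
  simp [(hI.2.2.2 T hT).2.1]

theorem reverse_encNat_mem_parsed {T : List ℕ} (hT : T ∈ I.sets) {i : ℕ} (hi : i ∈ T) :
    (encNat i).reverse ∈ I.parsed.flatten := by
  rw [List.mem_flatten]
  refine ⟨(T.map fun i => (encNat i).reverse).reverse, ?_, ?_⟩
  · rw [parsed, List.mem_reverse]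
    exact List.mem_map_of_mem hT
  · rw [List.mem_reverse]
    exact List.mem_map_of_mem hi

theorem reverse_encNat_mem_of_mem_E {F : Finset ℕ} (hF : F ∈ I.E) {i : ℕ} (hi : i ∈ F) :
    (encNat i).reverse ∈ I.parsed.flatten := by
  obtain ⟨T, hT, rfl⟩ := mem_E.mp hF
  exact reverse_encNat_mem_parsed hT (List.mem_toFinset.mp hi)

/-- The link between the two sides: the string program outputs the code of the median instance
analysed geometrically. Its points are listed in reverse because the parser reverses the sets. -/
theorem IsValid.enc_toMedian (hI : I.IsValid z) (hK : 2 ≤ K) (he : 4 * K ^ 2 ≤ 4 ^ e) (hu : Odd u)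
    (hz : z < 2 ^ t) :
    (I.toMedian e K z u t).enc = medianString e K (coordTable z u t) I.enc := by
  have h₁ : parseSets (afterComma (afterComma I.enc)) = I.parsed := by
    rw [I.enc_eq, afterComma_append (comma_notMem_encNat _),
      afterComma_append (comma_notMem_encNat _), parseSets_encList, parsed]
  have h₂ : (afterComma I.enc).takeWhile notComma = encNat I.k := by
    rw [I.enc_eq, afterComma_append (comma_notMem_encNat _),
      takeWhile_notComma (comma_notMem_encNat _)]
  have h₃ : encNat (4 ^ I.exponent e) =
      List.replicate (2 * I.exponent e) (Γ'.bit false) ++ [Γ'.bit true] := by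
    rw [← encNat_two_pow, pow_mul]
    norm_num
  have h₄ : encList (encList encRat) ((I.toMedian e K z u t).points.map List.ofFn) =
      pointsString e K (coordTable z u t) I.parsed := by
    have key : ∀ T ∈ I.sets, encList encRat (List.ofFn (I.point e K z u t T.toFinset)) =
        pointString (coordTable z u t) (I.exponent e) (counts (dictOf e K I.parsed)
          (4 ^ I.exponent e) (T.map fun i => (encNat i).reverse).reverse) := by
      intro T hT
      rw [counts_eq, encList, pointString]
      · have : List.ofFn (I.point e K z u t T.toFinset) = (List.ofFn fun p : Fin (4 ^ I.exponent e) =>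
            (T.map fun i => (encNat i).reverse).reverse.countP fun key =>
              (lookup (dictOf e K I.parsed) key).getD p false).map
                fun c : ℕ => (2 * (c : ℚ) - z) * (u / 2 ^ (t + I.exponent e)) := by
          rw [List.map_ofFn]
          congr 1
          funext p
          rw [point, Function.comp, List.countP_reverse, List.countP_map]
          congr 4
          have : ({i ∈ T.toFinset | (I.codeword e K i).getD p false = true} : Finset ℕ) =
              (T.filter fun i => (I.codeword e K i).getD p false).toFinset := by
            ext i
            simp
          rw [this, List.toFinset_card_of_nodup ((hI.nodup hT).filter _), List.countP_eq_length_filter]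
          rfl
        rw [this, List.flatMap_map]
        congr 2
        refine List.flatMap_congr fun c hc => ?_
        rw [encRat_coord hu hz]
        obtain ⟨p, rfl⟩ := (List.mem_ofFn' _ _).mp hc
        refine List.countP_le_length.trans ?_
        rw [List.length_reverse, List.length_map, (hI.2.2.2 T hT).2.1]
      · intro key hkey
        rw [List.mem_reverse, List.mem_map] at hkey
        obtain ⟨i, hi, rfl⟩ := hkey
        exact length_lookup hK he (reverse_encNat_mem_parsed hT hi)
    have hp : ∀ g : List (List Γ') → List Γ', I.parsed.flatMap g =
        I.sets.reverse.flatMap fun T => g (T.map fun i => (encNat i).reverse).reverse := by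
      intro g
      rw [parsed, ← List.map_reverse, List.flatMap_map]
    rw [encList, pointsString, hp, toMedian, List.map_reverse, List.map_map, ← List.map_reverse,
      List.flatMap_map]
    congr 2
    refine List.flatMap_congr fun T hT => ?_
    rw [Function.comp, key T (List.mem_reverse.mp hT)]
    rfl
  rw [MedianInstance.enc, h₄, medianString, h₁, h₂]
  change encNat (4 ^ I.exponent e) ++ Γ'.comma :: encNat I.k ++ _ = _
  rw [h₃]
  simp [exponent]

/-- The dimension is `4 ^ s'` with `s'` the exponent, and the entries are `± u / 2 ^ (t + s')`, so
the squared length is `(u / 2 ^ t) ^ 2` whatever the instance. -/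
theorem IsValid.nearlyOrthogonal (hK : 2 ≤ K) (he : 4 * K ^ 2 ≤ 4 ^ e) :
    NearlyOrthogonal (I.vec e K u t) (I.E.biUnion id) (((u : ℝ) / 2 ^ t) ^ 2) (1 / K) := by
  have hlen : ∀ i ∈ I.E.biUnion id, (I.codeword e K i).length = 4 ^ I.exponent e := by
    intro i hi
    obtain ⟨F, hF, hiF⟩ := mem_biUnion.mp hi
    exact length_lookup hK he (reverse_encNat_mem_of_mem_E hF hiF)
  have hq : ((u : ℝ) / 2 ^ (t + I.exponent e)) ^ 2 * ((4 ^ I.exponent e : ℕ) : ℝ) =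
      (u / 2 ^ t) ^ 2 := by
    have : ((4 ^ I.exponent e : ℕ) : ℝ) = (2 ^ I.exponent e) ^ 2 := by
      push_cast
      rw [← pow_mul, mul_comm, pow_mul]
      norm_num
    rw [this, pow_add]
    field_simp
  constructor
  · intro i hi
    rw [vec, inner_wordVec _ (hlen i hi) (hlen i hi), differ_self, ← hq]
    simp
  · intro i hi j hj hij
    rw [vec, vec, ← hq]
    refine abs_inner_wordVec_le (by omega) _ (hlen i hi) (hlen j hj) ?_
    obtain ⟨F, hF, hiF⟩ := mem_biUnion.mp hi
    obtain ⟨F', hF', hjF'⟩ := mem_biUnion.mp hj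
    have h₁ := reverse_encNat_mem_of_mem_E hF hiF
    have h₂ := reverse_encNat_mem_of_mem_E hF' hjF'
    refine nearOrth_or_of_mem_greedy (lookup_mem_greedy hK he h₁) (lookup_mem_greedy hK he h₂) ?_
    refine lookup_ne hK he h₁ h₂ fun h => hij (encNat_injective (List.reverse_injective h))

/-- If `c` of the `z` words have `true` in a given place, the entries there add up to `c - (z - c) =
2 * c - z` times the scale. -/
theorem toEuclidean_point {F : Finset ℕ} (hF : #F = z) :
    toEuclidean (I.point e K z u t F) = ∑ i ∈ F, I.vec e K u t i := by
  ext p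
  rw [WithLp.ofLp_sum, Finset.sum_apply]
  simp only [vec, wordVec, toEuclidean, point]
  rw [sum_ite, sum_const, sum_const, ← hF]
  have h := card_filter_add_card_filter_not (s := F) fun i => (I.codeword e K i).getD p false = true
  have h' : (#{i ∈ F | ¬(I.codeword e K i).getD p false = true} : ℝ) =
    #F - #{i ∈ F | (I.codeword e K i).getD p false = true} := by
    rw [← h]; push_cast; ring
  rw [nsmul_eq_mul, nsmul_eq_mul, h']
  push_cast
  ring

/-- Distinct `z`-sets have points at squared distance at least `r * (2 - 4 * z ^ 2 / K)`, which is
positive. So the number of points is `#E`, and an assignment of points is an assignment of sets. -/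
theorem IsValid.injOn_point (hI : I.IsValid z) (hK : 2 ≤ K) (he : 4 * K ^ 2 ≤ 4 ^ e) (hu : Odd u)
    (hKz : 2 * z ^ 2 < K) : Set.InjOn (I.point e K z u t) I.E := by
  intro F hF F' hF' h
  by_contra hne
  have hu0 : 0 < u := hu.pos
  have hc := hI.card_of_mem_E hF
  have hc' := hI.card_of_mem_E hF'
  have h₁ := (IsValid.nearlyOrthogonal (I := I) (u := u) (t := t) hK he).le_norm_sub_sq
    (by positivity) (by positivity)
    (subset_biUnion_of_mem id hF) (subset_biUnion_of_mem id hF') (hc.trans hc'.symm) hne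
  simp only [id] at h₁
  rw [← toEuclidean_point hc, ← toEuclidean_point hc', h, sub_self, norm_zero, hc] at h₁
  have hr : (0 : ℝ) < ((u : ℝ) / 2 ^ t) ^ 2 := by positivity
  have hK' : (0 : ℝ) < K := by positivity
  have hKz' : 2 * (z : ℝ) ^ 2 < K := by exact_mod_cast hKz
  have : (1 / K : ℝ) * (2 * z) ^ 2 < 2 := by
    rw [one_div, inv_mul_lt_iff₀ hK']
    linarith
  nlinarith

theorem IsValid.nodup_points (hI : I.IsValid z) (hK : 2 ≤ K) (he : 4 * K ^ 2 ≤ 4 ^ e) (hu : Odd u)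
    (hKz : 2 * z ^ 2 < K) : (I.toMedian e K z u t).points.Nodup := by
  rw [toMedian, List.nodup_reverse]
  refine List.Nodup.map_on (fun T hT T' hT' h => hI.injOn_toFinset T hT T' hT' ?_) hI.2.2.1
  exact hI.injOn_point hK he hu hKz (mem_E.mpr ⟨T, hT, rfl⟩) (mem_E.mpr ⟨T', hT', rfl⟩) h

theorem P_toMedian :
    (I.toMedian e K z u t).P = I.E.image (I.point e K z u t) := by
  have h : ∀ a, a ∈ (I.sets.map fun T => I.point e K z u t T.toFinset).reverse.toFinset ↔
      a ∈ I.E.image (I.point e K z u t) := by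
    intro a
    rw [List.mem_toFinset, mem_image]
    simp only [List.mem_reverse, List.mem_map, mem_E]
    constructor
    · rintro ⟨T, hT, rfl⟩
      exact ⟨_, ⟨T, hT, rfl⟩, rfl⟩
    · rintro ⟨_, ⟨T, hT, rfl⟩, rfl⟩
      exact ⟨T, hT, rfl⟩
  exact Finset.ext h

theorem IsValid.card_P (hI : I.IsValid z) (hK : 2 ≤ K) (he : 4 * K ^ 2 ≤ 4 ^ e) (hu : Odd u)
    (hKz : 2 * z ^ 2 < K) : #(I.toMedian e K z u t).P = #I.E :=
  (congrArg card P_toMedian).trans (card_image_of_injOn (hI.injOn_point hK he hu hKz))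

theorem IsValid.medianCost_eq (hI : I.IsValid z) (hK : 2 ≤ K) (he : 4 * K ^ 2 ≤ 4 ^ e) (hu : Odd u)
    (hKz : 2 * z ^ 2 < K) {k : ℕ} (c : Fin k → EuclideanSpace ℝ (Fin (4 ^ I.exponent e)))
    (σ : (Fin (4 ^ I.exponent e) → ℚ) → Fin k) :
    medianCost (d := 4 ^ I.exponent e) (I.toMedian e K z u t).P c σ =
      ∑ F ∈ I.E, ‖∑ i ∈ F, I.vec e K u t i - c (σ (I.point e K z u t F))‖ := by
  refine (Finset.sum_congr P_toMedian fun _ _ => rfl).trans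
    ((sum_image (hI.injOn_point hK he hu hKz)).trans ?_)
  refine sum_congr rfl fun F hF => ?_
  rw [toEuclidean_point (hI.card_of_mem_E hF)]

end JohnsonInstance

/-- The constant in the bound on the dimension. -/
noncomputable def dimConst (e z : ℕ) : ℝ := 4 ^ e * 4 * (z / Real.log 2 + 1) / Real.log 2

theorem inv_log_two_le_dimConst (e z : ℕ) : 1 / Real.log 2 ≤ dimConst e z := by
  have h : 0 < Real.log 2 := Real.log_pos one_lt_two
  refine div_le_div_of_nonneg_right ?_ h.le
  have h₁ : (1 : ℝ) ≤ 4 ^ e := one_le_pow₀ (by norm_num)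
  have h₂ : 0 ≤ (z : ℝ) / Real.log 2 := by positivity
  nlinarith

/-- Minimality of the exponent gives `2 ^ 4 ^ (s - 1) < z * #E` when `s` is positive; take
logarithms. Two sets are required so that `log #E` is bounded away from 0 and absorbs the additive
constants. -/
theorem JohnsonInstance.IsValid.pow_exponent_le {I : JohnsonInstance} {e z : ℕ} (hI : I.IsValid z)
    (hE : 2 ≤ #I.E) (hz : 0 < z) :
    ((4 ^ I.exponent e : ℕ) : ℝ) ≤ dimConst e z * Real.log #I.E := by
  have h : 0 < Real.log 2 := Real.log_pos one_lt_two
  have hE' : (2 : ℝ) ≤ #I.E := by exact_mod_cast hE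
  have hlog : Real.log 2 ≤ Real.log #I.E := Real.log_le_log (by norm_num) hE'
  obtain ⟨s, hs, -, hs'⟩ := dimExp_spec e (z * I.sets.length)
  rw [JohnsonInstance.exponent, hI.length_flatten_parsed, hs]
  rw [← hI.card_E] at hs'
  push_cast
  rcases hs' with rfl | hs'
  · have h₁ := inv_log_two_le_dimConst 0 z
    have h₂ : dimConst e z = 4 ^ e * dimConst 0 z := by simp [dimConst]; ring
    rw [h₂, add_zero, mul_assoc]
    refine le_mul_of_one_le_right (by positivity) ?_
    calc (1 : ℝ) = 1 / Real.log 2 * Real.log 2 := by field_simp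
      _ ≤ dimConst 0 z * Real.log #I.E :=
        mul_le_mul h₁ hlog h.le ((one_div_nonneg.mpr h.le).trans h₁)
  · rcases s with _ | s
    · have h₁ := inv_log_two_le_dimConst 0 z
      have h₂ : dimConst e z = 4 ^ e * dimConst 0 z := by simp [dimConst]; ring
      rw [h₂, add_zero, mul_assoc]
      refine le_mul_of_one_le_right (by positivity) ?_
      calc (1 : ℝ) = 1 / Real.log 2 * Real.log 2 := by field_simp
        _ ≤ dimConst 0 z * Real.log #I.E :=
          mul_le_mul h₁ hlog h.le ((one_div_nonneg.mpr h.le).trans h₁)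
    · rw [Nat.add_sub_cancel] at hs'
      have hz' : (0 : ℝ) < z := by exact_mod_cast hz
      have h₁ : (4 : ℝ) ^ s * Real.log 2 ≤ Real.log z + Real.log #I.E := by
        rw [← Real.log_mul hz'.ne' (by positivity)]
        have : Real.log ((2 : ℝ) ^ 4 ^ s) ≤ Real.log (z * #I.E) :=
          Real.log_le_log (by positivity) (by exact_mod_cast hs'.le)
        rw [Real.log_pow] at this
        exact_mod_cast this
      have h₂ : Real.log z ≤ z / Real.log 2 * Real.log #I.E := by
        refine (Real.log_le_self hz'.le).trans ?_
        rw [div_mul_eq_mul_div, le_div_iff₀ h]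
        exact mul_le_mul_of_nonneg_left hlog hz'.le
      have h₃ : (4 : ℝ) ^ s ≤ (z / Real.log 2 + 1) * Real.log #I.E / Real.log 2 := by
        rw [le_div_iff₀ h]
        linarith
      calc (4 : ℝ) ^ (e + (s + 1)) = 4 ^ e * 4 * 4 ^ s := by ring
        _ ≤ 4 ^ e * 4 * ((z / Real.log 2 + 1) * Real.log #I.E / Real.log 2) :=
          mul_le_mul_of_nonneg_left h₃ (by positivity)
        _ = _ := by rw [dimConst]; ring

end JCov

namespace JCov

open Finset
open Computability (Γ')
open PolyTime

/-! ### The parameters of the reduction -/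

theorem exists_odd_div_two_pow {x η : ℝ} (hx : 0 < x) (hη : 0 < η) (z : ℕ) :
    ∃ u t : ℕ, Odd u ∧ z < 2 ^ t ∧ x - η < (u : ℝ) / 2 ^ t ∧ (u : ℝ) / 2 ^ t < x := by
  obtain ⟨N, hN⟩ := exists_nat_ge (z + 1 + 4 / η + 4 / x)
  have hN' : (N : ℝ) < 2 ^ N := by exact_mod_cast Nat.lt_two_pow_self
  have hη' : 0 < 4 / η := by positivity
  have hx' : 0 < 4 / x := by positivity
  have hz0 : (0 : ℝ) ≤ z := Nat.cast_nonneg z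
  have h2 : (0 : ℝ) < 2 ^ N := by positivity
  have h₁ : 4 < x * 2 ^ N := by
    rw [mul_comm, ← div_lt_iff₀ hx]
    linarith
  have h₂ : 4 < η * 2 ^ N := by
    rw [mul_comm, ← div_lt_iff₀ hη]
    linarith
  -- The numerator `2 * b + 1 = 2 * a - 3` is odd and lies between `x * 2 ^ N - 3` and `x * 2 ^ N -
  -- 1`.
  set a := ⌈x * 2 ^ N / 2⌉₊ with ha
  have ha₁ : x * 2 ^ N / 2 ≤ a := Nat.le_ceil _
  have ha₂ : (a : ℝ) < x * 2 ^ N / 2 + 1 := Nat.ceil_lt_add_one (by positivity)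
  have ha3 : 2 < a := by
    have : (2 : ℝ) < a := by linarith
    exact_mod_cast this
  obtain ⟨b, hb⟩ := Nat.exists_eq_add_of_le' (show 2 ≤ a by omega)
  have hb' : (a : ℝ) = b + 2 := by exact_mod_cast hb
  refine ⟨2 * b + 1, N, odd_two_mul_add_one b, ?_, ?_, ?_⟩
  · have : (z : ℝ) < 2 ^ N := by linarith
    exact_mod_cast this
  · rw [lt_div_iff₀ h2]
    push_cast
    linarith
  · rw [div_lt_iff₀ h2]
    push_cast
    linarith

/-- The parameters of the reduction: `u / 2 ^ t` is the length of the vectors, `1 / K` bounds their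
inner products, `4 ^ e` is the least dimension, and `κ`, `m` are the tolerances in the analysis. -/
structure Params (α β : ℝ) (z y : ℕ) where
  u : ℕ
  t : ℕ
  K : ℕ
  e : ℕ
  m : ℕ
  κ : ℝ
  odd_u : Odd u
  lt_pow : z < 2 ^ t
  two_le_K : 2 ≤ K
  lt_K : 2 * z ^ 2 < K
  le_pow : 4 * K ^ 2 ≤ 4 ^ e
  m_pos : 0 < m
  κ_pos : 0 < κ
  m_le_K : m ≤ K
  z_le_K : z ≤ K
  div_K_le : 8 * (z : ℝ) ^ 2 ≤ κ * K
  sq_mul_le : ((u : ℝ) / 2 ^ t) ^ 2 * ((z : ℝ) - y) ≤ 1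
  sq_mul_le_one : ((u : ℝ) / 2 ^ t) ^ 2 * (((z : ℝ) - y) + 1 / K * ((z : ℝ) - y) ^ 2) ≤ 1
  lt_m : (2 * (z : ℝ) + 4) ^ 2 * (2 * ((u : ℝ) / 2 ^ t) ^ 2) <
    (κ * ((u : ℝ) / 2 ^ t) ^ 2 / (8 * z)) ^ 2 * m
  le_factor : β ≤ α * √(((u : ℝ) / 2 ^ t) ^ 2 * ((z : ℝ) - y - κ)) +
    (1 - α) * √(((u : ℝ) / 2 ^ t) ^ 2 * ((z : ℝ) - y + 1 / 2 - κ)) -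
      κ * √(((u : ℝ) / 2 ^ t) ^ 2 * ((z : ℝ) - y + 1 / 2 - κ))

/-- At length `1 / √(z - y)` and tolerance `0` the guaranteed factor is exactly the right-hand side
of `hβ`. By continuity it still exceeds `β` for a slightly shorter dyadic length `q` and some `κ >
0`; the shortening leaves room for the inner products in the completeness bound. Then `m` is chosen
for the threshold `τ = κ * q ^ 2 / (8 * z)`, after that `K`, and last `e`. -/
theorem nonempty_params {α β : ℝ} {z y : ℕ} (hyz : y < z)
    (hβ : β < α + (1 - α) * √(((z : ℝ) - y + 1 / 2) / (z - y))) : Nonempty (Params α β z y) := by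
  have hz : (0 : ℝ) < z := by exact_mod_cast (by omega : 0 < z)
  set w : ℝ := (z : ℝ) - y with hw
  have hw1 : 1 ≤ w := by
    have : (y : ℝ) + 1 ≤ z := by exact_mod_cast hyz
    linarith
  have hw0 : 0 < w := by linarith
  set g : ℝ × ℝ → ℝ := fun p => α * √(p.1 ^ 2 * (w - p.2)) + (1 - α) * √(p.1 ^ 2 * (w + 1 / 2 - p.2)) -
    p.2 * √(p.1 ^ 2 * (w + 1 / 2 - p.2)) with hg
  have hcont : Continuous g := by fun_prop
  have hx0 : 0 < 1 / √w := by positivity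
  have hxw : (1 / √w) ^ 2 = 1 / w := by rw [div_pow, Real.sq_sqrt hw0.le, one_pow]
  have hval : β < g (1 / √w, 0) := by
    simp only [hg, hxw, sub_zero, zero_mul]
    rw [one_div_mul_cancel hw0.ne', Real.sqrt_one, mul_one, one_div_mul_eq_div]
    exact hβ
  obtain ⟨η, hη, hη'⟩ := Metric.eventually_nhds_iff.mp
    (hcont.continuousAt.eventually (lt_mem_nhds hval))
  obtain ⟨u, t, hu, ht, h₁, h₂⟩ := exists_odd_div_two_pow hx0 hη z
  have hu0 : (0 : ℝ) < u := by exact_mod_cast hu.pos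
  set q : ℝ := (u : ℝ) / 2 ^ t with hq
  have hq0 : 0 < q := by positivity
  have hqw : q ^ 2 * w < 1 := by
    have : q ^ 2 < 1 / w := by
      rw [← hxw]
      exact pow_lt_pow_left₀ h₂ hq0.le two_ne_zero
    rwa [lt_div_iff₀ hw0] at this
  set κ : ℝ := η / 2 with hκ
  have hκ0 : 0 < κ := by positivity
  have hfac : β < g (q, κ) := by
    refine hη' ?_
    rw [Prod.dist_eq, max_lt_iff, Real.dist_eq, Real.dist_eq, abs_lt, abs_lt]
    refine ⟨⟨by linarith, by linarith⟩, by linarith, by linarith⟩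
  obtain ⟨m, hm⟩ := exists_nat_gt
    ((2 * (z : ℝ) + 4) ^ 2 * (2 * q ^ 2) / (κ * q ^ 2 / (8 * z)) ^ 2)
  have hτ : 0 < (κ * q ^ 2 / (8 * z)) ^ 2 := by positivity
  have hm0 : 0 < m := by
    have : (0 : ℝ) < m := lt_of_le_of_lt (by positivity) hm
    exact_mod_cast this
  rw [div_lt_iff₀' hτ] at hm
  obtain ⟨K, hK⟩ := exists_nat_ge
    (8 * z ^ 2 / κ + q ^ 2 * w ^ 2 / (1 - q ^ 2 * w) + (2 + 2 * (z : ℝ) ^ 2 + 1 + m + z))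
  have hd : 0 < 1 - q ^ 2 * w := by linarith
  have hK₁ : 0 ≤ 8 * z ^ 2 / κ := by positivity
  have hK₂ : 0 ≤ q ^ 2 * w ^ 2 / (1 - q ^ 2 * w) := by positivity
  have hKn : 2 + 2 * z ^ 2 + 1 + m + z ≤ K := by
    have : (2 + 2 * (z : ℝ) ^ 2 + 1 + m + z) ≤ K := by linarith
    exact_mod_cast this
  have hK0 : (0 : ℝ) < K := by exact_mod_cast (by omega : 0 < K)
  have hz2 : 0 ≤ (z : ℝ) ^ 2 := by positivity
  refine ⟨⟨u, t, K, 4 * K ^ 2, m, κ, hu, ht, by omega, by omega,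
    (Nat.lt_pow_self (by norm_num)).le, hm0, hκ0, by omega, by omega, ?_, hqw.le, ?_, hm, hfac.le⟩⟩
  · rw [← div_le_iff₀' hκ0]
    have : (0 : ℝ) ≤ m := Nat.cast_nonneg m
    linarith
  · have h₃ : q ^ 2 * w ^ 2 / (1 - q ^ 2 * w) ≤ K := by
      have : (0 : ℝ) ≤ m := Nat.cast_nonneg m
      linarith
    rw [div_le_iff₀ hd, ← div_le_iff₀' hK0] at h₃
    calc _ = q ^ 2 * w + q ^ 2 * w ^ 2 / K := by ring
      _ ≤ 1 := by linarith

/-! ### Completeness and soundness -/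

namespace Params

variable {α β : ℝ} {z y : ℕ} (p : Params α β z y) {I : JohnsonInstance}

theorem isValid_toMedian (hI : I.IsValid z) (hz : 0 < z) (hE : 2 ≤ #I.E) :
    (I.toMedian p.e p.K z p.u p.t).IsValid (dimConst p.e z) := by
  refine ⟨hI.1, ?_, hI.nodup_points p.two_le_K p.le_pow p.odd_u p.lt_K, ?_⟩
  · rw [JohnsonInstance.toMedian, Ne, List.reverse_eq_nil_iff, List.map_eq_nil_iff]
    exact hI.2.1
  · rw [hI.card_P p.two_le_K p.le_pow p.odd_u p.lt_K]
    exact hI.pow_exponent_le hE hz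

theorem toMedian_mem_medianYes (hyz : y < z) (hI : I ∈ johnsonYes z y) (hE : 2 ≤ #I.E) :
    I.toMedian p.e p.K z p.u p.t ∈ medianYes (dimConst p.e z) := by
  obtain ⟨hI, S, hS, hcov⟩ := hI
  refine ⟨p.isValid_toMedian hI (by omega) hE, ?_⟩
  rw [hI.card_P p.two_le_K p.le_pow p.odd_u p.lt_K]
  have hex : ∀ F ∈ I.E, ∃ j, S j ⊆ F := by
    intro F hF
    rw [← hcov, covFamily, mem_biUnion] at hF
    obtain ⟨j, -, hj⟩ := hF
    exact ⟨j, (mem_filter.mp hj).2⟩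
  have hinj := hI.injOn_point (t := p.t) p.two_le_K p.le_pow p.odd_u p.lt_K
  -- An assignment is a function of points, not of sets; injectivity of `point` lets each point
  -- inherit the choice made for its set.
  have hσ : ∃ σ : (Fin (4 ^ I.exponent p.e) → ℚ) → Fin I.k,
      ∀ F ∈ I.E, S (σ (I.point p.e p.K z p.u p.t F)) ⊆ F := by
    have : ∀ a : Fin (4 ^ I.exponent p.e) → ℚ, ∃ j : Fin I.k,
        ∀ F ∈ I.E, I.point p.e p.K z p.u p.t F = a → S j ⊆ F := by
      intro a
      by_cases ha : ∃ F ∈ I.E, I.point p.e p.K z p.u p.t F = a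
      · obtain ⟨F, hF, hFa⟩ := ha
        obtain ⟨j, hj⟩ := hex F hF
        refine ⟨j, fun F' hF' h => ?_⟩
        rwa [hinj hF' hF (h.trans hFa.symm)]
      · exact ⟨⟨0, hI.1⟩, fun F hF h => absurd ⟨F, hF, h⟩ ha⟩
    choose σ hσ using this
    exact ⟨σ, fun F hF => hσ _ F hF rfl⟩
  obtain ⟨σ, hσ⟩ := hσ
  refine ⟨fun j => ∑ i ∈ S j, I.vec p.e p.K p.u p.t i, σ, ?_⟩
  refine (hI.medianCost_eq p.two_le_K p.le_pow p.odd_u p.lt_K _ σ).trans_le ?_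
  have key : ∀ F ∈ I.E, ‖∑ i ∈ F, I.vec p.e p.K p.u p.t i -
      ∑ i ∈ S (σ (I.point p.e p.K z p.u p.t F)), I.vec p.e p.K p.u p.t i‖ ≤ 1 := by
    intro F hF
    have h := (JohnsonInstance.IsValid.nearlyOrthogonal (I := I) (u := p.u) (t := p.t)
      p.two_le_K p.le_pow).norm_sub_sq_le (by positivity) (by positivity)
      (subset_biUnion_of_mem id hF) (hσ F hF) (hI.card_of_mem_E hF) (mem_powersetCard.mp (hS _)).2
    refine (sq_le_one_iff₀ (norm_nonneg _)).mp (h.trans ?_)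
    exact p.sq_mul_le_one
  refine (sum_le_sum key).trans (le_of_eq ?_)
  simp

/-- The hypothesis `hd`, a consequence of density, charges the exceptional sets to the summand with
`κ` that `le_factor` holds in reserve. -/
theorem toMedian_mem_medianNo (hyz : y < z) (hI : I ∈ johnsonNo α z y) (hE : 2 ≤ #I.E)
    (hd : 2 ^ p.m * (I.k * (I.n : ℝ) ^ (z - y - 1)) ≤ p.κ * #I.E) :
    I.toMedian p.e p.K z p.u p.t ∈ medianNo (dimConst p.e z) β := by
  obtain ⟨hI, hcov⟩ := hI
  refine ⟨p.isValid_toMedian hI (by omega) hE, fun c σ => ?_⟩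
  rw [hI.card_P p.two_le_K p.le_pow p.odd_u p.lt_K]
  refine le_of_le_of_eq ?_ (hI.medianCost_eq p.two_le_K p.le_pow p.odd_u p.lt_K c σ).symm
  have hU : I.E.biUnion id ⊆ Icc 1 I.n := biUnion_subset.mpr fun F hF => hI.subset_of_mem_E hF
  have hyn : y ≤ I.n := by
    obtain ⟨F, hF⟩ := card_pos.mp (by omega : 0 < #I.E)
    have := card_le_card (hI.subset_of_mem_E hF)
    rw [hI.card_of_mem_E hF, Nat.card_Icc] at this
    omega
  have hz : (0 : ℝ) < z := by exact_mod_cast (by omega : 0 < z)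
  have hw1 : (1 : ℝ) ≤ (z : ℝ) - y := by
    have : (y : ℝ) + 1 ≤ z := by exact_mod_cast hyz
    linarith
  have hu0 : (0 : ℝ) < p.u := by exact_mod_cast p.odd_u.pos
  have hK0 : (0 : ℝ) < p.K := by exact_mod_cast (by have := p.two_le_K; omega : 0 < p.K)
  set r : ℝ := ((p.u : ℝ) / 2 ^ p.t) ^ 2 with hr
  have hr0 : 0 < r := by positivity
  have hrw := p.sq_mul_le
  rw [← hr] at hrw
  have hr1 : r ≤ 1 := by nlinarith
  have hδ : 1 / (p.K : ℝ) * z ^ 2 ≤ p.κ / 8 := by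
    rw [one_div, inv_mul_le_iff₀ hK0]
    linarith [p.div_K_le]
  have hκ := p.κ_pos
  have key := (JohnsonInstance.IsValid.nearlyOrthogonal (I := I) (u := p.u) (t := p.t)
    p.two_le_K p.le_pow).le_sum_dist (α := α) (κ := p.κ) (τ := p.κ * r / (8 * z)) (m := p.m)
    (E := I.E) (k := I.k) (by positivity) hr0 hr1 hU hyn hyz (by nlinarith) hκ.le (by positivity)
    (by
      have : 2 * (z * (p.κ * r / (8 * z))) = p.κ * r / 4 := by field_simp; ring
      rw [this]
      nlinarith)
    (by linarith)
    (by
      rw [one_div, inv_mul_le_iff₀ hK0, mul_one]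
      exact_mod_cast p.z_le_K)
    p.m_pos
    (by
      rw [one_div, inv_mul_le_iff₀ hK0, mul_one]
      exact_mod_cast p.m_le_K)
    p.lt_m (fun F hF => ⟨subset_biUnion_of_mem id hF, hI.card_of_mem_E hF⟩) hcov c
    (fun F => σ (I.point p.e p.K z p.u p.t F))
  refine le_trans ?_ key
  have h₁ := mul_le_mul_of_nonneg_right p.le_factor (Nat.cast_nonneg (α := ℝ) #I.E)
  refine h₁.trans ?_
  rw [sub_mul]
  refine sub_le_sub_left ?_ _
  exact (mul_le_mul_of_nonneg_left hd (Real.sqrt_nonneg _)).trans_eq (by ring)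

end Params

end JCov

namespace JCov

open Finset
open Computability (Γ')
open PolyTime

/-! ### Small instances -/

/-- The points `0` and `b` of the line, with one center. -/
def pairInstance (b : ℕ) : MedianInstance where
  d := 1
  k := 1
  points := [fun _ => 0, fun _ => b]

theorem nodup_points_pairInstance {b : ℕ} (hb : 0 < b) : (pairInstance b).points.Nodup := by
  have h : (fun _ : Fin 1 => (0 : ℚ)) ≠ fun _ => (b : ℚ) := fun h => by
    have h' : (0 : ℚ) = b := congrFun h 0
    exact hb.ne' (by exact_mod_cast h'.symm)
  exact List.nodup_cons.mpr ⟨fun h' => h (List.mem_singleton.mp h'), List.nodup_singleton _⟩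

theorem card_P_pairInstance {b : ℕ} (hb : 0 < b) : #(pairInstance b).P = 2 :=
  List.toFinset_card_of_nodup (nodup_points_pairInstance hb)

theorem isValid_pairInstance {b : ℕ} (hb : 0 < b) {C : ℝ} (hC : 1 / Real.log 2 ≤ C) :
    (pairInstance b).IsValid C := by
  refine ⟨Nat.one_pos, by simp [pairInstance], nodup_points_pairInstance hb, ?_⟩
  rw [card_P_pairInstance hb]
  rw [div_le_iff₀ (Real.log_pos one_lt_two)] at hC
  simpa [pairInstance] using hC

theorem medianCost_pairInstance {b : ℕ} (hb : 0 < b)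
    (c : Fin 1 → EuclideanSpace ℝ (Fin 1)) (σ : (Fin 1 → ℚ) → Fin 1) :
    medianCost (d := 1) (pairInstance b).P c σ = |0 - c 0 0| + |(b : ℝ) - c 0 0| := by
  have h := List.sum_toFinset (fun a : Fin 1 → ℚ => ‖toEuclidean a - c (σ a)‖)
    (nodup_points_pairInstance hb)
  refine h.trans ?_
  have hσ : ∀ a, σ a = 0 := fun a => Subsingleton.elim _ _
  simp [pairInstance, hσ, toEuclidean, EuclideanSpace.norm_eq, Real.sqrt_sq_eq_abs]

theorem pairInstance_two_mem_medianYes {C : ℝ} (hC : 1 / Real.log 2 ≤ C) :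
    pairInstance 2 ∈ medianYes C := by
  refine ⟨isValid_pairInstance two_pos hC, fun _ => toEuclidean fun _ => 1, fun _ => (0 : Fin 1), ?_⟩
  refine (medianCost_pairInstance two_pos _ _).trans_le ?_
  rw [card_P_pairInstance two_pos]
  norm_num [toEuclidean]

theorem pairInstance_mem_medianNo {b : ℕ} (hb : 0 < b) {C β : ℝ} (hC : 1 / Real.log 2 ≤ C)
    (hβ : β * 2 ≤ b) : pairInstance b ∈ medianNo C β := by
  refine ⟨isValid_pairInstance hb hC, fun c σ => ?_⟩
  rw [card_P_pairInstance hb]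
  refine le_trans ?_ (medianCost_pairInstance hb c σ).ge
  have h : ∀ t : ℝ, (b : ℝ) ≤ |0 - t| + |(b : ℝ) - t| := fun t => by
    have h₁ := neg_abs_le (0 - t)
    have h₂ := le_abs_self ((b : ℝ) - t)
    linarith
  exact hβ.trans (h _)

theorem finite_setOf_nodup {α : Type*} [DecidableEq α] {A : Set α} (hA : A.Finite) :
    {l : List α | l.Nodup ∧ ∀ x ∈ l, x ∈ A}.Finite := by
  refine ((hA.toFinset.powerset).finite_toSet.biUnion fun s _ =>
    (s.toList.permutations.toFinset).finite_toSet).subset ?_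
  rintro l ⟨hl, hA'⟩
  rw [Set.mem_iUnion₂]
  refine ⟨l.toFinset, ?_, ?_⟩
  · rw [mem_coe, mem_powerset]
    intro x hx
    exact hA.mem_toFinset.mpr (hA' x (List.mem_toFinset.mp hx))
  · rw [mem_coe, List.mem_toFinset, List.mem_permutations]
    exact (List.toFinset_toList hl).symm

namespace JohnsonInstance

theorem enc_injective : Function.Injective enc := by
  rintro ⟨n, k, l⟩ ⟨n', k', l'⟩ h
  rw [enc_eq, enc_eq] at h
  have h₁ := congrArg (List.takeWhile notComma) h
  rw [takeWhile_notComma (comma_notMem_encNat _), takeWhile_notComma (comma_notMem_encNat _)] at h₁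
  have h₂ := congrArg afterComma h
  rw [afterComma_append (comma_notMem_encNat _), afterComma_append (comma_notMem_encNat _)] at h₂
  have h₃ := congrArg (List.takeWhile notComma) h₂
  rw [takeWhile_notComma (comma_notMem_encNat _), takeWhile_notComma (comma_notMem_encNat _)] at h₃
  have h₄ := congrArg (fun s => parseSets (afterComma s)) h₂
  simp only [afterComma_append (comma_notMem_encNat _), parseSets_encList] at h₄
  have hinj : Function.Injective fun T : List ℕ => (T.map fun i => (encNat i).reverse).reverse :=
    List.reverse_injective.comp
      (List.map_injective_iff.mpr (List.reverse_injective.comp encNat_injective))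
  have h₅ := List.map_injective_iff.mpr hinj (List.reverse_injective h₄)
  rw [JohnsonInstance.mk.injEq]
  exact ⟨encNat_injective h₁, encNat_injective h₃, h₅⟩

/-- With `k ≥ #E` each set may receive a `y`-subset of its own; surplus indices reuse that of a
fixed set `F₀`. -/
theorem IsValid.mem_johnsonYes {I : JohnsonInstance} {z y : ℕ} (hI : I.IsValid z) (hyz : y ≤ z)
    (hk : #I.E ≤ I.k) : I ∈ johnsonYes z y := by
  refine ⟨hI, ?_⟩
  have hsub : ∀ F ∈ I.E, ∃ S ∈ (Icc 1 I.n).powersetCard y, S ⊆ F := by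
    intro F hF
    obtain ⟨S, hS, hS'⟩ := exists_subset_card_eq ((hI.card_of_mem_E hF).symm ▸ hyz)
    exact ⟨S, mem_powersetCard.mpr ⟨hS.trans (hI.subset_of_mem_E hF), hS'⟩, hS⟩
  choose! S hS hSF using hsub
  have hne : I.E.Nonempty := by
    obtain ⟨T, hT⟩ := List.exists_mem_of_ne_nil _ hI.2.1
    exact ⟨_, mem_E.mpr ⟨T, hT, rfl⟩⟩
  obtain ⟨F₀, hF₀⟩ := hne
  set G : Fin I.k → Finset ℕ := fun j =>
    if h : (j : ℕ) < #I.E then (I.E.equivFin.symm ⟨j, h⟩ : Finset ℕ) else F₀ with hG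
  have hGE : ∀ j, G j ∈ I.E := by
    intro j
    by_cases h : (j : ℕ) < #I.E
    · simp only [hG, dif_pos h]
      exact (I.E.equivFin.symm ⟨j, h⟩).2
    · simpa only [hG, dif_neg h]
  refine ⟨fun j => S (G j), fun j => hS _ (hGE j), ?_⟩
  refine Subset.antisymm (biUnion_subset.mpr fun j _ => filter_subset _ _) fun F hF => ?_
  rw [covFamily, mem_biUnion]
  refine ⟨⟨I.E.equivFin ⟨F, hF⟩, (I.E.equivFin ⟨F, hF⟩).2.trans_le hk⟩, mem_univ _, ?_⟩
  rw [cov, mem_filter]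
  refine ⟨hF, ?_⟩
  have : G ⟨I.E.equivFin ⟨F, hF⟩, (I.E.equivFin ⟨F, hF⟩).2.trans_le hk⟩ = F := by
    simp [hG]
  rw [this]
  exact hSF F hF

/-- For bounded `n` the collection ranges over a finite set but `k` does not. An instance that is
not a Yes-instance has `k < #E ≤ 2 ^ n`, however, so finitely many remain. -/
theorem finite_setOf_notMem_johnsonYes {z y : ℕ} (hyz : y ≤ z) (n : ℕ) :
    {I : JohnsonInstance | I.IsValid z ∧ I.n ≤ n ∧ I ∉ johnsonYes z y}.Finite := by
  have h₁ : {T : List ℕ | T.Nodup ∧ ∀ i ∈ T, i ∈ Set.Iic n}.Finite :=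
    finite_setOf_nodup (Set.finite_Iic n)
  have h₂ := finite_setOf_nodup h₁
  refine (((Set.finite_Iic n).prod ((Set.finite_Iic (2 ^ n)).prod h₂)).image
    fun p => (⟨p.1, p.2.1, p.2.2⟩ : JohnsonInstance)).subset ?_
  rintro I ⟨hI, hn, hyes⟩
  refine ⟨(I.n, I.k, I.sets), ⟨hn, ?_, hI.2.2.1, fun T hT => ⟨hI.nodup hT, fun i hi => ?_⟩⟩, rfl⟩
  · have h₃ : #I.E ≤ 2 ^ I.n := by
      have : I.E ⊆ (Icc 1 I.n).powerset := fun F hF => mem_powerset.mpr (hI.subset_of_mem_E hF)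
      simpa using card_le_card this
    have h₄ : I.k < #I.E := not_le.mp fun h => hyes (hI.mem_johnsonYes hyz h)
    exact (h₄.le.trans h₃).trans (Nat.pow_le_pow_right two_pos hn)
  · exact ((hI.2.2.2 T hT).2.2 i hi).2.trans hn

theorem notMem_johnsonYes_of_mem_johnsonNo {I : JohnsonInstance} {z y : ℕ} {α : ℝ} (hα : α < 1)
    (hI : I ∈ johnsonNo α z y) : I ∉ johnsonYes z y := by
  rintro ⟨hI', S, hS, hcov⟩
  have h := hI.2 S hS
  rw [hcov, hI'.card_E] at h
  have : (0 : ℝ) < I.sets.length := by exact_mod_cast List.length_pos_of_ne_nil hI'.2.1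
  nlinarith

end JohnsonInstance

/-! ### The reduction -/

/-- Beyond `n₀` the density function exceeds the constants 2 and `2 ^ m / κ`; below `n₀` nothing is
known about it. -/
theorem exists_threshold {f : ℕ → ℝ} (hf : Filter.Tendsto f Filter.atTop Filter.atTop) {κ : ℝ}
    (hκ : 0 < κ) (m z y : ℕ) : ∃ n₀ : ℕ, ∀ I ∈ johnsonDense f z y, n₀ < I.n → 0 < I.k →
      2 ≤ #I.E ∧ 2 ^ m * (I.k * (I.n : ℝ) ^ (z - y - 1)) ≤ κ * #I.E := by
  obtain ⟨n₀, hn₀⟩ := Filter.eventually_atTop.mp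
    ((hf.eventually_ge_atTop 2).and (hf.eventually_ge_atTop (2 ^ m / κ)))
  refine ⟨n₀, fun I hI hn hk => ?_⟩
  obtain ⟨h₁, h₂⟩ := hn₀ I.n hn.le
  have hI' : f I.n * (I.k * (I.n : ℝ) ^ (z - y - 1)) ≤ #I.E := hI
  have hk' : (1 : ℝ) ≤ I.k := by exact_mod_cast hk
  have hn' : (1 : ℝ) ≤ I.n := by exact_mod_cast (by omega : 1 ≤ I.n)
  have hX : 1 ≤ I.k * (I.n : ℝ) ^ (z - y - 1) := one_le_mul_of_one_le_of_one_le hk' (one_le_pow₀ hn')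
  constructor
  · have : (2 : ℝ) ≤ #I.E := by nlinarith
    exact_mod_cast this
  · rw [div_le_iff₀ hκ] at h₂
    have := mul_le_mul_of_nonneg_right h₂ (zero_le_one.trans hX)
    nlinarith

/-- The points `0` and `2` with one center have optimal cost 2, equal to their number, so this
instance is valid for both cases. The hardness hypothesis only supplies a polynomial-time machine to
follow with a constant function. -/
theorem medianNPHardWithin_of_le_one {α β : ℝ} {z y : ℕ} (hβ : β ≤ 1)
    (h : JohnsonCoverageStarNPHard α z y) : MedianNPHardWithin β := by
  obtain ⟨f, -, h⟩ := h
  refine ⟨1 / Real.log 2, fun L hL => ?_⟩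
  obtain ⟨F, ⟨hF⟩, -⟩ := h L hL
  refine ⟨fun _ => pairInstance 2,
    comp_ptf hF (PTF.const (pairInstance 2).enc) (fun _ => pairInstance 2) fun _ => rfl,
    fun x => ⟨fun _ => pairInstance_two_mem_medianYes le_rfl, fun _ => ?_⟩⟩
  exact pairInstance_mem_medianNo two_pos le_rfl (by push_cast; linarith)

/-- For universes of at most `n₀` elements the answer is fixed: the finitely many valid instances
that are not Yes-instances are listed in `bad` and sent to an expensive instance, all others to a
cheap one. As `α < 1`, a No-instance is not a Yes-instance and hence is found in the list. Larger
universes go through the geometric construction. -/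
theorem medianNPHardWithin_of_lt {α β : ℝ} {z y : ℕ} (hyz : y < z) (hα : α < 1)
    (hβ : β < α + (1 - α) * √(((z : ℝ) - y + 1 / 2) / (z - y)))
    (h : JohnsonCoverageStarNPHard α z y) : MedianNPHardWithin β := by
  classical
  obtain ⟨p⟩ := nonempty_params hyz hβ
  obtain ⟨f, hf, h⟩ := h
  obtain ⟨n₀, hn₀⟩ := exists_threshold hf p.κ_pos p.m z y
  obtain ⟨b, hb⟩ := exists_nat_ge (β * 2)
  set C := dimConst p.e z with hC
  have hC' : 1 / Real.log 2 ≤ C := inv_log_two_le_dimConst _ _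
  have hb' : pairInstance (b + 1) ∈ medianNo C β :=
    pairInstance_mem_medianNo (Nat.succ_pos b) hC' (by push_cast; linarith)
  have hfin := (JohnsonInstance.finite_setOf_notMem_johnsonYes (y := y) hyz.le n₀).image
    JohnsonInstance.enc
  set bad : List (List Γ') := hfin.toFinset.toList with hbad
  set small : List (List Γ') := (List.range (n₀ + 1)).map encNat with hsmall
  have mem_bad : ∀ I : JohnsonInstance, I.IsValid z →
      (I.enc ∈ bad ↔ I.n ≤ n₀ ∧ I ∉ johnsonYes z y) := by
    intro I hI
    rw [hbad, mem_toList, hfin.mem_toFinset]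
    constructor
    · rintro ⟨J, ⟨-, hJ⟩, hJI⟩
      rwa [← JohnsonInstance.enc_injective hJI]
    · exact fun h => ⟨I, ⟨hI, h⟩, rfl⟩
  have mem_small : ∀ I : JohnsonInstance, I.enc.takeWhile notComma ∈ small ↔ I.n ≤ n₀ := by
    intro I
    rw [I.enc_eq, takeWhile_notComma (comma_notMem_encNat _), hsmall,
      List.mem_map_of_injective encNat_injective, List.mem_range, Nat.lt_succ_iff]
  set G : JohnsonInstance → MedianInstance := fun I =>
    if I.enc ∈ bad then pairInstance (b + 1) else if I.n ≤ n₀ then pairInstance 2 else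
      I.toMedian p.e p.K z p.u p.t with hG
  refine ⟨C, fun L hL => ?_⟩
  obtain ⟨F, ⟨hF⟩, hFL⟩ := h L hL
  have hvalid : ∀ x, (F x).IsValid z := by
    intro x
    by_cases hx : x ∈ L
    · exact ((hFL x).1 hx).1.1
    · exact ((hFL x).2 hx).1.1
  refine ⟨fun x => G (F x), ?_, fun x => ⟨fun hx => ?_, fun hx => ?_⟩⟩
  · refine comp_ptf hF (PTF.reduction (e := p.e) (K := p.K) (A := coordTable z p.u p.t)
      (fun n hn => coordTable_eq_of_le hn) small bad (pairInstance 2).enc (pairInstance (b + 1)).enc)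
      _ fun x => ?_
    rw [reduction, ← (hvalid x).enc_toMedian p.two_le_K p.le_pow p.odd_u p.lt_pow]
    simp only [hG]
    by_cases h₁ : (F x).enc ∈ bad
    · rw [if_pos h₁, decide_eq_true h₁, cond_true]
    · rw [if_neg h₁, decide_eq_false h₁, cond_false]
      by_cases h₂ : (F x).n ≤ n₀
      · rw [if_pos h₂, decide_eq_true ((mem_small _).mpr h₂), cond_true]
      · rw [if_neg h₂, decide_eq_false (mt (mem_small _).mp h₂), cond_false]
  · obtain ⟨hyes, hd⟩ := (hFL x).1 hx
    simp only [hG]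
    rw [if_neg fun h => ((mem_bad _ (hvalid x)).mp h).2 hyes]
    split_ifs with h₂
    · exact pairInstance_two_mem_medianYes hC'
    · exact p.toMedian_mem_medianYes hyz hyes (hn₀ _ hd (not_le.mp h₂) (hvalid x).1).1
  · obtain ⟨hno, hd⟩ := (hFL x).2 hx
    have hyes := JohnsonInstance.notMem_johnsonYes_of_mem_johnsonNo hα hno
    simp only [hG]
    split_ifs with h₁ h₂
    · exact hb'
    · exact absurd ((mem_bad _ (hvalid x)).mpr ⟨h₂, hyes⟩) h₁
    · obtain ⟨hE, hd'⟩ := hn₀ _ hd (not_le.mp h₂) (hvalid x).1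
      exact p.toMedian_mem_medianNo hyz hno hE hd'

theorem medianNPHardWithin_of_johnsonCoverageStarNPHard {α : ℝ} {z y : ℕ} (hyz : y < z)
    (h : JohnsonCoverageStarNPHard α z y) {ε : ℝ} (hε : 0 < ε) :
    MedianNPHardWithin (α + √(((z : ℝ) - y + 0.5) / ((z : ℝ) - y)) * (1 - α) - ε) := by
  have hw : (0 : ℝ) < (z : ℝ) - y := sub_pos.mpr (by exact_mod_cast hyz)
  rw [show (0.5 : ℝ) = 1 / 2 by norm_num]
  have hs : 1 ≤ √(((z : ℝ) - y + 1 / 2) / ((z : ℝ) - y)) := by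
    rw [Real.one_le_sqrt, one_le_div hw]
    linarith
  rcases lt_or_ge α 1 with hα | hα
  · exact medianNPHardWithin_of_lt hyz hα (by linarith) h
  -- The square root is at least 1 and `1 - α ≤ 0`, so the factor is at most `1 - ε`.
  · exact medianNPHardWithin_of_le_one (by nlinarith) h

end JCov

theorem mainTheorem8 :
    (∀ (α : ℝ) (z y : ℕ), 1 ≤ y → y < z → JCov.JohnsonCoverageStarNPHard α z y →
      ∀ ε : ℝ, 0 < ε →
        JCov.MedianNPHardWithin
          (α + Real.sqrt (((z : ℝ) - (y : ℝ) + 0.5) / ((z : ℝ) - (y : ℝ))) * (1 - α) - ε)) ∧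
    (JCov.JCHStar →
      ∀ ε : ℝ, 0 < ε →
        JCov.MedianNPHardWithin
          (1 - 1 / Real.exp 1 + Real.sqrt (3 / 2) / Real.exp 1 - ε)) := by
  refine ⟨fun α z y _ hyz h ε hε =>
    JCov.medianNPHardWithin_of_johnsonCoverageStarNPHard hyz h hε, fun h ε hε => ?_⟩
  obtain ⟨z, hz, h⟩ := h ε hε
  have hs : Real.sqrt (3 / 2) < 2 := (Real.sqrt_lt' two_pos).mpr (by norm_num)
  -- With `α = 1 - 1/e + ε` the factor of part (a) has the surplus `ε * (1 - √(3/2))`; subtracting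
  -- `ε * (2 - √(3/2))` leaves a total error of exactly `-ε`.
  have h' := JCov.medianNPHardWithin_of_johnsonCoverageStarNPHard (by omega) h
    (ε := ε * (2 - Real.sqrt (3 / 2))) (mul_pos hε (by linarith))
  have hw : (z : ℝ) - ((z - 1 : ℕ) : ℝ) = 1 := by
    rw [Nat.cast_sub (by omega)]
    push_cast
    ring
  rw [hw, show ((1 : ℝ) + 0.5) / 1 = 3 / 2 by norm_num] at h'
  convert h' using 1
  ring
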